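/- Let $k$ be a field. If $\operatorname{char} k=0$, let $\mathcal M=K_0(\mathrm{Var}_k)$ be the Grothendieck ring of varieties (generated by classes of finite type $k$-schemes, with $[Y]=[U]+[Z]$ for $Z\subset Y$ closed with open complement $U$, and $[Y][Z]=[Y\times_k Z]$); if $\operatorname{char} k>0$, let $\mathcal M$ be the quotient of $K_0(\mathrm{Var}_k)$ by the relations $[Y]=[Z]$ for every surjective universally injective $k$-morphism $Y\to Z$ of finite type $k$-schemes. Put $\mathbf L=[\mathbb A^1]\in\mathcal M$. Let $X$ be a geometrically irreducible variety (reduced separated scheme of finite type) over $k$. For a finite group $H$ acting on a separated finite type $k$-scheme $V$ and an $H$-invariant locally closed $W\subseteq V$, $[W/H]\in\mathcal M$ denotes the class of the quotient (a scheme if $V$ is quasi-projective; in general the sum of the classes of the quotients of the parts in a partition of $W$ into finitely many invariant locally closed parts that have quotient schemes). Let $[\operatorname{Sym}^n X]=[X^n/\mathfrak S_n]$ and $\mathbf Z_X(t)=\sum_{n\ge 0}[\operatorname{Sym}^nX]\,t^n\in\mathcal M[[t]]$. For a partition $\mu$ (a finite multiset of positive integers), let $[w_\mu(X)]$ be the class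 of the space of $|\mu|$ distinct geometric points of $X$ labelled by the elements of $\mu$, i.e. of the quotient of the complement of the big diagonal in $X^{|\mu|}$ by the permutations preserving the labels. Write $\nu\le\mu$ if $\mu$ is obtained from $\nu$ by repeatedly replacing two parts by their sum, put $\overline w_\nu=\sum_{\nu\le\mu}[w_\mu(X)]$, and $$\overline K_{1^\bullet\nu}(t)=\sum_{j\ge 0}\overline w_{1^j\nu}\,t^j\in\mathcal M[[t]],$$ where $1^j\nu$ is $\nu$ with $j$ further parts equal to $1$. Likewise $ab^r$ is the partition with one part $a$ and $r$ further parts $b$. Let $a,b,r$ be integers with $1<a\le b$ and $r\ge 0$. Then $\mathbf Z_X(t)$ has constant coefficient $1$, and in the ring $\mathcal M((t))$ of Laurent series $$\overline K_{1^\bullet ab^r}(t)=\overline K_{1^\bullet b^r}(t)\,t^{-a}-\frac{\mathbf Z_X(t)\,t^{-a}}{\mathbf Z_X(t^a)}\,[\operatorname{Sym}^rX]$$ and $$\overline K_{1^\bullet ab^r}(t)=t^{-a-rb}\left(\mathbf Z_X(t)-\frac{\mathbf Z_X(t)}{\mathbf Z_X(t^b)}\sum_{i=0}^{r-1}[\operatorname{Sym}^iX]\,t^{bi}-\frac{\mathbf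 Z_X(t)}{\mathbf Z_X(t^a)}\,[\operatorname{Sym}^rX]\,t^{rb}\right).$$ If $X=\mathbb A^d$ with $d\ge 0$, and $\mathbf M=\mathbf L^d$, then $\mathbf Z_X(t)=1/(1-\mathbf Mt)$ and $$\overline K_{1^\bullet ab^r}(t)=\frac{\mathbf M^{r+1}}{1-\mathbf Mt}.$$ -/

import Mathlib

open CategoryTheory CategoryTheory.Limits AlgebraicGeometry
open scoped PowerSeries LaurentSeries

universe u

namespace MotivicConf

/-! ## The Grothendieck ring of varieties -/

/-- Schemes over `Spec k`. -/
abbrev SchOver (k : Type u) [Field k] : Type (u + 1) :=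
  Over (Spec (CommRingCat.of k))

/-- Schemes of finite type over a field `k`. -/
structure FTScheme (k : Type u) [Field k] : Type (u + 1) where
  obj : SchOver k
  [locallyOfFiniteType : LocallyOfFiniteType obj.hom]
  [quasiCompact : QuasiCompact obj.hom]

attribute [instance] FTScheme.locallyOfFiniteType FTScheme.quasiCompact

/-- The product over `k` of two finite type `k`-schemes. -/
noncomputable def FTScheme.prod {k : Type u} [Field k] (Y Z : FTScheme k) : FTScheme k where
  obj := Over.mk (pullback.fst Y.obj.hom Z.obj.hom ≫ Y.obj.hom)
  locallyOfFiniteType := by dsimp; infer_instance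
  quasiCompact := by dsimp; infer_instance

/-- The relators of the Grothendieck ring: `[Y] = [Z]` for isomorphic `Y`, `Z`; the scissor
relation `[Y] = [U] + [Z]` for `Z` closed in `Y` with open complement `U`; `[Spec k] = 1` and
`[Y][Z] = [Y ×ₖ Z]`; and, only when `k` has positive characteristic, `[Y] = [Z]` whenever there is
a surjective, universally injective (i.e. radicial) `k`-morphism `Y ⟶ Z`. -/
inductive Relator (k : Type u) [Field k] : FreeCommRing (FTScheme k) → Prop
  | iso (Y Z : FTScheme k) (e : Y.obj ≅ Z.obj) :
      Relator k (FreeCommRing.of Y - FreeCommRing.of Z)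
  | scissor (Y U Z : FTScheme k) (j : U.obj ⟶ Y.obj) (i : Z.obj ⟶ Y.obj)
      (hj : IsOpenImmersion j.left) (hi : IsClosedImmersion i.left)
      (hij : IsCompl (Set.range j.left) (Set.range i.left)) :
      Relator k (FreeCommRing.of Y - (FreeCommRing.of U + FreeCommRing.of Z))
  | one (Y : FTScheme k) (hY : IsIso Y.obj.hom) :
      Relator k (FreeCommRing.of Y - 1)
  | mul (Y Z : FTScheme k) :
      Relator k (FreeCommRing.of Y * FreeCommRing.of Z - FreeCommRing.of (Y.prod Z))
  | radicial (hk : ringChar k ≠ 0) (Y Z : FTScheme k) (f : Y.obj ⟶ Z.obj)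
      (hs : Surjective f.left) (hi : UniversallyInjective f.left) :
      Relator k (FreeCommRing.of Y - FreeCommRing.of Z)

/-- The Grothendieck ring of varieties over `k`, presented as a commutative ring. If `k` has
characteristic zero this is `K₀(Var_k)`: the first four families of relators say that the ring is
the group ring `ℤ[isomorphism classes]` modulo the ideal generated by the scissor relators, and the
subgroup generated by the scissor relators already is an ideal. If `k` has positive characteristic
it is the quotient of `K₀(Var_k)` that identifies the two ends of a radicial surjection. -/
abbrev GrothendieckRing (k : Type u) [Field k] : Type (u + 1) :=
  FreeCommRing (FTScheme k) ⧸ Ideal.span {x | Relator k x}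

/-- The class `[Y]` of a finite type `k`-scheme. -/
noncomputable def cls {k : Type u} [Field k] (Y : FTScheme k) : GrothendieckRing k :=
  Ideal.Quotient.mk _ (FreeCommRing.of Y)

/-- Affine space `𝔸ᵈ` over `k`. -/
noncomputable def affineSpace (k : Type u) [Field k] (d : ℕ) : FTScheme k where
  obj := Over.mk (𝔸(ULift.{u} (Fin d); Spec (CommRingCat.of k)) ↘ Spec (CommRingCat.of k))
  locallyOfFiniteType := by dsimp; infer_instance
  quasiCompact := by dsimp; infer_instance

/-- The Lefschetz class `𝐋 = [𝔸¹]`. -/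
noncomputable def lefschetz (k : Type u) [Field k] : GrothendieckRing k :=
  cls (affineSpace k 1)

/-- A geometrically irreducible variety over `k`: a reduced separated scheme of finite type over
`k` that is geometrically irreducible. -/
structure IsGeomIrredVariety {k : Type u} [Field k] (X : SchOver k) : Prop where
  isReduced : IsReduced X.left
  isSeparated : IsSeparated X.hom
  locallyOfFiniteType : LocallyOfFiniteType X.hom
  quasiCompact : QuasiCompact X.hom
  geometricallyIrreducible : GeometricallyIrreducible X.hom

/-! ## Classes of quotients by finite groups -/

/-- An invariant locally closed piece `S` of `V` that has a quotient. `V` is a `k`-scheme with a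
family `ρ` of endomorphisms (the automorphisms by which a finite group acts). The piece is given by
an immersion `ι : S ⟶ V` that is stable under `ρ`, and `π : S ⟶ Q` is its quotient in the usual
sense: `π` is affine and invariant, and `𝒪_Q` is the sheaf of invariants of `π_* 𝒪_S`, that is, `Q`
is glued from the schemes `Spec (A ^ H)` for invariant affine opens `Spec A` of `S`. -/
structure QuotientPiece {k : Type u} [Field k] {H : Type} (V : SchOver k)
    (ρ : H → (V ⟶ V)) : Type (u + 1) where
  S : FTScheme k
  Q : FTScheme k
  ι : S.obj ⟶ V
  isImmersion : IsImmersion ι.left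
  /-- the action on the piece -/
  act : H → (S.obj ⟶ S.obj)
  act_ι : ∀ h, act h ≫ ι = ι ≫ ρ h
  π : S.obj ⟶ Q.obj
  isAffineHom : IsAffineHom π.left
  act_π : ∀ h, act h ≫ π = π
  app_injective : ∀ U : Q.obj.left.Opens, Function.Injective (π.left.app U)
  exists_app_eq : ∀ (U : Q.obj.left.Opens) (f : Γ(S.obj.left, π.left ⁻¹ᵁ U)),
    (∀ (h : H) (hU : π.left ⁻¹ᵁ U ≤ (act h).left ⁻¹ᵁ (π.left ⁻¹ᵁ U)),
      (act h).left.appLE (π.left ⁻¹ᵁ U) (π.left ⁻¹ᵁ U) hU f = f) →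
    ∃ s : Γ(Q.obj.left, U), π.left.app U s = f

/-- The inclusion quantified over in `QuotientPiece.exists_app_eq` always holds. -/
theorem QuotientPiece.preimage_le {k : Type u} [Field k] {H : Type} {V : SchOver k}
    {ρ : H → (V ⟶ V)} (P : QuotientPiece V ρ) (U : P.Q.obj.left.Opens) (h : H) :
    P.π.left ⁻¹ᵁ U ≤ (P.act h).left ⁻¹ᵁ (P.π.left ⁻¹ᵁ U) := by
  have e : (P.act h).left ≫ P.π.left = P.π.left := by
    rw [← Over.comp_left, P.act_π]
  rw [← Scheme.Hom.comp_preimage, e]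

/-- `m` is the class `[W / H]` of the quotient of an invariant locally closed subset `W` of `V`:
`W` is partitioned into finitely many invariant locally closed pieces that have a quotient scheme,
and `m` is the sum of the classes of these quotients. If `W` itself has a quotient scheme one piece
suffices; otherwise this is the class of the quotient algebraic space. -/
def IsQuotientClass {k : Type u} [Field k] {H : Type} (V : SchOver k) (ρ : H → (V ⟶ V))
    (W : Set V.left) (m : GrothendieckRing k) : Prop :=
  ∃ (n : ℕ) (P : Fin n → QuotientPiece V ρ),
    Pairwise (fun i j => Disjoint (Set.range (P i).ι.left) (Set.range (P j).ι.left)) ∧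
    (⋃ i, Set.range (P i).ι.left) = W ∧
    m = ∑ i, cls (P i).Q

open Classical in
/-- The class `[W / H]` in the Grothendieck ring (it does not depend on the partition, which
always exists for a finite group acting on a separated scheme of finite type). -/
noncomputable def quotientClass {k : Type u} [Field k] {H : Type} (V : SchOver k)
    (ρ : H → (V ⟶ V)) (W : Set V.left) : GrothendieckRing k :=
  if h : ∃ m, IsQuotientClass V ρ W m then h.choose else 0

/-! ## Symmetric powers and configuration spaces -/

/-- The power `X ^ I` over `k`. -/
noncomputable abbrev power {k : Type u} [Field k] (X : SchOver k) (I : Type) [Finite I] :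
    SchOver k :=
  ∏ᶜ fun _ : I => X

/-- The permutation of the factors of `X ^ I` given by a permutation of `I`. -/
noncomputable def permute {k : Type u} [Field k] (X : SchOver k) {I : Type} [Finite I]
    (σ : Equiv.Perm I) : power X I ⟶ power X I :=
  Pi.lift fun i => Pi.π (fun _ : I => X) (σ i)

/-- The complement in `X ^ I` of the big diagonal, which is the union for `i ≠ j` of the closed
subschemes where the `i`-th and the `j`-th projection agree. -/
noncomputable def offDiagonal {k : Type u} [Field k] (X : SchOver k) (I : Type) [Finite I] :
    Set (power X I).left :=
  (⋃ (i : I) (j : I) (_ : i ≠ j),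
    Set.range (equalizer.ι (Pi.π (fun _ : I => X) i).left (Pi.π (fun _ : I => X) j).left))ᶜ

/-- `[Symⁿ X]`, the class of `Xⁿ / 𝔖ₙ`. -/
noncomputable def symClass {k : Type u} [Field k] (X : SchOver k) (n : ℕ) : GrothendieckRing k :=
  quotientClass (power X (Fin n)) (fun σ : Equiv.Perm (Fin n) => permute X σ) Set.univ

/-- `[w_μ(X)]`, the class of the space of `|μ|` distinct points of `X` labelled by the elements of
the multiset `μ`. It is the open subset of `Sym^μ X = ∏ Sym^{mᵢ} X` (the `mᵢ` are the multiplicities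
of the distinct elements of `μ`) in which all points are distinct, that is, the quotient of the
complement of the big diagonal in `X ^ |μ|` by the permutations that preserve the labels. -/
noncomputable def wClass {k : Type u} [Field k] (X : SchOver k) (μ : Multiset ℕ) :
    GrothendieckRing k :=
  quotientClass (power X μ.ToType)
    (fun σ : {σ : Equiv.Perm μ.ToType // ∀ p, (σ p).1 = p.1} => permute X σ.1)
    (offDiagonal X μ.ToType)

/-- `l'` arises from `l` by replacing two of its elements by their sum. -/
def ElementaryMerge (l l' : Multiset ℕ) : Prop :=
  ∃ (x y : ℕ) (s : Multiset ℕ), l = x ::ₘ y ::ₘ s ∧ l' = (x + y) ::ₘ s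

/-- The refinement ordering `l ≤ l'` on partitions: `l'` arises from `l` by merging. -/
def Refines (l l' : Multiset ℕ) : Prop :=
  Relation.ReflTransGen ElementaryMerge l l'

open Classical in
/-- `w̄_ν(X) = ∑_{ν ≤ μ} [w_μ(X)]`. -/
noncomputable def wBar {k : Type u} [Field k] (X : SchOver k) {n : ℕ} (ν : n.Partition) :
    GrothendieckRing k :=
  ∑ μ : n.Partition with Refines ν.parts μ.parts, wClass X μ.parts

/-- The motivic zeta function `Z_X(t) = ∑ₙ [Symⁿ X] tⁿ`. -/
noncomputable def zeta {k : Type u} [Field k] (X : SchOver k) : (GrothendieckRing k)⟦X⟧ :=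
  PowerSeries.mk fun n => symClass X n

/-- `K̄_{1^• ν}(t) = ∑ⱼ w̄_{1^j ν}(X) t^j`, for a multiset `ν` of positive integers. -/
noncomputable def KBar {k : Type u} [Field k] (X : SchOver k) (ν : Multiset ℕ) :
    (GrothendieckRing k)⟦X⟧ :=
  PowerSeries.mk fun j => wBar X (Nat.Partition.ofMultiset (Multiset.replicate j 1 + ν))

/-- `1 / f` for a power series `f` with constant coefficient `1`. -/
noncomputable def recip {R : Type*} [CommRing R] (f : R⟦X⟧) : R⟦X⟧ :=
  PowerSeries.invOfUnit f 1

/-- `f(t ^ a)`. -/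
noncomputable def substPow {R : Type*} [CommRing R] (f : R⟦X⟧) (a : ℕ) : R⟦X⟧ :=
  f.subst (PowerSeries.X ^ a : R⟦X⟧)

/-- `t ^ m` as a Laurent series, for an integer `m`. -/
noncomputable def tPow {R : Type*} [CommRing R] (m : ℤ) : R⸨X⸩ :=
  HahnSeries.single m 1

end MotivicConf

/-!
The idea of the proof is to replace identities between classes of quotients by bijections between
sets of geometric points. A morphism that is bijective on geometric points preserves the class
(`cls_eq_of_geomPt_bijective`): in positive characteristic this is a defining relation, and in
characteristic zero such a morphism is, up to nilpotents, an isomorphism over a nonempty open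
subset of the target. By Chevalley's theorem it follows that two quotients of one scheme with the
same geometric fibres have the same class (`cls_eq_of_geomPt_fibres`). The predicate `HasClass`
expresses that an element of the Grothendieck ring is the class of a family of sets of geometric
points modulo an equivalence relation; it is compatible with finite disjoint unions and products,
and determines the class whenever the relation is given by finitely many endomorphisms
(`HasClass.unique`). The class `[W / H]` is of this kind for the orbits of the finite group `H`
(`IsQuotientClass.hasClass`), and it exists (`exists_isQuotientClass`).

In these terms `[Symⁿ X]` is the class of the effective zero-cycles of degree `n`, and `[w_μ]` is
the class of the cycles whose multiplicities form the partition `μ`. The series in the theorem thus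
count cycles with conditions on their multiplicities. Division with remainder of the multiplicities
by `b` writes a cycle as `b E + D`. If `a ≤ b`, then `(E, D) ↦ b E + D` is injective on the pairs
in which all multiplicities of `D` are less than `a`, and this gives `symClass_mul_wSum`: the
cycles with `deg E = r` for which `D` has multiplicities less than `a` have the generating series
`[Symʳ X] t^(r b) · Z(t) / Z(t ^ a)`. On the other hand, `μ` is a merging of `1^j b^r` iff
`deg E ≥ r`, and of `1^j a b^r` iff moreover `deg E > r` or `D` has a multiplicity at least `a`
(`refines_one_replicate_iff`, `refines_one_cons_replicate_iff`). The cycles that satisfy the first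
condition but not the second are those with `deg E = r` for which `D` has multiplicities less than
`a`. This is the first formula, and the second one follows from it, since its case `a = b`, summed
over `r`, computes the series of the cycles with `deg E ≥ r`.

For `X = 𝔸ᵈ` the formulas reduce to `[Symⁿ 𝔸ᵈ] = 𝐋^(d n)`, which is proved without the theory of
vector bundles by a constructible bijection on geometric points: a multiset of `n` vectors in
`K ^ d` is determined by the polynomial of degree `n` whose roots are the first coordinates and, for a
root of multiplicity `m`, by a multiset of `m` vectors in `K ^ (d - 1)`. By induction the latter
amounts to `d - 1` jets of length `m` at this root, and Hermite interpolation combines the jets at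
all the roots into `d - 1` polynomials of degree less than `n` (`Corr`, `Corr.vectors_eq_iff`).
-/

universe v w

namespace MotivicConf

section

/-! ### Geometric points -/

/-- A geometric point of `Spec k`: an algebraically closed field `K` together with a morphism
`Spec K ⟶ Spec k`. -/
structure GeomPt (k : Type u) [Field k] : Type (u + 1) where
  K : Type u
  [field : Field K]
  [isAlgClosed : IsAlgClosed K]
  str : Spec (CommRingCat.of K) ⟶ Spec (CommRingCat.of k)

attribute [instance] GeomPt.field GeomPt.isAlgClosed

variable {k : Type u} [Field k]

/-- The spectrum of the algebraically closed field, as a scheme over `k`. -/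
noncomputable abbrev GeomPt.pt (Ω : GeomPt k) : SchOver k := Over.mk Ω.str

/-- The unique topological point of `Spec K`. -/
noncomputable abbrev GeomPt.closedPt (Ω : GeomPt k) : Ω.pt.left := IsLocalRing.closedPoint Ω.K

theorem GeomPt.eq_closedPt (Ω : GeomPt k) (x : Ω.pt.left) : x = Ω.closedPt :=
  Subsingleton.elim (α := PrimeSpectrum Ω.K) _ _

/-- The topological point underlying a geometric point. -/
noncomputable abbrev GeomPt.im {Ω : GeomPt k} {Y : SchOver k} (x : Ω.pt ⟶ Y) : Y.left :=
  x.left Ω.closedPt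

theorem GeomPt.im_comp {Ω : GeomPt k} {Y Z : SchOver k} (x : Ω.pt ⟶ Y) (g : Y ⟶ Z) :
    GeomPt.im (x ≫ g) = g.left (GeomPt.im x) := by
  simp [GeomPt.im]

theorem exists_geomPt (Z : SchOver k) (z : Z.left) :
    ∃ (Ω : GeomPt k) (x : Ω.pt ⟶ Z), GeomPt.im x = z := by
  let K := AlgebraicClosure (Z.left.residueField z)
  let i : Z.left.residueField z ⟶ CommRingCat.of K :=
    CommRingCat.ofHom (algebraMap (Z.left.residueField z) K)
  let p : Spec (CommRingCat.of K) ⟶ Z.left := Spec.map i ≫ Z.left.fromSpecResidueField z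
  refine ⟨⟨K, p ≫ Z.hom⟩, Over.homMk p rfl, ?_⟩
  simp [GeomPt.im, p]

/-- A geometric point of the target whose image is in the range of a morphism of finite type lifts:
its fibre is nonempty and of finite type over an algebraically closed field, so it has a rational
point. -/
theorem exists_geomPt_lift {S Y : SchOver k} (g : S ⟶ Y) [LocallyOfFiniteType g.left]
    {Ω : GeomPt k} (y : Ω.pt ⟶ Y) (h : GeomPt.im y ∈ Set.range g.left) :
    ∃ s : Ω.pt ⟶ S, s ≫ g = y := by
  obtain ⟨s₀, hs₀⟩ := h
  obtain ⟨t, -, -⟩ := Scheme.Pullback.exists_preimage_pullback (f := g.left) (g := y.left)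
    s₀ Ω.closedPt hs₀
  have : LocallyOfFiniteType (pullback.snd g.left y.left) := inferInstance
  have hj : JacobsonSpace ↥(pullback g.left y.left) :=
    LocallyOfFiniteType.jacobsonSpace (Y := Spec (CommRingCat.of Ω.K)) (pullback.snd g.left y.left)
  have hne : (closedPoints ↥(pullback g.left y.left)).Nonempty := by
    by_contra hc
    rw [Set.not_nonempty_iff_eq_empty] at hc
    have := JacobsonSpace.closure_inter_closedPoints (X := ↥(pullback g.left y.left)) isClosed_univ
    rw [hc] at this
    simp at this
    exact (Set.eq_empty_iff_forall_notMem.mp this.symm t) trivial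
  obtain ⟨c, hc⟩ := hne
  let q := pointOfClosedPoint (K := Ω.K) (pullback.snd g.left y.left) c hc
  have hq : q ≫ pullback.snd g.left y.left = 𝟙 _ := pointOfClosedPoint_comp _ _ _
  have hq' : (q ≫ pullback.fst g.left y.left) ≫ g.left = y.left := by
    rw [Category.assoc, pullback.condition, reassoc_of% hq]
  refine ⟨Over.homMk (q ≫ pullback.fst g.left y.left) ?_, ?_⟩
  · have := Over.w g
    have h2 := Over.w y
    rw [← this]
    rw [← Category.assoc, hq']
    exact h2
  · ext1
    exact hq'

/-- A morphism that hits all geometric points is surjective. -/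
theorem surjective_of_geomPt {Y Z : SchOver k} (g : Y ⟶ Z)
    (h : ∀ (Ω : GeomPt k) (z : Ω.pt ⟶ Z), ∃ y, y ≫ g = z) : Surjective g.left := by
  refine ⟨fun z => ?_⟩
  obtain ⟨Ω, x, rfl⟩ := exists_geomPt Z z
  obtain ⟨y, rfl⟩ := h Ω x
  exact ⟨GeomPt.im y, (GeomPt.im_comp y g).symm⟩

/-- Injectivity on geometric points implies injectivity on points with values in any field `K`,
since `Spec` of the algebraic closure of `K` is an epimorphic cover of `Spec K`. -/
theorem universallyInjective_of_geomPt {Y Z : SchOver k} (g : Y ⟶ Z)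
    (h : ∀ (Ω : GeomPt k), Function.Injective fun y : Ω.pt ⟶ Y => y ≫ g) :
    UniversallyInjective g.left := by
  refine ((tfae_universallyInjective g.left).out 0 1).mpr ?_
  intro K _ y₁ y₂ h12
  let i : CommRingCat.of K ⟶ CommRingCat.of (AlgebraicClosure K) :=
    CommRingCat.ofHom (algebraMap K (AlgebraicClosure K))
  have hfl : Flat (Spec.map i) := by
    rw [Flat.SpecMap_iff]
    exact (RingHom.flat_algebraMap_iff).mpr inferInstance
  have hsu : Surjective (Spec.map i) :=
    ⟨fun x => ⟨IsLocalRing.closedPoint (AlgebraicClosure K),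
      Subsingleton.elim (α := PrimeSpectrum K) _ _⟩⟩
  have : Epi (Spec.map i) := Flat.epi_of_flat_of_surjective _
  have hs : y₁ ≫ Y.hom = y₂ ≫ Y.hom := by
    rw [← Over.w g, ← Category.assoc, ← Category.assoc]
    exact congrArg (· ≫ Z.hom) h12
  rw [← cancel_epi (Spec.map i)]
  let Ω : GeomPt k := ⟨AlgebraicClosure K, Spec.map i ≫ y₁ ≫ Y.hom⟩
  let z₁ : Ω.pt ⟶ Y := Over.homMk (Spec.map i ≫ y₁) (by simp [Ω])
  let z₂ : Ω.pt ⟶ Y := Over.homMk (Spec.map i ≫ y₂) (by simp [Ω, hs])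
  have := @h Ω z₁ z₂ (by
    ext1
    simp only [Over.comp_left]
    change (Spec.map i ≫ y₁) ≫ g.left = (Spec.map i ≫ y₂) ≫ g.left
    simp only [Category.assoc]
    exact congrArg (Spec.map i ≫ ·) h12)
  exact congrArg (·.left) this

theorem geomPt_injective_of_mono {Y Z : SchOver k} (g : Y ⟶ Z) [Mono g.left] (Ω : GeomPt k) :
    Function.Injective fun y : Ω.pt ⟶ Y => y ≫ g := by
  intro a b h
  have := Over.mono_of_mono_left g
  exact (cancel_mono g).mp h

theorem mem_range_iff_exists_geomPt {S Y : SchOver k} (g : S ⟶ Y) [LocallyOfFiniteType g.left]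
    {Ω : GeomPt k} (y : Ω.pt ⟶ Y) :
    GeomPt.im y ∈ Set.range g.left ↔ ∃ s : Ω.pt ⟶ S, s ≫ g = y := by
  refine ⟨exists_geomPt_lift g y, ?_⟩
  rintro ⟨s, rfl⟩
  exact ⟨GeomPt.im s, (GeomPt.im_comp s g).symm⟩

end

section

variable {k : Type u} [Field k]

/-! ### Subschemes of schemes of finite type and their classes -/

instance FTScheme.isNoetherian (Y : FTScheme k) : IsNoetherian Y.obj.left := by
  have h1 : IsLocallyNoetherian Y.obj.left :=
    LocallyOfFiniteType.isLocallyNoetherian Y.obj.hom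
  have h2 : CompactSpace Y.obj.left := by
    have := (quasiCompact_iff_compactSpace (f := Y.obj.hom)).mp inferInstance
    exact this
  exact { h1, h2 with }

instance FTScheme.locallyOfFiniteType_left {Y : SchOver k} {S : FTScheme k} (g : S.obj ⟶ Y) :
    LocallyOfFiniteType g.left := by
  have : LocallyOfFiniteType (g.left ≫ Y.hom) := by rw [Over.w g]; infer_instance
  exact locallyOfFiniteType_of_comp g.left Y.hom

/-- The source of an immersion into a scheme of finite type, as a scheme of finite type. -/
noncomputable def FTScheme.ofImmersion (Y : FTScheme k) {S : Scheme.{u}} (i : S ⟶ Y.obj.left)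
    [IsImmersion i] : FTScheme k where
  obj := Over.mk (i ≫ Y.obj.hom)
  locallyOfFiniteType := by dsimp; infer_instance
  quasiCompact := by
    have : TopologicalSpace.NoetherianSpace S := i.isEmbedding.isInducing.noetherianSpace
    dsimp
    infer_instance

/-- The inclusion of the source of an immersion. -/
noncomputable def FTScheme.ofImmersionι (Y : FTScheme k) {S : Scheme.{u}} (i : S ⟶ Y.obj.left)
    [IsImmersion i] : (Y.ofImmersion i).obj ⟶ Y.obj := Over.homMk i rfl

/-- Open subschemes. -/
noncomputable abbrev FTScheme.restrict (Y : FTScheme k) (U : Y.obj.left.Opens) : FTScheme k :=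
  Y.ofImmersion U.ι

theorem isReduced_subscheme_vanishingIdeal {Y : Scheme.{u}} (Z : TopologicalSpace.Closeds Y) :
    IsReduced (Scheme.IdealSheafData.vanishingIdeal Z).subscheme := by
  have : ∀ i, IsReduced
      ((Scheme.IdealSheafData.vanishingIdeal Z).subschemeCover.openCover.X i) := by
    intro U
    change IsReduced (Spec (CommRingCat.of
      (Γ(Y, U.1) ⧸ (Scheme.IdealSheafData.vanishingIdeal Z).ideal U)))
    have : _root_.IsReduced (Γ(Y, U.1) ⧸ (Scheme.IdealSheafData.vanishingIdeal Z).ideal U) := by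
      rw [← Ideal.isRadical_iff_quotient_reduced]
      exact PrimeSpectrum.isRadical_vanishingIdeal _
    infer_instance
  exact IsReduced.of_openCover _ (Scheme.IdealSheafData.vanishingIdeal Z).subschemeCover.openCover

/-- Locally closed subsets carry a structure of reduced scheme of finite type. -/
theorem FTScheme.exists_reduced (Y : FTScheme k) {L : Set Y.obj.left} (hL : IsLocallyClosed L) :
    ∃ (S : FTScheme k) (ι : S.obj ⟶ Y.obj), IsReduced S.obj.left ∧ IsImmersion ι.left ∧
      Set.range ι.left = L := by
  obtain ⟨U, Z, hU, hZ, rfl⟩ := hL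
  let U' : Y.obj.left.Opens := ⟨U, hU⟩
  let Z' : TopologicalSpace.Closeds U' := ⟨U'.ι ⁻¹' Z, hZ.preimage U'.ι.continuous⟩
  let i := (Scheme.IdealSheafData.vanishingIdeal Z').subschemeι ≫ U'.ι
  refine ⟨Y.ofImmersion i, Y.ofImmersionι i, isReduced_subscheme_vanishingIdeal Z',
    inferInstanceAs (IsImmersion i), ?_⟩
  change Set.range i = _
  have h1 := (Scheme.IdealSheafData.vanishingIdeal Z').range_subschemeι
  rw [Scheme.Hom.comp_base, TopCat.coe_comp, Set.range_comp, h1]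
  rw [Scheme.IdealSheafData.coe_support_vanishingIdeal]
  change U'.ι '' (U'.ι ⁻¹' Z) = _
  rw [Set.image_preimage_eq_inter_range, Scheme.Opens.range_ι, Set.inter_comm]
  rfl

theorem FTScheme.exists_reduced_closed (Y : FTScheme k) {L : Set Y.obj.left} (hL : IsClosed L) :
    ∃ (S : FTScheme k) (ι : S.obj ⟶ Y.obj), IsReduced S.obj.left ∧ IsClosedImmersion ι.left ∧
      Set.range ι.left = L := by
  obtain ⟨S, ι, h1, h2, h3⟩ := Y.exists_reduced hL.isLocallyClosed
  exact ⟨S, ι, h1, .of_isPreimmersion _ (h3 ▸ hL), h3⟩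

theorem le_ker_of_range_subset {T Z Y : Scheme.{u}} (i : Z ⟶ Y) (g : T ⟶ Y)
    [IsReduced T] (h : Set.range g ⊆ Set.range i) : i.ker ≤ g.ker := by
  refine Scheme.IdealSheafData.le_ofIdeals_iff.mpr fun U s hs => ?_
  have hs' : i.app U s = 0 := i.ideal_ker_le U hs
  change g.app U s = 0
  apply eq_zero_of_basicOpen_eq_bot
  rw [← Scheme.Hom.preimage_basicOpen, ← le_bot_iff]
  intro t ht
  obtain ⟨z, hz⟩ := h ⟨t, rfl⟩
  have : z ∈ i ⁻¹ᵁ (Y.basicOpen s) := by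
    change i z ∈ Y.basicOpen s
    rw [hz]
    exact ht
  rw [Scheme.Hom.preimage_basicOpen, hs'] at this
  simp at this

/-- A morphism from a reduced scheme factors through every immersion that contains its image. -/
theorem exists_lift_of_range_subset {T Z Y : SchOver k} (i : Z ⟶ Y) (g : T ⟶ Y)
    [IsImmersion i.left] [IsReduced T.left] (h : Set.range g.left ⊆ Set.range i.left) :
    ∃ l : T ⟶ Z, l ≫ i = g := by
  let U := i.left.coborderRange
  let c := i.left.liftCoborder
  have hcU : c ≫ U.ι = i.left := i.left.liftCoborder_ι
  have hgU : Set.range g.left ⊆ Set.range U.ι := by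
    refine h.trans ?_
    rw [← hcU]
    rintro _ ⟨z, rfl⟩
    exact ⟨c z, by simp⟩
  let g' := IsOpenImmersion.lift U.ι g.left hgU
  have hg' : g' ≫ U.ι = g.left := IsOpenImmersion.lift_fac _ _ _
  have hr : Set.range g' ⊆ Set.range c := by
    rintro _ ⟨t, rfl⟩
    obtain ⟨z, hz⟩ := h ⟨t, rfl⟩
    refine ⟨z, U.ι.isOpenEmbedding.injective ?_⟩
    rw [← Scheme.Hom.comp_apply, ← Scheme.Hom.comp_apply, hcU, hg', hz]
  let l := IsClosedImmersion.lift c g' (le_ker_of_range_subset c g' hr)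
  have hl : l ≫ i.left = g.left := by
    rw [← hcU, ← hg', IsClosedImmersion.lift_fac_assoc]
  refine ⟨Over.homMk l ?_, ?_⟩
  · rw [← Over.w i, reassoc_of% hl, Over.w g]
  · ext1; exact hl

theorem cls_scissor {Y U Z : FTScheme k} (j : U.obj ⟶ Y.obj) (i : Z.obj ⟶ Y.obj)
    (hj : IsOpenImmersion j.left) (hi : IsClosedImmersion i.left)
    (hij : IsCompl (Set.range j.left) (Set.range i.left)) : cls Y = cls U + cls Z := by
  have := (Ideal.Quotient.eq).mpr (Ideal.subset_span (Relator.scissor Y U Z j i hj hi hij))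
  rw [map_add] at this
  exact this

theorem cls_mul (Y Z : FTScheme k) : cls Y * cls Z = cls (Y.prod Z) := by
  have := (Ideal.Quotient.eq).mpr (Ideal.subset_span (Relator.mul Y Z))
  rw [map_mul] at this
  exact this

theorem cls_one (Y : FTScheme k) (hY : IsIso Y.obj.hom) : cls Y = 1 := by
  have := (Ideal.Quotient.eq).mpr (Ideal.subset_span (Relator.one Y hY))
  rwa [map_one] at this

theorem cls_isEmpty (Y : FTScheme k) [IsEmpty Y.obj.left] : cls Y = 0 := by
  have := cls_scissor (𝟙 Y.obj) (𝟙 Y.obj) (by dsimp; infer_instance) (by dsimp; infer_instance)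
    (by rw [Set.range_eq_empty, isCompl_iff]; simp)
  simpa using this

/-- The empty scheme. -/
noncomputable def FTScheme.empty (k : Type u) [Field k] : FTScheme k where
  obj := Over.mk (Scheme.emptyTo (Spec (CommRingCat.of k)))
  locallyOfFiniteType := by dsimp; infer_instance
  quasiCompact := by
    have : TopologicalSpace.NoetherianSpace (∅ : Scheme.{u}) :=
      TopologicalSpace.Finite.to_noetherianSpace
    dsimp
    infer_instance

instance : IsEmpty (FTScheme.empty k).obj.left := inferInstanceAs (IsEmpty (∅ : Scheme.{u}))

/-- The morphism from the empty scheme. -/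
noncomputable def FTScheme.emptyTo (Y : SchOver k) : (FTScheme.empty k).obj ⟶ Y :=
  Over.homMk (Scheme.emptyTo Y.left) (Scheme.empty_ext _ _)

/-- Surjective closed immersions preserve the class: the scissor relation has empty open part. -/
theorem cls_eq_of_closedImmersion {Y Z : FTScheme k} (i : Z.obj ⟶ Y.obj)
    [IsClosedImmersion i.left] (hi : Function.Surjective i.left) : cls Y = cls Z := by
  have h := cls_scissor (FTScheme.emptyTo Y.obj) i
    (inferInstanceAs (IsOpenImmersion (Scheme.emptyTo Y.obj.left))) inferInstance
    (by rw [Set.range_eq_empty, hi.range_eq]; exact isCompl_bot_top)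
  rw [h, cls_isEmpty, zero_add]

end

section

variable {k : Type u} [Field k]

/-! ### Morphisms that are bijective on geometric points -/

/-- Bijectivity on geometric points is inherited by the restriction of `f` over a subscheme of the
target. -/
theorem geomPt_bijective_of_range_eq {Y Z : SchOver k} {Y' Z' : FTScheme k} (f : Y ⟶ Z)
    (i : Z'.obj ⟶ Z) (j : Y'.obj ⟶ Y) (f' : Y'.obj ⟶ Z'.obj) (w : f' ≫ i = j ≫ f)
    [Mono i.left] [Mono j.left] (hr : Set.range j.left = f.left ⁻¹' Set.range i.left)
    (h : ∀ Ω : GeomPt k, Function.Bijective fun y : Ω.pt ⟶ Y => y ≫ f) (Ω : GeomPt k) :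
    Function.Bijective fun y : Ω.pt ⟶ Y'.obj => y ≫ f' := by
  refine ⟨fun a b hab => geomPt_injective_of_mono j Ω ((h Ω).1 ?_), fun z => ?_⟩
  · dsimp at hab ⊢
    rw [Category.assoc, Category.assoc, ← w, reassoc_of% hab]
  · obtain ⟨y, hy⟩ := (h Ω).2 (z ≫ i)
    dsimp at hy
    obtain ⟨y', rfl⟩ := exists_geomPt_lift j y (by
      rw [hr, Set.mem_preimage, ← GeomPt.im_comp, hy, GeomPt.im_comp]
      exact ⟨_, rfl⟩)
    refine ⟨y', geomPt_injective_of_mono i Ω ?_⟩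
    dsimp
    rw [Category.assoc, w, ← Category.assoc, hy]

/-- A generic point of an irreducible component has no proper generalizations. -/
theorem exists_forall_specializes_eq {X : Type*} [TopologicalSpace X] [QuasiSober X] [T0Space X]
    [Nonempty X] : ∃ η : X, ∀ y, y ⤳ η → y = η := by
  obtain ⟨x⟩ := ‹Nonempty X›
  obtain ⟨η, hη⟩ := QuasiSober.sober (isIrreducible_irreducibleComponent (x := x))
    isClosed_irreducibleComponent
  refine ⟨η, fun y hy => ?_⟩
  have h1 : closure {η} ⊆ closure {y} := hy.closure_subset
  have h2 : closure {y} ⊆ closure {η} := by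
    have := irreducibleComponent_mem_irreducibleComponents x
    rw [← hη.def] at this
    exact this.2 isIrreducible_singleton.closure h1
  exact ((specializes_iff_closure_subset.mpr h1).antisymm
    (specializes_iff_closure_subset.mpr h2)).eq

theorem isField_stalk {Z : Scheme.{u}} [IsReduced Z] (η : Z) (h : ∀ y, y ⤳ η → y = η) :
    IsField (Z.presheaf.stalk η) := by
  have : Subsingleton (PrimeSpectrum (Z.presheaf.stalk η)) := by
    refine ⟨fun p q => (Z.fromSpecStalk η).isEmbedding.injective ?_⟩
    have H : ∀ p : Spec (Z.presheaf.stalk η), Z.fromSpecStalk η p = η := fun p => h _ <| by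
      have : Z.fromSpecStalk η p ∈ Set.range (Z.fromSpecStalk η) := ⟨p, rfl⟩
      rwa [Scheme.range_fromSpecStalk] at this
    exact (H p).trans (H q).symm
  exact PrimeSpectrum.subsingleton_iff_isField_of_isReduced.mp this

theorem charZero_residueField [CharZero k] (Z : SchOver k) (z : Z.left) :
    CharZero (Z.left.residueField z) := by
  let φ := Spec.preimage (Z.left.fromSpecResidueField z ≫ Z.hom)
  exact charZero_of_injective_ringHom φ.hom.injective

/-- In characteristic zero a radicial morphism to a reduced scheme has a section over a nonempty
open set, so the two restrictions have the same class: at a generic point it induces a purely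
inseparable, hence trivial, extension of residue fields, and the inverse of that extension spreads
out. -/
theorem exists_restrict_cls_eq [CharZero k] {Y Z : FTScheme k} (f : Y.obj ⟶ Z.obj)
    (h : ∀ Ω : GeomPt k, Function.Bijective fun y : Ω.pt ⟶ Y.obj => y ≫ f)
    [IsReduced Z.obj.left] [Nonempty Z.obj.left] :
    ∃ U : Z.obj.left.Opens, (U : Set Z.obj.left).Nonempty ∧
      cls (Z.restrict U) = cls (Y.restrict (f.left ⁻¹ᵁ U)) := by
  obtain ⟨η, hη⟩ := exists_forall_specializes_eq (X := Z.obj.left)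
  have hs := surjective_of_geomPt f fun Ω => (h Ω).2
  have hi := universallyInjective_of_geomPt f fun Ω => (h Ω).1
  obtain ⟨y, rfl⟩ := hs.surj η
  -- the inverses of these two maps of fields give the section at the generic point
  have hfield := isField_stalk _ hη
  have hres : IsIso (Z.obj.left.residue (f.left y)) := by
    rw [ConcreteCategory.isIso_iff_bijective]
    let := hfield.toField
    exact ⟨RingHom.injective (Z.obj.left.residue (f.left y)).hom,
      Z.obj.left.residue_surjective (f.left y)⟩
  have hpi : (f.left.residueFieldMap y).hom.IsPurelyInseparable :=
    have H : Function.Injective f.left ∧ ∀ x, (f.left.residueFieldMap x).hom.IsPurelyInseparable :=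
      ((tfae_universallyInjective f.left).out 0 2).mp hi
    H.2 y
  have hrf : IsIso (f.left.residueFieldMap y) := by
    rw [ConcreteCategory.isIso_iff_bijective]
    have := charZero_residueField Z.obj (f.left y)
    algebraize [(f.left.residueFieldMap y).hom]
    exact IsPurelyInseparable.bijective_algebraMap_of_isSeparable
      (Z.obj.left.residueField (f.left y)) (Y.obj.left.residueField y)
  let φ : Spec (Z.obj.left.presheaf.stalk (f.left y)) ⟶ Y.obj.left :=
    Spec.map (inv (Z.obj.left.residue (f.left y))) ≫
      Spec.map (inv (f.left.residueFieldMap y)) ≫ Y.obj.left.fromSpecResidueField y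
  have hφ : φ ≫ f.left = Z.obj.left.fromSpecStalk (f.left y) ≫ 𝟙 _ := by
    simp only [φ, Category.assoc, Category.comp_id]
    rw [← f.left.SpecMap_residueFieldMap_fromSpecResidueField,
      ← Spec.map_comp_assoc (f.left.residueFieldMap y), IsIso.hom_inv_id, Spec.map_id,
      Category.id_comp]
    change Spec.map _ ≫ Spec.map _ ≫ _ = _
    rw [← Spec.map_comp_assoc, IsIso.hom_inv_id, Spec.map_id, Category.id_comp]
  obtain ⟨U, hyU, g, -, hg⟩ := spread_out_of_isGermInjective' (𝟙 _) f.left φ hφ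
  rw [Category.comp_id] at hg
  refine ⟨U, ⟨_, hyU⟩, ?_⟩
  have hgr : Set.range g ⊆ Set.range (f.left ⁻¹ᵁ U).ι := by
    rintro _ ⟨u, rfl⟩
    rw [Scheme.Opens.range_ι]
    change f.left (g u) ∈ U
    rw [← Scheme.Hom.comp_apply, hg]
    exact u.2
  let l := IsOpenImmersion.lift (f.left ⁻¹ᵁ U).ι g hgr
  have hl : l ≫ (f.left ⁻¹ᵁ U).ι = g := IsOpenImmersion.lift_fac _ _ _
  have hl' : l ≫ (f.left ⁻¹ᵁ U).ι ≫ f.left = U.ι := by rw [reassoc_of% hl, hg]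
  have : IsImmersion (l ≫ (f.left ⁻¹ᵁ U).ι ≫ f.left) := by rw [hl']; infer_instance
  -- the section is an immersion and, as `f` is injective, surjective
  have hlim : IsImmersion l := IsImmersion.of_comp l ((f.left ⁻¹ᵁ U).ι ≫ f.left)
  have hlsurj : Function.Surjective l := by
    intro v
    refine ⟨⟨f.left ((f.left ⁻¹ᵁ U).ι v), v.2⟩, (f.left ⁻¹ᵁ U).ι.isOpenEmbedding.injective
      (f.left.injective ?_)⟩
    exact congrArg (fun m : U.toScheme ⟶ Z.obj.left =>
      m ⟨f.left ((f.left ⁻¹ᵁ U).ι v), v.2⟩) hl'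
  let L : (Z.restrict U).obj ⟶ (Y.restrict (f.left ⁻¹ᵁ U)).obj := Over.homMk l (by
    change l ≫ (f.left ⁻¹ᵁ U).ι ≫ Y.obj.hom = U.ι ≫ Z.obj.hom
    rw [← Over.w f, reassoc_of% hl'])
  have : IsClosedImmersion L.left :=
    have : IsPreimmersion L.left := hlim.toIsPreimmersion
    .of_isPreimmersion _ (by
      change IsClosed (Set.range l)
      rw [hlsurj.range_eq]; exact isClosed_univ)
  exact (cls_eq_of_closedImmersion L hlsurj).symm

/-- The characteristic zero case, by Noetherian induction on the image `T` of the target in a fixed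
scheme: the statement holds over a nonempty open subset, and the induction hypothesis covers its
complement. -/
theorem cls_eq_of_geomPt_bijective_aux [CharZero k] (Z : FTScheme k)
    (T : TopologicalSpace.Closeds Z.obj.left) :
    ∀ (Y' Z' : FTScheme k) (f : Y'.obj ⟶ Z'.obj) (i : Z'.obj ⟶ Z.obj),
      IsClosedImmersion i.left → Set.range i.left = T →
      (∀ Ω : GeomPt k, Function.Bijective fun y : Ω.pt ⟶ Y'.obj => y ≫ f) →
      cls Y' = cls Z' := by
  induction T using WellFoundedLT.induction with | _ T ih => ?_
  intro Y' Z' f i hi hiT hf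
  by_cases hZ : IsEmpty Z'.obj.left
  · have : IsEmpty Y'.obj.left := ⟨fun y => hZ.false (f.left y)⟩
    rw [cls_isEmpty, cls_isEmpty]
  obtain ⟨Zr, jZ, hZr, hjZ, hjZr⟩ := Z'.exists_reduced_closed isClosed_univ
  obtain ⟨Yr, jY, hYr, hjY, hjYr⟩ := Y'.exists_reduced_closed isClosed_univ
  rw [cls_eq_of_closedImmersion jZ (Set.range_eq_univ.mp hjZr),
    cls_eq_of_closedImmersion jY (Set.range_eq_univ.mp hjYr)]
  obtain ⟨fr, hfr⟩ := exists_lift_of_range_subset jZ (jY ≫ f) (by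
    rw [hjZr]
    exact Set.subset_univ _)
  have hfr' := geomPt_bijective_of_range_eq f jZ jY fr hfr (by rw [hjZr, hjYr]; rfl) hf
  have : Nonempty Zr.obj.left := by
    rw [not_isEmpty_iff] at hZ
    obtain ⟨z⟩ := hZ
    obtain ⟨z', -⟩ := hjZr.ge (Set.mem_univ z)
    exact ⟨z'⟩
  obtain ⟨U, hU, hcls⟩ := exists_restrict_cls_eq fr hfr'
  obtain ⟨Zc, cZ, hZc, hcZ, hcZr⟩ := Zr.exists_reduced_closed (L := (U : Set _)ᶜ) U.2.isClosed_compl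
  obtain ⟨Yc, cY, hYc, hcY, hcYr⟩ := Yr.exists_reduced_closed
    (L := ((fr.left ⁻¹ᵁ U : Yr.obj.left.Opens) : Set _)ᶜ) (fr.left ⁻¹ᵁ U).2.isClosed_compl
  obtain ⟨fc, hfc⟩ := exists_lift_of_range_subset cZ (cY ≫ fr) (by
    rw [hcZr]
    rintro _ ⟨y, rfl⟩ hy
    have : cY.left y ∈ Set.range cY.left := ⟨y, rfl⟩
    rw [hcYr] at this
    exact this (by simpa using hy))
  have hfc' := geomPt_bijective_of_range_eq fr cZ cY fc hfc (by rw [hcZr, hcYr]; rfl) hfr'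
  have e1 := cls_scissor (Y := Zr) (U := Zr.restrict U) (Zr.ofImmersionι U.ι) cZ
    (inferInstanceAs (IsOpenImmersion U.ι)) hcZ (by
      rw [hcZr]
      change IsCompl (Set.range U.ι) _
      rw [Scheme.Opens.range_ι]
      exact isCompl_compl)
  have e2 := cls_scissor (Y := Yr) (U := Yr.restrict (fr.left ⁻¹ᵁ U))
    (Yr.ofImmersionι (fr.left ⁻¹ᵁ U).ι) cY
    (inferInstanceAs (IsOpenImmersion (fr.left ⁻¹ᵁ U).ι)) hcY (by
      rw [hcYr]
      change IsCompl (Set.range (fr.left ⁻¹ᵁ U).ι) _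
      rw [Scheme.Opens.range_ι]
      exact isCompl_compl)
  rw [e1, e2, hcls]
  congr 1
  let I := cZ ≫ jZ ≫ i
  have hI : IsClosedImmersion I.left := by
    change IsClosedImmersion (cZ.left ≫ jZ.left ≫ i.left)
    infer_instance
  refine ih ⟨Set.range I.left, hI.isClosedEmbedding.isClosed_range⟩ ?_ Yc Zc fc I hI rfl hfc'
  rw [lt_iff_le_not_ge]
  constructor
  · rw [← SetLike.coe_subset_coe, ← hiT]
    rintro _ ⟨x, rfl⟩
    exact ⟨jZ.left (cZ.left x), by simp [I]⟩
  · intro hle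
    rw [← SetLike.coe_subset_coe, ← hiT] at hle
    obtain ⟨z, hz⟩ := hU
    obtain ⟨x, hx⟩ := hle ⟨jZ.left z, rfl⟩
    have hx' : cZ.left x = z := by
      have : (jZ ≫ i).left (cZ.left x) = (jZ ≫ i).left z := by simpa [I] using hx
      have hinj : IsClosedImmersion (jZ ≫ i).left := by
        change IsClosedImmersion (jZ.left ≫ i.left)
        infer_instance
      exact hinj.isClosedEmbedding.injective this
    have : z ∈ Set.range cZ.left := ⟨x, hx'⟩
    rw [hcZr] at this
    exact this hz

/-- A morphism that is bijective on geometric points preserves the class. In positive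
characteristic this is one of the relations; in characteristic zero it is a theorem. -/
theorem cls_eq_of_geomPt_bijective {Y Z : FTScheme k} (f : Y.obj ⟶ Z.obj)
    (h : ∀ Ω : GeomPt k, Function.Bijective fun y : Ω.pt ⟶ Y.obj => y ≫ f) :
    cls Y = cls Z := by
  by_cases hk : ringChar k = 0
  · have : CharZero k := (CharP.ringChar_zero_iff_CharZero k).mp hk
    exact cls_eq_of_geomPt_bijective_aux Z ⊤ Y Z f (𝟙 _) (by dsimp; infer_instance)
      (by simp) h
  · exact (Ideal.Quotient.eq).mpr (Ideal.subset_span (Relator.radicial hk Y Z f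
      (surjective_of_geomPt f fun Ω => (h Ω).2)
      (universallyInjective_of_geomPt f fun Ω => (h Ω).1)))

end

section

variable {k : Type u} [Field k]

/-! ### Disjoint unions, products, constructible sets -/

/-- The disjoint union of two schemes of finite type. -/
noncomputable def FTScheme.coprod (Y Z : FTScheme k) : FTScheme k where
  obj := Over.mk (coprod.desc Y.obj.hom Z.obj.hom)
  locallyOfFiniteType := by
    dsimp
    have : IsZariskiLocalAtSource @LocallyOfFiniteType :=
      HasRingHomProperty.instIsZariskiLocalAtSource (Q := RingHom.FiniteType)
    rw [IsZariskiLocalAtSource.iff_of_openCover (P := @LocallyOfFiniteType)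
      (coprodOpenCover.{u, 0} Y.obj.left Z.obj.left)]
    rintro (⟨⟨⟩⟩ | ⟨⟨⟩⟩)
    · have := Y.locallyOfFiniteType
      rwa [← coprod.inl_desc Y.obj.hom Z.obj.hom] at this
    · have := Z.locallyOfFiniteType
      rwa [← coprod.inr_desc Y.obj.hom Z.obj.hom] at this
  quasiCompact := by
    dsimp
    have h := (coprodMk Y.obj.left Z.obj.left).compactSpace
    have : CompactSpace ↥(Y.obj.left ⨿ Z.obj.left) := h
    exact (quasiCompact_iff_compactSpace (coprod.desc Y.obj.hom Z.obj.hom)).mpr this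

/-- The left inclusion. -/
noncomputable def FTScheme.inl (Y Z : FTScheme k) : Y.obj ⟶ (Y.coprod Z).obj :=
  Over.homMk coprod.inl (coprod.inl_desc _ _)

/-- The right inclusion. -/
noncomputable def FTScheme.inr (Y Z : FTScheme k) : Z.obj ⟶ (Y.coprod Z).obj :=
  Over.homMk coprod.inr (coprod.inr_desc _ _)

/-- The morphism out of a disjoint union given by its two components. -/
noncomputable def FTScheme.desc {Y Z : FTScheme k} {T : SchOver k} (f : Y.obj ⟶ T)
    (g : Z.obj ⟶ T) : (Y.coprod Z).obj ⟶ T :=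
  Over.homMk (coprod.desc f.left g.left) (by
    change coprod.desc f.left g.left ≫ T.hom = coprod.desc Y.obj.hom Z.obj.hom
    rw [coprod.desc_comp, Over.w, Over.w])

@[simp]
theorem FTScheme.inl_desc {Y Z : FTScheme k} {T : SchOver k} (f : Y.obj ⟶ T)
    (g : Z.obj ⟶ T) : Y.inl Z ≫ FTScheme.desc f g = f := by
  ext1
  exact coprod.inl_desc _ _

@[simp]
theorem FTScheme.inr_desc {Y Z : FTScheme k} {T : SchOver k} (f : Y.obj ⟶ T)
    (g : Z.obj ⟶ T) : Y.inr Z ≫ FTScheme.desc f g = g := by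
  ext1
  exact coprod.inr_desc _ _

instance (Y Z : FTScheme k) : IsOpenImmersion (Y.inl Z).left :=
  inferInstanceAs (IsOpenImmersion (coprod.inl : Y.obj.left ⟶ Y.obj.left ⨿ Z.obj.left))

instance (Y Z : FTScheme k) : IsOpenImmersion (Y.inr Z).left :=
  inferInstanceAs (IsOpenImmersion (coprod.inr : Z.obj.left ⟶ Y.obj.left ⨿ Z.obj.left))

theorem FTScheme.isCompl_range (Y Z : FTScheme k) :
    IsCompl (Set.range (Y.inl Z).left) (Set.range (Y.inr Z).left) :=
  isCompl_range_inl_inr Y.obj.left Z.obj.left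

theorem cls_coprod (Y Z : FTScheme k) : cls (Y.coprod Z) = cls Y + cls Z := by
  have h := Y.isCompl_range Z
  refine cls_scissor (Y.inl Z) (Y.inr Z) inferInstance (.of_isPreimmersion _ ?_) h
  rw [← h.compl_eq]
  exact (Y.inl Z).left.isOpenEmbedding.isOpen_range.isClosed_compl

theorem FTScheme.coprod_geomPt (Y Z : FTScheme k) {Ω : GeomPt k}
    (x : Ω.pt ⟶ (Y.coprod Z).obj) :
    (∃ y, y ≫ Y.inl Z = x) ∨ (∃ z, z ≫ Y.inr Z = x) := by
  have h : GeomPt.im x ∈ Set.range (Y.inl Z).left ∪ Set.range (Y.inr Z).left := by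
    exact (Y.isCompl_range Z).sup_eq_top.ge trivial
  exact h.imp (exists_geomPt_lift _ x) (exists_geomPt_lift _ x)

theorem FTScheme.inl_ne_inr (Y Z : FTScheme k) {Ω : GeomPt k} (y : Ω.pt ⟶ Y.obj)
    (z : Ω.pt ⟶ Z.obj) : y ≫ Y.inl Z ≠ z ≫ Y.inr Z := by
  intro h
  have := Set.disjoint_iff.mp (Y.isCompl_range Z).disjoint
    ⟨⟨GeomPt.im y, rfl⟩, ⟨GeomPt.im z, by rw [← GeomPt.im_comp, ← h, GeomPt.im_comp]⟩⟩
  exact this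

/-- The first projection. -/
noncomputable def FTScheme.fst (Y Z : FTScheme k) : (Y.prod Z).obj ⟶ Y.obj :=
  Over.homMk (pullback.fst Y.obj.hom Z.obj.hom) rfl

/-- The second projection. -/
noncomputable def FTScheme.snd (Y Z : FTScheme k) : (Y.prod Z).obj ⟶ Z.obj :=
  Over.homMk (pullback.snd Y.obj.hom Z.obj.hom) pullback.condition.symm

/-- The morphism to a product given by its two components. -/
noncomputable def FTScheme.lift {Y Z : FTScheme k} {T : SchOver k} (f : T ⟶ Y.obj)
    (g : T ⟶ Z.obj) : T ⟶ (Y.prod Z).obj :=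
  Over.homMk (pullback.lift f.left g.left (by rw [Over.w, Over.w])) (by
    change pullback.lift f.left g.left _ ≫ pullback.fst _ _ ≫ _ = _
    rw [pullback.lift_fst_assoc, Over.w])

@[simp]
theorem FTScheme.lift_fst {Y Z : FTScheme k} {T : SchOver k} (f : T ⟶ Y.obj)
    (g : T ⟶ Z.obj) : FTScheme.lift f g ≫ Y.fst Z = f := by
  ext1
  exact pullback.lift_fst _ _ _

@[simp]
theorem FTScheme.lift_fst_assoc {Y Z : FTScheme k} {T T' : SchOver k} (f : T ⟶ Y.obj)
    (g : T ⟶ Z.obj) (h : Y.obj ⟶ T') : FTScheme.lift f g ≫ Y.fst Z ≫ h = f ≫ h := by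
  rw [← Category.assoc, FTScheme.lift_fst]

@[simp]
theorem FTScheme.lift_snd {Y Z : FTScheme k} {T : SchOver k} (f : T ⟶ Y.obj)
    (g : T ⟶ Z.obj) : FTScheme.lift f g ≫ Y.snd Z = g := by
  ext1
  exact pullback.lift_snd _ _ _

@[simp]
theorem FTScheme.lift_snd_assoc {Y Z : FTScheme k} {T T' : SchOver k} (f : T ⟶ Y.obj)
    (g : T ⟶ Z.obj) (h : Z.obj ⟶ T') : FTScheme.lift f g ≫ Y.snd Z ≫ h = g ≫ h := by
  rw [← Category.assoc, FTScheme.lift_snd]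

theorem FTScheme.prod_ext {Y Z : FTScheme k} {T : SchOver k} {f g : T ⟶ (Y.prod Z).obj}
    (h₁ : f ≫ Y.fst Z = g ≫ Y.fst Z) (h₂ : f ≫ Y.snd Z = g ≫ Y.snd Z) : f = g := by
  ext1
  exact pullback.hom_ext (congrArg (·.left) h₁) (congrArg (·.left) h₂)

/-- A constructible subset of a scheme of finite type and its complement, pulled back along any
`g`, are the images of two schemes of finite type that inject on geometric points. The
complement is carried along so that unions can be made disjoint. -/
theorem exists_geomPt_of_isConstructible {Y : FTScheme k} {C : Set Y.obj.left}
    (hC : Topology.IsConstructible C) : ∀ (S : FTScheme k) (g : S.obj ⟶ Y.obj),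
    ∃ (R R' : FTScheme k) (ι : R.obj ⟶ S.obj) (ι' : R'.obj ⟶ S.obj), ∀ Ω : GeomPt k,
      (Function.Injective fun r : Ω.pt ⟶ R.obj => r ≫ ι) ∧
      (Function.Injective fun r : Ω.pt ⟶ R'.obj => r ≫ ι') ∧
      ∀ s : Ω.pt ⟶ S.obj, ((∃ r, r ≫ ι = s) ↔ GeomPt.im (s ≫ g) ∈ C) ∧
        ((∃ r, r ≫ ι' = s) ↔ GeomPt.im (s ≫ g) ∉ C) := by
  induction hC using BooleanSubalgebra.closure_bot_sup_induction with
  | mem U hU =>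
    intro S g
    let V : S.obj.left.Opens := g.left ⁻¹ᵁ ⟨U, hU.1⟩
    obtain ⟨R', ι', -, h1, h2⟩ := S.exists_reduced_closed (L := (V : Set _)ᶜ) V.2.isClosed_compl
    have hm : IsOpenImmersion (S.ofImmersionι V.ι).left := inferInstanceAs (IsOpenImmersion V.ι)
    refine ⟨S.restrict V, R', S.ofImmersionι V.ι, ι', fun Ω => ⟨geomPt_injective_of_mono _ Ω,
      geomPt_injective_of_mono _ Ω, fun s => ⟨?_, ?_⟩⟩⟩
    · rw [← mem_range_iff_exists_geomPt, GeomPt.im_comp]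
      change _ ∈ Set.range V.ι ↔ _
      rw [Scheme.Opens.range_ι]
      rfl
    · rw [← mem_range_iff_exists_geomPt, GeomPt.im_comp, h2]
      rfl
  | bot =>
    intro S g
    refine ⟨FTScheme.empty k, S, FTScheme.emptyTo _, 𝟙 _, fun Ω => ⟨?_, ?_, fun s => ⟨?_, ?_⟩⟩⟩
    · intro r
      exact (IsEmpty.false (r.left Ω.closedPt)).elim
    · intro a b h; simpa using h
    · simp only [Set.bot_eq_empty, Set.mem_empty_iff_false, iff_false]
      rintro ⟨r, -⟩
      exact IsEmpty.false (r.left Ω.closedPt)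
    · simp
  | sup A hA B hB ihA ihB =>
    intro S g
    obtain ⟨RA, RA', a, a', ha⟩ := ihA S g
    -- only the part of `B` outside `A` is used
    obtain ⟨RB, RB', b, b', hb⟩ := ihB RA' (a' ≫ g)
    refine ⟨RA.coprod RB, RB', FTScheme.desc a (b ≫ a'), b' ≫ a', fun Ω => ?_⟩
    obtain ⟨ha1, ha2, ha3⟩ := ha Ω
    obtain ⟨hb1, hb2, hb3⟩ := hb Ω
    have key : ∀ (x : Ω.pt ⟶ RA.obj) (y : Ω.pt ⟶ RA'.obj), x ≫ a ≠ y ≫ a' := fun x y hxy =>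
      ((ha3 (x ≫ a)).2.mp ⟨y, hxy.symm⟩) ((ha3 (x ≫ a)).1.mp ⟨x, rfl⟩)
    refine ⟨?_, ?_, fun s => ⟨?_, ?_⟩⟩
    · intro x y hxy
      dsimp at hxy
      rcases RA.coprod_geomPt RB x with ⟨x, rfl⟩ | ⟨x, rfl⟩ <;>
      rcases RA.coprod_geomPt RB y with ⟨y, rfl⟩ | ⟨y, rfl⟩ <;>
      simp only [Category.assoc, FTScheme.inl_desc, FTScheme.inr_desc] at hxy
      · rw [ha1 hxy]
      · rw [← Category.assoc y] at hxy
        exact (key _ _ hxy).elim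
      · rw [← Category.assoc x] at hxy
        exact (key _ _ hxy.symm).elim
      · rw [← Category.assoc x, ← Category.assoc y] at hxy
        rw [hb1 (ha2 hxy)]
    · intro x y hxy
      dsimp at hxy
      rw [← Category.assoc x, ← Category.assoc y] at hxy
      exact hb2 (ha2 hxy)
    · constructor
      · rintro ⟨r, rfl⟩
        rcases RA.coprod_geomPt RB r with ⟨x, rfl⟩ | ⟨x, rfl⟩
        · left
          have := (ha3 (x ≫ a)).1.mp ⟨x, rfl⟩
          simpa using this
        · right
          have := (hb3 (x ≫ b)).1.mp ⟨x, rfl⟩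
          simpa using this
      · intro h
        by_cases hsA : GeomPt.im (s ≫ g) ∈ A
        · obtain ⟨r, rfl⟩ := (ha3 s).1.mpr hsA
          exact ⟨r ≫ RA.inl RB, by simp⟩
        · obtain ⟨r', rfl⟩ := (ha3 s).2.mpr hsA
          obtain ⟨r, rfl⟩ := (hb3 r').1.mpr (by
            have := h.resolve_left hsA
            simpa using this)
          exact ⟨r ≫ RA.inr RB, by simp⟩
    · constructor
      · rintro ⟨r, rfl⟩ h
        have h1 := (ha3 ((r ≫ b') ≫ a')).2.mp ⟨_, rfl⟩
        have h2 := (hb3 (r ≫ b')).2.mp ⟨r, rfl⟩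
        rcases h with h | h
        · exact h1 (by simpa using h)
        · exact h2 (by simpa using h)
      · intro h
        obtain ⟨r', rfl⟩ := (ha3 s).2.mpr fun h' => h (Or.inl h')
        obtain ⟨r, rfl⟩ := (hb3 r').2.mpr fun h' => h (Or.inr (by simpa using h'))
        exact ⟨r, by simp⟩
  | compl A hA ih =>
    intro S g
    obtain ⟨R, R', ι, ι', h⟩ := ih S g
    refine ⟨R', R, ι', ι, fun Ω => ⟨(h Ω).2.1, (h Ω).1, fun s => ⟨((h Ω).2.2 s).2, ?_⟩⟩⟩
    rw [((h Ω).2.2 s).1]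
    simp

/-- Chevalley's theorem. -/
theorem isConstructible_range {S Y : FTScheme k} (g : S.obj ⟶ Y.obj) :
    Topology.IsConstructible (Set.range g.left) := by
  have : LocallyOfFinitePresentation g.left :=
    LocallyOfFinitePresentation.iff_locallyOfFiniteType.mpr inferInstance
  rw [← Set.image_univ]
  exact g.left.isConstructible_image .univ

/-- Two quotients of the same scheme with the same geometric fibres have the same class: the
image of the scheme in their product is constructible and maps bijectively to both of them on
geometric points. -/
theorem cls_eq_of_geomPt_fibres {S Q Q' : FTScheme k} (p : S.obj ⟶ Q.obj) (p' : S.obj ⟶ Q'.obj)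
    (h : ∀ Ω : GeomPt k, (∀ q : Ω.pt ⟶ Q.obj, ∃ s, s ≫ p = q) ∧
      (∀ q : Ω.pt ⟶ Q'.obj, ∃ s, s ≫ p' = q) ∧
      ∀ s s' : Ω.pt ⟶ S.obj, s ≫ p = s' ≫ p ↔ s ≫ p' = s' ≫ p') : cls Q = cls Q' := by
  let P := FTScheme.prod Q Q'
  let g : S.obj ⟶ P.obj := FTScheme.lift p p'
  obtain ⟨R, R', ι, ι', hR⟩ := exists_geomPt_of_isConstructible (isConstructible_range g) P (𝟙 _)
  have hR1 : ∀ (Ω : GeomPt k) (r : Ω.pt ⟶ R.obj), ∃ s : Ω.pt ⟶ S.obj, s ≫ g = r ≫ ι := by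
    intro Ω r
    have := ((hR Ω).2.2 (r ≫ ι)).1.mp ⟨r, rfl⟩
    rw [Category.comp_id] at this
    exact exists_geomPt_lift g _ this
  have hR2 : ∀ (Ω : GeomPt k) (s : Ω.pt ⟶ S.obj), ∃ r, r ≫ ι = s ≫ g := by
    intro Ω s
    refine ((hR Ω).2.2 (s ≫ g)).1.mpr ?_
    rw [Category.comp_id, GeomPt.im_comp]
    exact ⟨_, rfl⟩
  have e : ∀ (Ω : GeomPt k) (s : Ω.pt ⟶ S.obj) (r : Ω.pt ⟶ R.obj), s ≫ g = r ≫ ι →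
      s ≫ p = r ≫ ι ≫ Q.fst Q' ∧ s ≫ p' = r ≫ ι ≫ Q.snd Q' := by
    intro Ω s r hsr
    rw [← reassoc_of% hsr, ← reassoc_of% hsr, FTScheme.lift_fst, FTScheme.lift_snd]
    exact ⟨rfl, rfl⟩
  have inj : ∀ (Ω : GeomPt k) (r₁ r₂ : Ω.pt ⟶ R.obj), (r₁ ≫ ι ≫ Q.fst Q' = r₂ ≫ ι ≫ Q.fst Q' ∨
      r₁ ≫ ι ≫ Q.snd Q' = r₂ ≫ ι ≫ Q.snd Q') → r₁ = r₂ := by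
    intro Ω r₁ r₂ hr
    obtain ⟨s₁, h₁⟩ := hR1 Ω r₁
    obtain ⟨s₂, h₂⟩ := hR1 Ω r₂
    obtain ⟨a₁, b₁⟩ := e Ω s₁ r₁ h₁
    obtain ⟨a₂, b₂⟩ := e Ω s₂ r₂ h₂
    rw [← a₁, ← a₂, ← b₁, ← b₂, (h Ω).2.2, or_self] at hr
    refine (hR Ω).1 (FTScheme.prod_ext ?_ ?_)
    · simp only [Category.assoc, ← a₁, ← a₂]
      exact ((h Ω).2.2 _ _).mpr hr
    · simp only [Category.assoc, ← b₁, ← b₂, hr]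
  rw [← cls_eq_of_geomPt_bijective (ι ≫ Q.fst Q') fun Ω =>
      ⟨fun r₁ r₂ hr => inj Ω r₁ r₂ (.inl hr), fun q => ?_⟩,
    ← cls_eq_of_geomPt_bijective (ι ≫ Q.snd Q') fun Ω =>
      ⟨fun r₁ r₂ hr => inj Ω r₁ r₂ (.inr hr), fun q => ?_⟩]
  · obtain ⟨s, rfl⟩ := (h Ω).2.1 q
    obtain ⟨r, hr⟩ := hR2 Ω s
    exact ⟨r, ((e Ω s r hr.symm).2).symm⟩
  · obtain ⟨s, rfl⟩ := (h Ω).1 q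
    obtain ⟨r, hr⟩ := hR2 Ω s
    exact ⟨r, ((e Ω s r hr.symm).1).symm⟩

end

section

variable {k : Type u} [Field k]

/-! ### Classes of families of sets of geometric points -/

/-- The fibre product of two schemes of finite type over a `k`-scheme. -/
noncomputable def FTScheme.fiberProd {S T : FTScheme k} {V : SchOver k} (a : S.obj ⟶ V)
    (b : T.obj ⟶ V) : FTScheme k where
  obj := Over.mk (pullback.fst a.left b.left ≫ S.obj.hom)
  locallyOfFiniteType := by dsimp; infer_instance
  quasiCompact := by dsimp; infer_instance

theorem FTScheme.exists_fiberProd {S T : FTScheme k} {V : SchOver k} (a : S.obj ⟶ V)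
    (b : T.obj ⟶ V) : ∃ (R : FTScheme k) (p : R.obj ⟶ S.obj) (q : R.obj ⟶ T.obj),
      p ≫ a = q ≫ b ∧ ∀ (Ω : GeomPt k) (s : Ω.pt ⟶ S.obj) (t : Ω.pt ⟶ T.obj),
        s ≫ a = t ≫ b → ∃ r : Ω.pt ⟶ R.obj, r ≫ p = s ∧ r ≫ q = t := by
  have hw : pullback.snd a.left b.left ≫ T.obj.hom = pullback.fst a.left b.left ≫ S.obj.hom := by
    rw [← Over.w a, ← Over.w b, pullback.condition_assoc]
  refine ⟨FTScheme.fiberProd a b, Over.homMk (pullback.fst a.left b.left) rfl,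
    Over.homMk (pullback.snd a.left b.left) hw, ?_, fun Ω s t h => ?_⟩
  · ext1; exact pullback.condition
  · have h' : s.left ≫ a.left = t.left ≫ b.left := congrArg (·.left) h
    refine ⟨Over.homMk (pullback.lift s.left t.left h') ?_, ?_, ?_⟩
    · change pullback.lift s.left t.left h' ≫ pullback.fst _ _ ≫ _ = _
      rw [pullback.lift_fst_assoc, Over.w]
    · ext1; exact pullback.lift_fst _ _ _
    · ext1; exact pullback.lift_snd _ _ _

/-- `D Ω` is a set of `Ω`-points of `V`, for each geometric point `Ω`, and `f` is a function on
`Ω`-points. `HasClass V D f m` says that `m` is the class of the quotient of `D` by the relation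
`f x = f y`: there are a scheme `S` with a morphism to `V` whose geometric points lie in `D` and
meet all fibres of `f` in `D`, and a scheme `Q` of class `m` with a morphism `S ⟶ Q` that is on
geometric points the quotient by the relation induced by `f`. -/
def HasClass (V : SchOver k) (D : ∀ Ω : GeomPt k, Set (Ω.pt ⟶ V)) {F : GeomPt k → Type v}
    (f : ∀ Ω : GeomPt k, (Ω.pt ⟶ V) → F Ω) (m : GrothendieckRing k) : Prop :=
  ∃ (S Q : FTScheme k) (ι : S.obj ⟶ V) (π : S.obj ⟶ Q.obj), m = cls Q ∧ ∀ Ω : GeomPt k,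
    (∀ s : Ω.pt ⟶ S.obj, s ≫ ι ∈ D Ω) ∧
    (∀ x ∈ D Ω, ∃ s : Ω.pt ⟶ S.obj, f Ω (s ≫ ι) = f Ω x) ∧
    (∀ q : Ω.pt ⟶ Q.obj, ∃ s, s ≫ π = q) ∧
    ∀ s s' : Ω.pt ⟶ S.obj, s ≫ π = s' ≫ π ↔ f Ω (s ≫ ι) = f Ω (s' ≫ ι)

section
variable {V V' : SchOver k} {D D' : ∀ Ω : GeomPt k, Set (Ω.pt ⟶ V)}
  {E : ∀ Ω : GeomPt k, Set (Ω.pt ⟶ V')} {F : GeomPt k → Type v} {G : GeomPt k → Type w}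
  {f : ∀ Ω : GeomPt k, (Ω.pt ⟶ V) → F Ω} {g : ∀ Ω : GeomPt k, (Ω.pt ⟶ V') → G Ω}
  {m m' : GrothendieckRing k}

/-- A morphism that induces a bijection on fibres transports the class. -/
theorem HasClass.map (h : HasClass V D f m) (φ : V ⟶ V')
    (h1 : ∀ Ω, ∀ x ∈ D Ω, x ≫ φ ∈ E Ω)
    (h2 : ∀ Ω, ∀ y ∈ E Ω, ∃ x ∈ D Ω, g Ω (x ≫ φ) = g Ω y)
    (h3 : ∀ Ω, ∀ x ∈ D Ω, ∀ x' ∈ D Ω, f Ω x = f Ω x' ↔ g Ω (x ≫ φ) = g Ω (x' ≫ φ)) :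
    HasClass V' E g m := by
  obtain ⟨S, Q, ι, π, rfl, h⟩ := h
  refine ⟨S, Q, ι ≫ φ, π, rfl, fun Ω => ?_⟩
  obtain ⟨a, b, c, d⟩ := h Ω
  refine ⟨fun s => ?_, fun y hy => ?_, c, fun s s' => ?_⟩
  · rw [← Category.assoc]; exact h1 Ω _ (a s)
  · obtain ⟨x, hx, hxy⟩ := h2 Ω y hy
    obtain ⟨s, hs⟩ := b x hx
    refine ⟨s, ?_⟩
    rw [← Category.assoc, ← hxy]
    exact (h3 Ω _ (a s) _ hx).mp hs
  · rw [d, ← Category.assoc, ← Category.assoc]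
    exact h3 Ω _ (a s) _ (a s')

theorem HasClass.congr (h : HasClass V D f m) {g : ∀ Ω : GeomPt k, (Ω.pt ⟶ V) → G Ω}
    (h1 : ∀ Ω, D Ω = D' Ω)
    (h2 : ∀ Ω, ∀ x ∈ D Ω, ∀ x' ∈ D Ω, f Ω x = f Ω x' ↔ g Ω x = g Ω x') :
    HasClass V D' g m := by
  refine h.map (𝟙 V) (fun Ω x hx => ?_) (fun Ω y hy => ⟨y, ?_, ?_⟩) (fun Ω x hx x' hx' => ?_)
  · rwa [Category.comp_id, ← h1]
  · rwa [h1]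
  · rw [Category.comp_id]
  · simpa using h2 Ω x hx x' hx'

theorem HasClass.empty (f : ∀ Ω : GeomPt k, (Ω.pt ⟶ V) → F Ω) (hD : ∀ Ω, D Ω = ∅) :
    HasClass V D f 0 := by
  refine ⟨FTScheme.empty k, FTScheme.empty k, FTScheme.emptyTo _, 𝟙 _, (cls_isEmpty _).symm,
    fun Ω => ⟨fun s => (IsEmpty.false (s.left Ω.closedPt)).elim, fun x hx => ?_,
      fun s => (IsEmpty.false (s.left Ω.closedPt)).elim,
      fun s => (IsEmpty.false (s.left Ω.closedPt)).elim⟩⟩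
  rw [hD] at hx
  exact hx.elim

theorem HasClass.union (h : HasClass V D f m) (h' : HasClass V D' f m')
    (hd : ∀ Ω, ∀ x ∈ D Ω, ∀ y ∈ D' Ω, f Ω x ≠ f Ω y) :
    HasClass V (fun Ω => D Ω ∪ D' Ω) f (m + m') := by
  obtain ⟨S, Q, ι, π, rfl, h⟩ := h
  obtain ⟨S', Q', ι', π', rfl, h'⟩ := h'
  refine ⟨S.coprod S', Q.coprod Q', FTScheme.desc ι ι',
    FTScheme.desc (π ≫ Q.inl Q') (π' ≫ Q.inr Q'), (cls_coprod _ _).symm, fun Ω => ?_⟩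
  obtain ⟨a, b, c, d⟩ := h Ω
  obtain ⟨a', b', c', d'⟩ := h' Ω
  refine ⟨fun s => ?_, fun x hx => ?_, fun q => ?_, fun s s' => ?_⟩
  · rcases S.coprod_geomPt S' s with ⟨s, rfl⟩ | ⟨s, rfl⟩
    · left; simpa using a s
    · right; simpa using a' s
  · rcases hx with hx | hx
    · obtain ⟨s, hs⟩ := b x hx
      exact ⟨s ≫ S.inl S', by simpa using hs⟩
    · obtain ⟨s, hs⟩ := b' x hx
      exact ⟨s ≫ S.inr S', by simpa using hs⟩
  · rcases Q.coprod_geomPt Q' q with ⟨q, rfl⟩ | ⟨q, rfl⟩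
    · obtain ⟨s, rfl⟩ := c q
      exact ⟨s ≫ S.inl S', by simp⟩
    · obtain ⟨s, rfl⟩ := c' q
      exact ⟨s ≫ S.inr S', by simp⟩
  · have hinl : ∀ a b : Ω.pt ⟶ Q.obj, a ≫ Q.inl Q' = b ≫ Q.inl Q' ↔ a = b := fun a b =>
      (geomPt_injective_of_mono (Q.inl Q') Ω).eq_iff
    have hinr : ∀ a b : Ω.pt ⟶ Q'.obj, a ≫ Q.inr Q' = b ≫ Q.inr Q' ↔ a = b := fun a b =>
      (geomPt_injective_of_mono (Q.inr Q') Ω).eq_iff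
    rcases S.coprod_geomPt S' s with ⟨s, rfl⟩ | ⟨s, rfl⟩ <;>
    rcases S.coprod_geomPt S' s' with ⟨s', rfl⟩ | ⟨s', rfl⟩ <;>
    simp only [Category.assoc, FTScheme.inl_desc, FTScheme.inr_desc]
    · rw [← Category.assoc, ← Category.assoc, hinl, d]
    · rw [← Category.assoc, ← Category.assoc]
      exact iff_of_false (Q.inl_ne_inr Q' _ _) (hd Ω _ (a _) _ (a' _))
    · rw [← Category.assoc, ← Category.assoc]
      exact iff_of_false (Q.inl_ne_inr Q' _ _).symm (hd Ω _ (a _) _ (a' _)).symm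
    · rw [← Category.assoc, ← Category.assoc, hinr, d']

theorem HasClass.sum {I : Type*} (A : Finset I) {D : I → ∀ Ω : GeomPt k, Set (Ω.pt ⟶ V)}
    {m : I → GrothendieckRing k} (h : ∀ i ∈ A, HasClass V (D i) f (m i))
    (hd : ∀ i ∈ A, ∀ j ∈ A, i ≠ j → ∀ Ω, ∀ x ∈ D i Ω, ∀ y ∈ D j Ω, f Ω x ≠ f Ω y) :
    HasClass V (fun Ω => {x | ∃ i ∈ A, x ∈ D i Ω}) f (∑ i ∈ A, m i) := by
  classical
  induction A using Finset.induction_on with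
  | empty => exact HasClass.empty f (by simp)
  | insert a A ha ih =>
    rw [Finset.sum_insert ha]
    have h1 := h a (Finset.mem_insert_self a A)
    have h2 := ih (fun i hi => h i (Finset.mem_insert_of_mem hi)) fun i hi j hj =>
      hd i (Finset.mem_insert_of_mem hi) j (Finset.mem_insert_of_mem hj)
    refine (h1.union h2 ?_).congr (fun Ω => ?_) fun _ _ _ _ _ => Iff.rfl
    · rintro Ω x hx y ⟨j, hj, hy⟩
      exact hd a (Finset.mem_insert_self a A) j (Finset.mem_insert_of_mem hj)
        (fun h => ha (h ▸ hj)) Ω x hx y hy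
    · ext x
      simp

theorem HasClass.prod (h : HasClass V D f m) (h' : HasClass V' E g m') :
    HasClass (V ⨯ V') (fun Ω => {x | x ≫ Limits.prod.fst ∈ D Ω ∧ x ≫ Limits.prod.snd ∈ E Ω})
      (fun Ω x => (f Ω (x ≫ Limits.prod.fst), g Ω (x ≫ Limits.prod.snd))) (m * m') := by
  obtain ⟨S, Q, ι, π, rfl, h⟩ := h
  obtain ⟨S', Q', ι', π', rfl, h'⟩ := h'
  have e1 : Limits.prod.lift (S.fst S' ≫ ι) (S.snd S' ≫ ι') ≫ Limits.prod.fst = S.fst S' ≫ ι :=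
    Limits.prod.lift_fst _ _
  have e2 : Limits.prod.lift (S.fst S' ≫ ι) (S.snd S' ≫ ι') ≫ Limits.prod.snd = S.snd S' ≫ ι' :=
    Limits.prod.lift_snd _ _
  refine ⟨S.prod S', Q.prod Q', Limits.prod.lift (S.fst S' ≫ ι) (S.snd S' ≫ ι'),
    FTScheme.lift (S.fst S' ≫ π) (S.snd S' ≫ π'), cls_mul _ _, fun Ω => ?_⟩
  obtain ⟨a, b, c, d⟩ := h Ω
  obtain ⟨a', b', c', d'⟩ := h' Ω
  simp only [Category.assoc, e1, e2, Set.mem_ofPred_eq]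
  refine ⟨fun s => ?_, fun x hx => ?_, fun q => ?_, fun s s' => ?_⟩
  · refine ⟨?_, ?_⟩
    · simpa using a (s ≫ S.fst S')
    · simpa using a' (s ≫ S.snd S')
  · obtain ⟨s, hs⟩ := b _ hx.1
    obtain ⟨s', hs'⟩ := b' _ hx.2
    exact ⟨FTScheme.lift s s', by simp [hs, hs']⟩
  · obtain ⟨s, hs⟩ := c (q ≫ Q.fst Q')
    obtain ⟨s', hs'⟩ := c' (q ≫ Q.snd Q')
    exact ⟨FTScheme.lift s s', FTScheme.prod_ext (by simp [hs]) (by simp [hs'])⟩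
  · have e : s ≫ FTScheme.lift (S.fst S' ≫ π) (S.snd S' ≫ π') =
        s' ≫ FTScheme.lift (S.fst S' ≫ π) (S.snd S' ≫ π') ↔
        (s ≫ S.fst S') ≫ π = (s' ≫ S.fst S') ≫ π ∧
          (s ≫ S.snd S') ≫ π' = (s' ≫ S.snd S') ≫ π' := by
      constructor
      · intro h
        constructor
        · simpa using congrArg (· ≫ Q.fst Q') h
        · simpa using congrArg (· ≫ Q.snd Q') h
      · rintro ⟨h₁, h₂⟩
        exact FTScheme.prod_ext (by simpa using h₁) (by simpa using h₂)
    rw [e, d, d', Prod.mk.injEq]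
    simp only [Category.assoc]

/-- The class is determined by `D` and `f` if the fibres of `f` in `D` are contained in the orbits
of finitely many endomorphisms. -/
theorem HasClass.unique (h : HasClass V D f m) (h' : HasClass V D f m') {H : Type*} [Finite H]
    (ρ : H → (V ⟶ V)) (hρ : ∀ Ω, ∀ x ∈ D Ω, ∀ y ∈ D Ω, f Ω x = f Ω y → ∃ h, x ≫ ρ h = y)
    (hρ' : ∀ Ω, ∀ x ∈ D Ω, ∀ h, f Ω (x ≫ ρ h) = f Ω x) :
    m = m' := by
  classical
  obtain ⟨S, Q, ι, π, rfl, h⟩ := h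
  obtain ⟨S', Q', ι', π', rfl, h'⟩ := h'
  -- `T` parametrizes the pairs of a point of `S` and a point of `S'` that are related by an element
  -- of `A`, so for `A = H` it is a common cover of `Q` and `Q'`
  have key : ∀ A : Finset H, ∃ (T : FTScheme k) (p : T.obj ⟶ S.obj) (q : T.obj ⟶ S'.obj),
      ∀ Ω : GeomPt k, (∀ t : Ω.pt ⟶ T.obj, ∃ h ∈ A, (t ≫ p) ≫ ι ≫ ρ h = (t ≫ q) ≫ ι') ∧
        ∀ (s : Ω.pt ⟶ S.obj) (s' : Ω.pt ⟶ S'.obj), (∃ h ∈ A, s ≫ ι ≫ ρ h = s' ≫ ι') →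
          ∃ t, t ≫ p = s ∧ t ≫ q = s' := by
    intro A
    induction A using Finset.induction_on with
    | empty =>
      exact ⟨FTScheme.empty k, FTScheme.emptyTo _, FTScheme.emptyTo _, fun Ω =>
        ⟨fun s => (IsEmpty.false (s.left Ω.closedPt)).elim, by simp⟩⟩
    | insert a A ha ih =>
      obtain ⟨T, p, q, hT⟩ := ih
      obtain ⟨R, p', q', hR, hR'⟩ := FTScheme.exists_fiberProd (ι ≫ ρ a) ι'
      refine ⟨R.coprod T, FTScheme.desc p' p, FTScheme.desc q' q, fun Ω => ⟨fun t => ?_, ?_⟩⟩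
      · rcases R.coprod_geomPt T t with ⟨t, rfl⟩ | ⟨t, rfl⟩
        · refine ⟨a, Finset.mem_insert_self _ _, ?_⟩
          simp [hR]
        · obtain ⟨h, hh, e⟩ := (hT Ω).1 t
          refine ⟨h, Finset.mem_insert_of_mem hh, ?_⟩
          simpa using e
      · rintro s s' ⟨h, hh, e⟩
        rcases Finset.mem_insert.mp hh with rfl | hh
        · obtain ⟨r, hr, hr'⟩ := hR' Ω s s' e
          exact ⟨r ≫ R.inl T, by simpa using hr, by simpa using hr'⟩
        · obtain ⟨r, hr, hr'⟩ := (hT Ω).2 s s' ⟨h, hh, e⟩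
          exact ⟨r ≫ R.inr T, by simpa using hr, by simpa using hr'⟩
  have := Fintype.ofFinite H
  obtain ⟨T, p, q, hT⟩ := key Finset.univ
  refine cls_eq_of_geomPt_fibres (p ≫ π) (q ≫ π') fun Ω => ?_
  obtain ⟨a, b, c, d⟩ := h Ω
  obtain ⟨a', b', c', d'⟩ := h' Ω
  obtain ⟨e, e'⟩ := hT Ω
  have ef : ∀ t : Ω.pt ⟶ T.obj, f Ω ((t ≫ p) ≫ ι) = f Ω ((t ≫ q) ≫ ι') := by
    intro t
    obtain ⟨h, -, hh⟩ := e t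
    rw [← hh, ← Category.assoc _ ι]
    exact (hρ' Ω _ (a _) h).symm
  have e'f : ∀ s s', f Ω (s ≫ ι) = f Ω (s' ≫ ι') → ∃ t, t ≫ p = s ∧ t ≫ q = s' := by
    intro s s' h
    obtain ⟨h, hh⟩ := hρ Ω _ (a s) _ (a' s') h
    exact e' s s' ⟨h, Finset.mem_univ h, by simpa using hh⟩
  refine ⟨fun x => ?_, fun x => ?_, fun t t' => ?_⟩
  · obtain ⟨s, rfl⟩ := c x
    obtain ⟨s', hs'⟩ := b' _ (a s)
    obtain ⟨t, rfl, -⟩ := e'f s s' hs'.symm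
    exact ⟨t, by simp⟩
  · obtain ⟨s', rfl⟩ := c' x
    obtain ⟨s, hs⟩ := b _ (a' s')
    obtain ⟨t, -, rfl⟩ := e'f s s' hs
    exact ⟨t, by simp⟩
  · rw [← Category.assoc, ← Category.assoc, ← Category.assoc, ← Category.assoc, d, d', ef, ef]

end

end

section

/-! ### Points of quotients by finite groups -/

section
open Polynomial

variable {A R G : Type*} [CommRing A] [CommRing R] [IsDomain R] [Group G] [Finite G]
  [MulSemiringAction G A]

/-- `ψ a` is a root of the image of `∏ (X - g • a)`, a polynomial with invariant coefficients. -/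
theorem exists_eq_smul_of_eqOn_fixed (φ ψ : A →+* R)
    (h : ∀ a : A, (∀ g : G, g • a = a) → φ a = ψ a) (a : A) : ∃ g : G, ψ a = φ (g • a) := by
  have := Fintype.ofFinite G
  have e : (MulSemiringAction.charpoly G a).map φ = (MulSemiringAction.charpoly G a).map ψ := by
    ext n
    rw [coeff_map, coeff_map]
    exact h _ fun g => MulSemiringAction.smul_coeff_charpoly a n g
  have e' : ((MulSemiringAction.charpoly G a).map ψ).eval (ψ a) = 0 := by
    rw [Polynomial.eval_map, Polynomial.eval₂_hom, MulSemiringAction.eval_charpoly, map_zero]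
  rw [← e, MulSemiringAction.charpoly_eq, Polynomial.map_prod, eval_prod,
    Finset.prod_eq_zero_iff] at e'
  obtain ⟨g, -, hg⟩ := e'
  exact ⟨g, by simpa [sub_eq_zero] using hg⟩

/-- Two homomorphisms to a domain that agree on the invariants of a finite group differ by an
element of the group. -/
theorem exists_forall_eq_smul_of_eqOn_fixed (φ ψ : A →+* R)
    (h : ∀ a : A, (∀ g : G, g • a = a) → φ a = ψ a) : ∃ g : G, ∀ a, ψ a = φ (g • a) := by
  by_contra! hc
  choose c hc using hc
  have := Fintype.ofFinite G
  let e := Fintype.equivFin G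
  -- the previous lemma applied to the polynomial ring yields one `g` for all coefficients of `p`,
  -- but the coefficient `c g` rules out `g`
  let p : A[X] := ∑ g : G, C (c g) * X ^ (e g : ℕ)
  have hp : ∀ g, p.coeff (e g) = c g := by
    intro g
    simp only [p, finsetSum_coeff, coeff_C_mul_X_pow]
    rw [Finset.sum_eq_single g]
    · simp
    · intro b _ hb
      rw [if_neg]
      intro h
      exact hb (e.injective (Fin.ext h)).symm
    · simp
  obtain ⟨g, hg⟩ := exists_eq_smul_of_eqOn_fixed (G := G) (mapRingHom φ) (mapRingHom ψ)
    (fun q hq => by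
      ext n
      simp only [coe_mapRingHom, coeff_map]
      refine h _ fun g => ?_
      conv_rhs => rw [← hq g]
      rw [smul_eq_map, coeff_map]
      rfl) p
  have := congrArg (fun q => q.coeff (e g)) hg
  simp only [coe_mapRingHom, coeff_map] at this
  rw [smul_eq_map, coeff_map, hp] at this
  exact hc g this

end

variable {k : Type u} [Field k]

section
variable {H : Type} [Group H] {S : Scheme.{u}}

/-- The action on the ring of sections over `W` induced by an action on a scheme that maps `W`
to itself. -/
noncomputable abbrev sectionsAction (act : H → (S ⟶ S)) (h1 : act 1 = 𝟙 S)
    (hmul : ∀ h h', act (h * h') = act h ≫ act h') (W : S.Opens)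
    (hW : ∀ h, W ≤ act h ⁻¹ᵁ W) : MulSemiringAction H Γ(S, W) :=
  MulSemiringAction.compHom _
    ({ toFun := fun h => ((act h).appLE W W (hW h)).hom
       map_one' := by
        ext a
        have : (act 1).appLE W W (hW 1) = (𝟙 S :).appLE W W (by simp) := by
          congr 1
        rw [this]
        exact congrArg (fun f => f.hom a)
          ((Scheme.Hom.app_eq_appLE (f := 𝟙 S) (U := W)).symm.trans (Scheme.Hom.id_app W))
       map_mul' := fun h h' => by
        have : (act (h * h')).appLE W W (hW _) = (act h').appLE W W (hW _) ≫
            (act h).appLE W W (hW _) := by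
          rw [Scheme.Hom.appLE_comp_appLE]
          congr 1
          exact hmul h h'
        rw [this]
        rfl } : H →* (Γ(S, W) →+* Γ(S, W)))

theorem exists_eq_specMap_fromSpec {W : S.Opens} (hW : IsAffineOpen W) {K : CommRingCat.{u}}
    (g : Spec K ⟶ S) (hg : Set.range g ⊆ W) : ∃ φ : Γ(S, W) ⟶ K, g = Spec.map φ ≫ hW.fromSpec := by
  have hg' : Set.range g ⊆ Set.range hW.fromSpec := by rwa [hW.range_fromSpec]
  obtain ⟨φ, hφ⟩ := Spec.map_surjective (IsOpenImmersion.lift hW.fromSpec g hg')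
  exact ⟨φ, by rw [hφ, IsOpenImmersion.lift_fac]⟩

end

namespace QuotientPiece

variable {H : Type} [Group H] {V : SchOver k} {ρ : H → (V ⟶ V)} (P : QuotientPiece V ρ)

omit [Group H] in
include P in
theorem mono_ι : Mono P.ι := by
  have := P.isImmersion
  exact Over.mono_of_mono_left P.ι

theorem act_one (h1 : ρ 1 = 𝟙 V) : P.act 1 = 𝟙 _ := by
  have := P.mono_ι
  rw [← cancel_mono P.ι, P.act_ι, h1, Category.comp_id, Category.id_comp]

theorem act_mul (hmul : ∀ h h', ρ (h * h') = ρ h ≫ ρ h') (h h' : H) :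
    P.act (h * h') = P.act h ≫ P.act h' := by
  have := P.mono_ι
  rw [← cancel_mono P.ι, P.act_ι, hmul, Category.assoc, P.act_ι, ← Category.assoc (P.act h),
    P.act_ι, Category.assoc]

variable [Finite H] (h1 : ρ 1 = 𝟙 V) (hmul : ∀ h h', ρ (h * h') = ρ h ≫ ρ h')
include h1 hmul

/-- The quotient map is surjective, since rings are integral over their rings of invariants. -/
theorem surjective_π : Function.Surjective P.π.left := by
  intro y
  obtain ⟨U, hU, hy, -⟩ := exists_isAffineOpen_mem_and_subset (x := y) (U := ⊤) trivial
  have := P.isAffineHom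
  have hW : IsAffineOpen (P.π.left ⁻¹ᵁ U) := hU.preimage P.π.left
  let _ : MulSemiringAction H Γ(P.S.obj.left, P.π.left ⁻¹ᵁ U) :=
    sectionsAction (fun h => (P.act h).left) (by rw [P.act_one h1]; rfl)
      (fun h h' => by rw [P.act_mul hmul]; rfl) (P.π.left ⁻¹ᵁ U) (P.preimage_le U)
  let _ : Algebra Γ(P.Q.obj.left, U) Γ(P.S.obj.left, P.π.left ⁻¹ᵁ U) :=
    (P.π.left.app U).hom.toAlgebra
  have hinv : Algebra.IsInvariant Γ(P.Q.obj.left, U) Γ(P.S.obj.left, P.π.left ⁻¹ᵁ U) H :=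
    ⟨fun a ha => P.exists_app_eq U a fun h _ => ha h⟩
  have hint : Algebra.IsIntegral Γ(P.Q.obj.left, U) Γ(P.S.obj.left, P.π.left ⁻¹ᵁ U) :=
    hinv.isIntegral _ _ _
  have hfaith : FaithfulSMul Γ(P.Q.obj.left, U) Γ(P.S.obj.left, P.π.left ⁻¹ᵁ U) :=
    (faithfulSMul_iff_algebraMap_injective _ _).mpr (P.app_injective U)
  have hy' : y ∈ Set.range hU.fromSpec := by rwa [hU.range_fromSpec]
  obtain ⟨p, rfl⟩ := hy'
  obtain ⟨q, rfl⟩ := Algebra.IsIntegral.comap_surjective Γ(P.Q.obj.left, U)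
    Γ(P.S.obj.left, P.π.left ⁻¹ᵁ U) p
  refine ⟨hW.fromSpec q, ?_⟩
  have e := hU.SpecMap_appLE_fromSpec P.π.left hW le_rfl
  rw [← Scheme.Hom.app_eq_appLE] at e
  exact (congrArg (fun f => f q) e).symm

theorem exists_comp_π_eq {Ω : GeomPt k} (q : Ω.pt ⟶ P.Q.obj) : ∃ s, s ≫ P.π = q :=
  exists_geomPt_lift P.π q (P.surjective_π h1 hmul _)

/-- The geometric fibres of a quotient map are the orbits. -/
theorem comp_π_eq_iff {Ω : GeomPt k} (s s' : Ω.pt ⟶ P.S.obj) :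
    s ≫ P.π = s' ≫ P.π ↔ ∃ h, s ≫ P.act h = s' := by
  constructor
  · intro hs
    obtain ⟨U, hU, hy, -⟩ := exists_isAffineOpen_mem_and_subset
      (x := GeomPt.im (s ≫ P.π)) (U := ⊤) trivial
    have := P.isAffineHom
    have hW : IsAffineOpen (P.π.left ⁻¹ᵁ U) := hU.preimage P.π.left
    let _ : MulSemiringAction H Γ(P.S.obj.left, P.π.left ⁻¹ᵁ U) :=
      sectionsAction (fun h => (P.act h).left) (by rw [P.act_one h1]; rfl)
        (fun h h' => by rw [P.act_mul hmul]; rfl) (P.π.left ⁻¹ᵁ U) (P.preimage_le U)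
    have hr : ∀ t : Ω.pt ⟶ P.S.obj, GeomPt.im (t ≫ P.π) ∈ U →
        Set.range t.left ⊆ (P.π.left ⁻¹ᵁ U : P.S.obj.left.Opens) := by
      rintro t ht _ ⟨x, rfl⟩
      rw [Ω.eq_closedPt x]
      rw [GeomPt.im_comp] at ht
      exact ht
    obtain ⟨φ, hφ⟩ := exists_eq_specMap_fromSpec hW s.left (hr s hy)
    obtain ⟨ψ, hψ⟩ := exists_eq_specMap_fromSpec hW s'.left (hr s' (hs ▸ hy))
    have hπ := hU.SpecMap_appLE_fromSpec P.π.left hW le_rfl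
    have e : P.π.left.appLE U _ le_rfl ≫ φ = P.π.left.appLE U _ le_rfl ≫ ψ := by
      apply Spec.map_injective
      rw [← cancel_mono hU.fromSpec, Spec.map_comp, Spec.map_comp, Category.assoc, Category.assoc,
        hπ, ← Category.assoc, ← Category.assoc, ← hφ, ← hψ]
      exact congrArg (·.left) hs
    obtain ⟨h, hh⟩ := exists_forall_eq_smul_of_eqOn_fixed (G := H) φ.hom ψ.hom (fun a ha => by
      obtain ⟨b, rfl⟩ := P.exists_app_eq U a fun h _ => ha h
      rw [← Scheme.Hom.app_eq_appLE] at e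
      exact congrArg (fun f => f.hom b) e)
    refine ⟨h, ?_⟩
    ext1
    have e2 : ψ =
        (P.act h).left.appLE (P.π.left ⁻¹ᵁ U) (P.π.left ⁻¹ᵁ U) (P.preimage_le U h) ≫ φ := by
      ext a
      exact hh a
    rw [Over.comp_left, hφ, hψ, e2, Spec.map_comp, Category.assoc, Category.assoc,
      hW.SpecMap_appLE_fromSpec (P.act h).left hW (P.preimage_le U h)]
  · rintro ⟨h, rfl⟩
    rw [Category.assoc, P.act_π]

end QuotientPiece

/-- The class of a quotient is the class of the family of geometric points modulo orbits. -/
theorem IsQuotientClass.hasClass {H : Type} [Group H] [Finite H] {V : SchOver k}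
    {ρ : H → (V ⟶ V)} {W : Set V.left} {m : GrothendieckRing k} (hm : IsQuotientClass V ρ W m)
    (h1 : ρ 1 = 𝟙 V) (hmul : ∀ h h', ρ (h * h') = ρ h ≫ ρ h') :
    HasClass V (fun _ => {x | GeomPt.im x ∈ W})
      (fun _ x => Set.range fun h => x ≫ ρ h) m := by
  obtain ⟨n, P, hd, rfl, rfl⟩ := hm
  have hstep : ∀ i h, ∀ {Ω : GeomPt k} (x : Ω.pt ⟶ V), GeomPt.im x ∈ Set.range (P i).ι.left →
      GeomPt.im (x ≫ ρ h) ∈ Set.range (P i).ι.left := by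
    intro i h _ x hx
    obtain ⟨s, rfl⟩ := exists_geomPt_lift _ _ hx
    rw [Category.assoc, ← (P i).act_ι, ← Category.assoc, GeomPt.im_comp]
    exact ⟨_, rfl⟩
  have horb : ∀ Ω : GeomPt k, ∀ x y : Ω.pt ⟶ V,
      (Set.range fun h => x ≫ ρ h) = (Set.range fun h => y ≫ ρ h) ↔ ∃ h, x ≫ ρ h = y := by
    intro Ω x y
    constructor
    · intro h
      have : y ∈ Set.range fun h => y ≫ ρ h := ⟨1, by simp [h1]⟩
      rwa [← h] at this
    · rintro ⟨h, rfl⟩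
      ext z
      constructor
      · rintro ⟨g, rfl⟩
        exact ⟨h⁻¹ * g, by simp [← hmul]⟩
      · rintro ⟨g, rfl⟩
        exact ⟨h * g, by simp [hmul]⟩
  have key : ∀ i, HasClass V (fun _ => {x | GeomPt.im x ∈ Set.range (P i).ι.left})
      (fun _ x => Set.range fun h => x ≫ ρ h) (cls (P i).Q) := by
    intro i
    refine ⟨(P i).S, (P i).Q, (P i).ι, (P i).π, rfl, fun Ω => ⟨fun s => ?_, fun x hx => ?_,
      (P i).exists_comp_π_eq h1 hmul, fun s s' => ?_⟩⟩
    · rw [Set.mem_ofPred_eq, GeomPt.im_comp]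
      exact ⟨_, rfl⟩
    · obtain ⟨s, rfl⟩ := exists_geomPt_lift _ _ hx
      exact ⟨s, rfl⟩
    · rw [(P i).comp_π_eq_iff h1 hmul, horb]
      have := (P i).mono_ι
      simp_rw [Category.assoc, ← (P i).act_ι, ← Category.assoc, cancel_mono]
  refine (HasClass.sum Finset.univ (fun i _ => key i) ?_).congr (fun Ω => ?_)
    fun _ _ _ _ _ => Iff.rfl
  · intro i _ j _ hij Ω x hx y hy he
    obtain ⟨h, rfl⟩ := (horb Ω x y).mp he
    exact Set.disjoint_left.mp (hd hij) (hstep i h x hx) hy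
  · ext x
    simp

end

section

/-! ### Quotients of affine schemes by finite groups -/

section sections

variable {X Y Z : Scheme.{u}}

/-- Restriction of sections. -/
noncomputable abbrev res {U V : X.Opens} (h : V ≤ U) : Γ(X, U) →+* Γ(X, V) :=
  (X.presheaf.map (homOfLE h).op).hom

/-- Pull-back of sections. -/
noncomputable abbrev pull (f : X ⟶ Y) {U : Y.Opens} {V : X.Opens} (h : V ≤ f ⁻¹ᵁ U) :
    Γ(Y, U) →+* Γ(X, V) :=
  (f.appLE U V h).hom

theorem top_le_preimage (f : X ⟶ Y) : (⊤ : X.Opens) ≤ f ⁻¹ᵁ ⊤ := le_rfl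

theorem res_res {U V W : X.Opens} (h : V ≤ U) (h' : W ≤ V) (s : Γ(X, U)) :
    res h' (res h s) = res (h'.trans h) s := by
  change (X.presheaf.map (homOfLE h).op ≫ X.presheaf.map (homOfLE h').op).hom s = _
  rw [← Functor.map_comp]
  rfl

theorem res_pull (f : X ⟶ Y) {U : Y.Opens} {V V' : X.Opens} (h : V ≤ f ⁻¹ᵁ U) (h' : V' ≤ V)
    (s : Γ(Y, U)) : res h' (pull f h s) = pull f (h'.trans h) s := by
  change (f.appLE U V h ≫ X.presheaf.map (homOfLE h').op).hom s = _
  rw [Scheme.Hom.appLE_map]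

theorem pull_res (f : X ⟶ Y) {U U' : Y.Opens} {V : X.Opens} (h : V ≤ f ⁻¹ᵁ U) (h' : U ≤ U')
    (s : Γ(Y, U')) : pull f h (res h' s) = pull f (h.trans (f.preimage_mono h')) s := by
  change (Y.presheaf.map (homOfLE h').op ≫ f.appLE U V h).hom s = _
  rw [Scheme.Hom.map_appLE]

theorem pull_pull (f : X ⟶ Y) (g : Y ⟶ Z) {U : Z.Opens} {V : Y.Opens} {W : X.Opens}
    (h : V ≤ g ⁻¹ᵁ U) (h' : W ≤ f ⁻¹ᵁ V) (s : Γ(Z, U)) :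
    pull f h' (pull g h s) = pull (f ≫ g) (h'.trans (f.preimage_mono h)) s := by
  change (g.appLE U V h ≫ f.appLE V W h').hom s = _
  rw [Scheme.Hom.appLE_comp_appLE]

variable [IsAffine X] {b : Γ(X, ⊤)} {V : X.Opens}

theorem isUnit_res_of_eq_basicOpen (e : V = X.basicOpen b) : IsUnit (res (le_top : V ≤ ⊤) b) := by
  subst e
  exact IsLocalization.Away.algebraMap_isUnit (S := Γ(X, X.basicOpen b)) b

theorem exists_mul_pow_eq_res_of_eq_basicOpen (e : V = X.basicOpen b) (f : Γ(X, V)) :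
    ∃ (n : ℕ) (a : Γ(X, ⊤)), f * res le_top b ^ n = res le_top a := by
  subst e
  obtain ⟨n, a, h⟩ := IsLocalization.Away.surj (S := Γ(X, X.basicOpen b)) b f
  exact ⟨n, a, h⟩

theorem exists_pow_mul_eq_zero_of_eq_basicOpen (e : V = X.basicOpen b) {a : Γ(X, ⊤)}
    (ha : res (le_top : V ≤ ⊤) a = 0) : ∃ n : ℕ, b ^ n * a = 0 := by
  subst e
  obtain ⟨⟨_, n, rfl⟩, h⟩ := (IsLocalization.map_eq_zero_iff (Submonoid.powers b)
    Γ(X, X.basicOpen b) a).mp ha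
  exact ⟨n, h⟩

end sections

section affine

variable {S Q : Scheme.{u}} [IsAffine S] [IsAffine Q] (π : S ⟶ Q) {H : Type} [Finite H]
  (act : H → (S ⟶ S)) (hπ : ∀ h, act h ≫ π = π)

include hπ in
omit [IsAffine S] [IsAffine Q] [Finite H] in
theorem preimage_le_of_comp_eq (U : Q.Opens) (h : H) :
    π ⁻¹ᵁ U ≤ act h ⁻¹ᵁ (π ⁻¹ᵁ U) := by
  rw [← Scheme.Hom.comp_preimage, hπ]

variable (hinj : Function.Injective (pull π (top_le_preimage π)))
  (hinv : ∀ f : Γ(S, ⊤), (∀ h, pull (act h) (top_le_preimage _) f = f) →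
    ∃ s, pull π (top_le_preimage π) s = f)

include hinj in
theorem pull_injective_basicOpen (b : Γ(Q, ⊤)) :
    Function.Injective (pull π (le_refl (π ⁻¹ᵁ Q.basicOpen b))) := by
  have e : π ⁻¹ᵁ Q.basicOpen b = S.basicOpen (pull π (top_le_preimage π) b) := by
    rw [Scheme.basicOpen_appLE, top_inf_eq]
  rw [injective_iff_map_eq_zero]
  intro s hs
  obtain ⟨n, c, hc⟩ := exists_mul_pow_eq_res_of_eq_basicOpen rfl s
  have hc0 : res (le_top : π ⁻¹ᵁ Q.basicOpen b ≤ ⊤) (pull π (top_le_preimage π) c) = 0 := by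
    have := congrArg (pull π (le_refl (π ⁻¹ᵁ Q.basicOpen b))) hc
    rw [map_mul, hs, zero_mul, pull_res] at this
    rw [res_pull]
    exact this.symm
  obtain ⟨m, hm⟩ := exists_pow_mul_eq_zero_of_eq_basicOpen e hc0
  rw [← map_pow, ← map_mul] at hm
  have hm' := hinj (hm.trans (map_zero _).symm)
  have hu := isUnit_res_of_eq_basicOpen (rfl : Q.basicOpen b = Q.basicOpen b)
  have := congrArg (res (le_top : Q.basicOpen b ≤ ⊤)) hm'
  rw [map_mul, map_pow, map_zero, ← hc] at this
  rwa [(hu.pow m).mul_right_eq_zero, (hu.pow n).mul_left_eq_zero] at this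

include hinv in
theorem exists_pull_eq_basicOpen (b : Γ(Q, ⊤)) (f : Γ(S, π ⁻¹ᵁ Q.basicOpen b))
    (hf : ∀ h, pull (act h) (preimage_le_of_comp_eq π act hπ _ h) f = f) :
    ∃ s, pull π le_rfl s = f := by
  have e : π ⁻¹ᵁ Q.basicOpen b = S.basicOpen (pull π (top_le_preimage π) b) := by
    rw [Scheme.basicOpen_appLE, top_inf_eq]
  obtain ⟨n, a, ha⟩ := exists_mul_pow_eq_res_of_eq_basicOpen e f
  have hb : ∀ h, pull (act h) (top_le_preimage (act h)) (pull π (top_le_preimage π) b) =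
      pull π (top_le_preimage π) b := by
    intro h
    rw [pull_pull]
    congr 3
    exact hπ h
  have h1 : ∀ h, ∃ m : ℕ, pull π (top_le_preimage π) b ^ m *
      (pull (act h) (top_le_preimage (act h)) a - a) = 0 := by
    intro h
    apply exists_pow_mul_eq_zero_of_eq_basicOpen e
    rw [map_sub, ← ha, sub_eq_zero, res_pull]
    have := congrArg (pull (act h) (preimage_le_of_comp_eq π act hπ (Q.basicOpen b) h)) ha
    rw [map_mul, hf, map_pow, pull_res, pull_res] at this
    rw [← this]
    congr 2
    have := congrArg (res (le_top : π ⁻¹ᵁ Q.basicOpen b ≤ ⊤)) (hb h)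
    rw [res_pull] at this
    exact this
  choose m hm using h1
  have := Fintype.ofFinite H
  -- after multiplication by a large power of `b`, the numerator of `f` is invariant
  let M := ∑ h, m h
  have h2 : ∀ h, pull π (top_le_preimage π) b ^ M *
      (pull (act h) (top_le_preimage (act h)) a - a) = 0 := by
    intro h
    have : m h ≤ M := Finset.single_le_sum (fun _ _ => Nat.zero_le _) (Finset.mem_univ h)
    rw [← Nat.sub_add_cancel this, pow_add, mul_assoc, hm, mul_zero]
  obtain ⟨c, hc⟩ := hinv (pull π (top_le_preimage π) b ^ M * a) (fun h => by
    rw [map_mul, map_pow, hb, ← sub_eq_zero, ← mul_sub, h2])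
  obtain ⟨v, hv⟩ := (isUnit_res_of_eq_basicOpen (rfl : Q.basicOpen b = Q.basicOpen b))
  have hu := isUnit_res_of_eq_basicOpen e
  refine ⟨res le_top c * (↑(v⁻¹ ^ (M + n)) : Γ(Q, Q.basicOpen b)), ?_⟩
  have hv' : pull π (le_refl (π ⁻¹ᵁ Q.basicOpen b)) v =
      res le_top (pull π (top_le_preimage π) b) := by
    rw [hv, pull_res, res_pull]
  rw [← (hu.pow (M + n)).mul_left_inj, map_mul, mul_assoc, ← hv', ← map_pow, ← map_mul,
    ← Units.val_pow_eq_pow_val, ← Units.val_mul, ← mul_pow, inv_mul_cancel, one_pow, Units.val_one,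
    map_one, mul_one, pull_res, Units.val_pow_eq_pow_val, map_pow, hv', pow_add,
    mul_comm (_ ^ M), ← mul_assoc, ha, ← map_pow, ← map_mul, mul_comm a, ← hc, res_pull]

theorem exists_basicOpen_cover {Q : Scheme.{u}} [IsAffine Q] (U : Q.Opens) : ∃ b : U → Γ(Q, ⊤),
    (∀ x, Q.basicOpen (b x) ≤ U) ∧ U ≤ ⨆ x, Q.basicOpen (b x) := by
  have : ∀ x : U, ∃ b : Γ(Q, ⊤), x.1 ∈ Q.basicOpen b ∧ Q.basicOpen b ≤ U := by
    intro x
    obtain ⟨_, ⟨b, rfl⟩, h1, h2⟩ :=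
      (TopologicalSpace.Opens.isBasis_iff_nbhd.mp (isBasis_basicOpen Q)) x.2
    exact ⟨b, h1, h2⟩
  choose b hb hb' using this
  exact ⟨b, hb', fun x hx => TopologicalSpace.Opens.mem_iSup.mpr ⟨⟨x, hx⟩, hb _⟩⟩

include hinj in
theorem pull_injective (U : Q.Opens) :
    Function.Injective (pull π (le_refl (π ⁻¹ᵁ U))) := by
  intro s t hst
  obtain ⟨b, hb, hb'⟩ := exists_basicOpen_cover U
  refine TopCat.Sheaf.eq_of_locally_eq' Q.sheaf (fun x => Q.basicOpen (b x)) U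
    (fun x => homOfLE (hb x)) hb' s t fun x => ?_
  apply pull_injective_basicOpen π hinj (b x)
  change pull π _ (res (hb x) s) = pull π _ (res (hb x) t)
  rw [pull_res, pull_res]
  have := congrArg (res (π.preimage_mono (hb x))) hst
  rwa [res_pull, res_pull] at this

include hinj hinv in
/-- A section over `π ⁻¹ U` that is invariant is the pull-back of a section over `U`, as soon as
this holds for global sections: it holds on basic open sets by localization, and these sections
glue. -/
theorem exists_pull_eq (U : Q.Opens) (f : Γ(S, π ⁻¹ᵁ U))
    (hf : ∀ h, pull (act h) (preimage_le_of_comp_eq π act hπ _ h) f = f) :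
    ∃ s, pull π le_rfl s = f := by
  obtain ⟨b, hb, hb'⟩ := exists_basicOpen_cover U
  have : ∀ x, ∃ s, pull π (le_refl (π ⁻¹ᵁ Q.basicOpen (b x))) s =
      res (π.preimage_mono (hb x)) f := by
    intro x
    refine exists_pull_eq_basicOpen π act hπ hinv (b x) _ fun h => ?_
    rw [pull_res]
    conv_rhs => rw [← hf h]
    rw [res_pull]
  choose s hs using this
  obtain ⟨t, ht, -⟩ := TopCat.Sheaf.existsUnique_gluing' Q.sheaf (fun x => Q.basicOpen (b x)) U
    (fun x => homOfLE (hb x)) hb' s (by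
      intro x y
      apply pull_injective π hinj
      change pull π _ (res _ (s x)) = pull π _ (res _ (s y))
      rw [pull_res, pull_res]
      have h1 := congrArg (res (π.preimage_mono
        (inf_le_left : Q.basicOpen (b x) ⊓ Q.basicOpen (b y) ≤ _))) (hs x)
      have h2 := congrArg (res (π.preimage_mono
        (inf_le_right : Q.basicOpen (b x) ⊓ Q.basicOpen (b y) ≤ _))) (hs y)
      rw [res_pull, res_res] at h1 h2
      exact h1.trans h2.symm)
  replace ht : ∀ x, res (hb x) (t : Γ(Q, U)) = s x := ht
  change Γ(Q, U) at t
  refine ⟨t, ?_⟩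
  refine TopCat.Sheaf.eq_of_locally_eq' S.sheaf (fun x => π ⁻¹ᵁ Q.basicOpen (b x)) (π ⁻¹ᵁ U)
    (fun x => homOfLE (π.preimage_mono (hb x))) ?_ _ _ fun x => ?_
  · rw [← Scheme.Hom.preimage_iSup]
    exact π.preimage_mono hb'
  · change res _ (pull π _ t) = res _ f
    rw [← hs x, ← ht x, pull_res, res_pull]

end affine

end

section

variable {k : Type u} [Field k]

/-! ### Existence of classes of quotients -/

/-- An invariant piece of a scheme with finite group action that is affine has a quotient: the
spectrum of the ring of invariants, which is of finite type by the Artin–Tate lemma. -/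
theorem exists_quotientPiece_of_isAffine {V : SchOver k} {H : Type} [Group H] [Finite H]
    {ρ : H → (V ⟶ V)} (T : FTScheme k) [IsAffine T.obj.left] (ι : T.obj ⟶ V)
    [IsImmersion ι.left] (act : H → (T.obj ⟶ T.obj)) (hact : ∀ h, act h ≫ ι = ι ≫ ρ h)
    (h1 : act 1 = 𝟙 _) (hmul : ∀ h h', act (h * h') = act h ≫ act h') :
    ∃ P : QuotientPiece V ρ, Set.range P.ι.left = Set.range ι.left := by
  let A := Γ(T.obj.left, ⊤)
  let _ : MulSemiringAction H A := sectionsAction (fun h => (act h).left) (by rw [h1]; rfl)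
    (fun h h' => by rw [hmul]; rfl) ⊤ (fun h => top_le_preimage _)
  have hsmul : ∀ (h : H) (a : A), h • a = (act h).left.appTop.hom a := fun h a => by
    rw [Scheme.Hom.appTop, Scheme.Hom.app_eq_appLE]
    rfl
  let φ : CommRingCat.of k ⟶ A := (Scheme.ΓSpecIso (CommRingCat.of k)).inv ≫ T.obj.hom.appTop
  let _ : Algebra k A := φ.hom.toAlgebra
  have hφ : φ.hom.FiniteType := by
    have h2 : T.obj.hom.appTop.hom.FiniteType :=
      HasRingHomProperty.appTop (P := @LocallyOfFiniteType) T.obj.hom inferInstance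
    exact h2.comp (RingHom.FiniteType.of_surjective _ (ConcreteCategory.bijective_of_isIso
      (Scheme.ΓSpecIso (CommRingCat.of k)).inv).surjective)
  have hφh : ∀ (h : H) (c : k), h • (φ.hom c : A) = φ.hom c := by
    intro h c
    rw [hsmul]
    have e : φ ≫ (act h).left.appTop = φ := by
      simp only [φ, Category.assoc]
      rw [← Scheme.Hom.comp_appTop, Over.w]
    exact congrArg (fun f => f.hom c) e
  have : SMulCommClass H k A := ⟨fun h c a => by
    rw [Algebra.smul_def, smul_mul', Algebra.smul_def]
    congr 1
    exact hφh h c⟩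
  let B := FixedPoints.subalgebra k A H
  have hinvB : Algebra.IsInvariant B A H := ⟨fun a ha => ⟨⟨a, ha⟩, rfl⟩⟩
  have hB : Algebra.FiniteType k B := by
    have hA : Algebra.FiniteType k A := hφ
    have : Algebra.FiniteType B A := Algebra.FiniteType.of_restrictScalars_finiteType k B A
    have : Algebra.IsIntegral B A := hinvB.isIntegral _ _ _
    have : Module.Finite B A := Algebra.IsIntegral.finite
    exact ⟨fg_of_fg_of_fg k B A hA.out this.1 Subtype.val_injective⟩
  let val : CommRingCat.of B ⟶ A := CommRingCat.ofHom B.val.toRingHom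
  let str : CommRingCat.of k ⟶ CommRingCat.of B := CommRingCat.ofHom (algebraMap k B)
  have hval : str ≫ val = φ := rfl
  let p : T.obj.left ⟶ Spec (CommRingCat.of B) := T.obj.left.toSpecΓ ≫ Spec.map val
  have hp : p.appTop = (Scheme.ΓSpecIso (CommRingCat.of B)).hom ≫ val := by
    simp only [p]
    rw [Scheme.Hom.comp_appTop, Scheme.toSpecΓ_appTop, Scheme.ΓSpecIso_naturality]
  have hpw : p ≫ Spec.map str = T.obj.hom := by
    apply ext_of_isAffine
    rw [Scheme.Hom.comp_appTop, hp, Scheme.ΓSpecIso_naturality_assoc, hval]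
    simp [φ]
  have hpact : ∀ h, (act h).left ≫ p = p := by
    intro h
    apply ext_of_isAffine
    rw [Scheme.Hom.comp_appTop, hp, Category.assoc]
    congr 1
    ext b
    exact (hsmul h b.1).symm.trans (b.2 h)
  have hpull : ∀ s, pull p (top_le_preimage p) s = p.appTop.hom s := fun s => by
    rw [Scheme.Hom.appTop, Scheme.Hom.app_eq_appLE]
    rfl
  have hinj : Function.Injective (pull p (top_le_preimage p)) := by
    intro s t hst
    rw [hpull, hpull, hp] at hst
    have := Subtype.val_injective hst
    exact (ConcreteCategory.bijective_of_isIso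
      (Scheme.ΓSpecIso (CommRingCat.of B)).hom).injective this
  have hinv : ∀ f : A, (∀ h, pull (act h).left (top_le_preimage _) f = f) →
      ∃ s, pull p (top_le_preimage p) s = f := by
    intro f hf
    obtain ⟨s, hs⟩ := (ConcreteCategory.bijective_of_isIso
      (Scheme.ΓSpecIso (CommRingCat.of B)).hom).surjective (⟨f, hf⟩ : B)
    refine ⟨s, ?_⟩
    rw [hpull, hp]
    exact congrArg Subtype.val hs
  let Q : FTScheme k :=
    { obj := Over.mk (Spec.map str)
      locallyOfFiniteType := by
        dsimp
        rw [HasRingHomProperty.Spec_iff (P := @LocallyOfFiniteType)]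
        exact (RingHom.finiteType_algebraMap).mpr hB
      quasiCompact := by dsimp; infer_instance }
  exact ⟨{
    S := T
    Q := Q
    ι := ι
    isImmersion := inferInstance
    act := act
    act_ι := hact
    π := Over.homMk p hpw
    isAffineHom := inferInstanceAs (IsAffineHom p)
    act_π := fun h => by ext1; exact hpact h
    app_injective := fun U => by
      have := pull_injective p hinj U
      rw [Scheme.Hom.app_eq_appLE]
      exact this
    exists_app_eq := fun U f hf => by
      have := exists_pull_eq p (fun h => (act h).left) hpact hinj hinv U f fun h => hf h _
      rw [Scheme.Hom.app_eq_appLE]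
      exact this }, rfl⟩

/-- A Noetherian scheme has a dense affine open subscheme: a disjoint union of affine open subsets
of the irreducible components that avoid the other components. -/
theorem exists_dense_isAffineOpen (S : Scheme.{u}) [IsNoetherian S] :
    ∃ U : S.Opens, IsAffineOpen U ∧ Dense (U : Set S) := by
  have hfin : (irreducibleComponents S).Finite :=
    TopologicalSpace.NoetherianSpace.finite_irreducibleComponents
  have : ∀ Z : irreducibleComponents S, ∃ U : S.Opens, IsAffineOpen U ∧
      U ≤ Scheme.irreducibleComponentOpen S Z ∧ ((U : Set S) ∩ Z).Nonempty := by
    intro Z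
    have hcl := closure_sUnion_irreducibleComponents_sdiff_singleton hfin Z.1 Z.2
    have hne : (Scheme.irreducibleComponentOpen S Z : Set S).Nonempty := by
      rw [← closure_nonempty_iff]
      change (closure (⋃₀ (irreducibleComponents S \ {Z.1}))ᶜ).Nonempty
      rw [hcl]
      exact Z.2.1.1
    obtain ⟨x, hx⟩ := hne
    obtain ⟨U, hU, hxU, hUle⟩ := exists_isAffineOpen_mem_and_subset (x := x) hx
    refine ⟨U, hU, hUle, x, hxU, ?_⟩
    rw [← hcl]
    exact subset_closure hx
  choose U hU hUle hne using this
  have := hfin.to_subtype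
  refine ⟨⨆ Z, U Z, IsAffineOpen.iSup_of_disjoint hU fun Z Z' hZ => ?_, ?_⟩
  · rw [Function.onFun, ← TopologicalSpace.Opens.coe_disjoint, Set.disjoint_left]
    intro x hx hx'
    have h1 := hUle Z hx
    have h2 := hUle Z' hx'
    refine h1 ⟨irreducibleComponent x, ⟨irreducibleComponent_mem_irreducibleComponents x, ?_⟩,
      mem_irreducibleComponent⟩
    intro hxZ
    exact h2 ⟨irreducibleComponent x, ⟨irreducibleComponent_mem_irreducibleComponents x,
      fun h => hZ (Subtype.ext (Eq.trans (Eq.symm hxZ) h))⟩, mem_irreducibleComponent⟩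
  · rw [dense_iff_inter_open]
    rintro O hO ⟨x, hx⟩
    obtain ⟨y, hyO, hyU⟩ := (irreducibleComponent_mem_irreducibleComponents x).1.2 O _ hO
      (U ⟨_, irreducibleComponent_mem_irreducibleComponents x⟩).isOpen
      ⟨x, mem_irreducibleComponent, hx⟩ (by rw [Set.inter_comm]; exact hne _)
    exact ⟨y, hyU.1, TopologicalSpace.Opens.mem_iSup.mpr ⟨_, hyU.2⟩⟩

theorem IsQuotientClass.add_piece {V : SchOver k} {H : Type} {ρ : H → (V ⟶ V)} {W W' : Set V.left}
    {m : GrothendieckRing k} (h : IsQuotientClass V ρ W m) (P : QuotientPiece V ρ)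
    (hd : Disjoint (Set.range P.ι.left) W) (hW' : Set.range P.ι.left ∪ W = W') :
    IsQuotientClass V ρ W' (cls P.Q + m) := by
  obtain ⟨n, p, hp, rfl, rfl⟩ := h
  rw [Set.disjoint_iUnion_right] at hd
  refine ⟨n + 1, Fin.cons P p, ?_, ?_, ?_⟩
  · intro i j hij
    induction i using Fin.cases with
    | zero =>
      induction j using Fin.cases with
      | zero => exact absurd rfl hij
      | succ j => exact hd j
    | succ i =>
      induction j using Fin.cases with
      | zero => exact (hd i).symm
      | succ j => exact hp fun h => hij (congrArg Fin.succ h)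
  · rw [← hW']
    ext x
    simp only [Set.mem_iUnion, Fin.exists_fin_succ, Set.mem_union]
    rfl
  · rw [Fin.sum_univ_succ]
    rfl

/-- The class of the quotient of an invariant locally closed subset by a finite group exists: the
intersection of the translates of a dense affine open subset is dense, invariant and, as the scheme
is separated, affine, so it is a piece with a quotient, and its complement is smaller. -/
theorem exists_isQuotientClass (V : FTScheme k) (hV : IsSeparated V.obj.hom) {H : Type} [Group H]
    [Finite H] {ρ : H → (V.obj ⟶ V.obj)} (h1 : ρ 1 = 𝟙 _)
    (hmul : ∀ h h', ρ (h * h') = ρ h ≫ ρ h') (W : Set V.obj.left) (hW : IsLocallyClosed W)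
    (hinv : ∀ h, Set.MapsTo (ρ h).left W W) : ∃ m, IsQuotientClass V.obj ρ W m := by
  -- Noetherian induction on the closure of `W`
  generalize hZ : TopologicalSpace.Closeds.closure W = Z
  induction Z using WellFoundedLT.induction generalizing W with
  | ind Z ih =>
  subst hZ
  rcases W.eq_empty_or_nonempty with rfl | hne
  · exact ⟨0, 0, Fin.elim0, fun i => i.elim0, by simp, by simp⟩
  obtain ⟨S, ι, hS, hι, rfl⟩ := V.exists_reduced hW
  have hmono : Mono ι := Over.mono_of_mono_left ι
  have : ∀ h, ∃ a : S.obj ⟶ S.obj, a ≫ ι = ι ≫ ρ h := fun h =>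
    exists_lift_of_range_subset ι (ι ≫ ρ h) (by
      rw [Over.comp_left]
      rintro _ ⟨x, rfl⟩
      rw [Scheme.Hom.comp_apply]
      exact hinv h ⟨x, rfl⟩)
  choose act hact using this
  have act1 : act 1 = 𝟙 _ := by
    rw [← cancel_mono ι, hact, h1, Category.comp_id, Category.id_comp]
  have actmul : ∀ h h', act (h * h') = act h ≫ act h' := fun h h' => by
    rw [← cancel_mono ι, hact, hmul, Category.assoc, hact, ← Category.assoc (act h), hact,
      Category.assoc]
  have actapp : ∀ h h' x, (act h').left ((act h).left x) = (act (h * h')).left x := by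
    intro h h' x
    rw [actmul, Over.comp_left, Scheme.Hom.comp_apply]
  have hiso : ∀ h, IsIso (act h).left := fun h => by
    refine ⟨(act h⁻¹).left, ?_, ?_⟩ <;>
    rw [← Over.comp_left, ← actmul] <;> simp [act1]
  obtain ⟨U, hU, hUd⟩ := exists_dense_isAffineOpen S.obj.left
  let O : S.obj.left.Opens := ⨅ h, (act h).left ⁻¹ᵁ U
  have hsep : IsAffineHom (pullback.diagonal (terminal.from S.obj.left)) := by
    have : IsSeparated S.obj.hom := by
      rw [← Over.w ι]
      infer_instance
    have : IsSeparated (terminal.from S.obj.left) := by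
      rw [← terminal.comp_from S.obj.hom]
      infer_instance
    infer_instance
  have hOaff : IsAffineOpen O := IsAffineOpen.iInf fun h => hU.preimage_of_isIso (act h).left
  have hOmem : ∀ x, x ∈ O ↔ ∀ h, (act h).left x ∈ U := by
    intro x
    rw [← SetLike.mem_coe, TopologicalSpace.Opens.coe_iInf]
    simp
  have hOinv : ∀ h x, x ∈ O → (act h).left x ∈ O := by
    intro h x hx
    rw [hOmem] at hx ⊢
    intro g
    rw [actapp]
    exact hx _
  have hOne : ∃ o, o ∈ O := by
    have := Fintype.ofFinite H
    have key : ∀ A : Finset H, ∃ D : S.obj.left.Opens, Dense (D : Set S.obj.left) ∧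
        ∀ x ∈ D, ∀ h ∈ A, (act h).left x ∈ U := by
      classical
      intro A
      induction A using Finset.induction_on with
      | empty => exact ⟨⊤, dense_univ, by simp⟩
      | insert a A _ ih =>
        obtain ⟨D, hD, hD'⟩ := ih
        refine ⟨D ⊓ (act a).left ⁻¹ᵁ U, hD.inter_of_isOpen_left
          (hUd.preimage (act a).left.homeomorph.isOpenMap) D.isOpen, fun x hx h hh => ?_⟩
        rcases Finset.mem_insert.mp hh with rfl | hh
        · exact hx.2
        · exact hD' x hx.1 h hh
    obtain ⟨D, hD, hD'⟩ := key Finset.univ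
    obtain ⟨_, x, -⟩ := hne
    have : Nonempty S.obj.left := ⟨x⟩
    obtain ⟨o, ho⟩ := hD.nonempty
    exact ⟨o, (hOmem o).mpr fun h => hD' o ho h (Finset.mem_univ h)⟩
  let T := S.restrict O
  let j : T.obj ⟶ S.obj := S.ofImmersionι O.ι
  have hjr : Set.range j.left = O := O.range_ι
  have hj : IsOpenImmersion j.left := inferInstanceAs (IsOpenImmersion O.ι)
  have hTaff : IsAffine T.obj.left := hOaff
  have hTred : IsReduced T.obj.left := isReduced_of_isOpenImmersion j.left
  have hjmono : Mono j := Over.mono_of_mono_left j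
  have : ∀ h, ∃ a : T.obj ⟶ T.obj, a ≫ j = j ≫ act h := fun h =>
    exists_lift_of_range_subset j (j ≫ act h) (by
      rw [Over.comp_left, hjr]
      rintro _ ⟨x, rfl⟩
      rw [Scheme.Hom.comp_apply]
      exact hOinv h _ (hjr.subset ⟨x, rfl⟩))
  choose actT hactT using this
  have hjι : IsImmersion (j ≫ ι).left := by rw [Over.comp_left]; infer_instance
  obtain ⟨P, hP⟩ := exists_quotientPiece_of_isAffine T (j ≫ ι) (ρ := ρ) actT
    (fun h => by rw [← Category.assoc, hactT, Category.assoc, hact, Category.assoc])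
    (by rw [← cancel_mono j, hactT, act1, Category.comp_id, Category.id_comp])
    (fun h h' => by
      rw [← cancel_mono j, hactT, actmul, Category.assoc, hactT, ← Category.assoc (actT h), hactT,
        Category.assoc])
  have hPO : Set.range P.ι.left = ι.left '' O := by
    rw [hP, Over.comp_left, ← hjr, ← Set.range_comp]
    rfl
  have hinj : Function.Injective ι.left := ι.left.isEmbedding.injective
  have hιact : ∀ h x, (ρ h).left (ι.left x) = ι.left ((act h).left x) := by
    intro h x
    rw [← Scheme.Hom.comp_apply, ← Scheme.Hom.comp_apply, ← Over.comp_left, ← Over.comp_left, hact]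
  have hlt : TopologicalSpace.Closeds.closure (ι.left '' (O : Set S.obj.left)ᶜ) <
      TopologicalSpace.Closeds.closure (Set.range ι.left) := by
    refine lt_of_le_of_ne (closure_mono (Set.image_subset_range _ _)) fun he => ?_
    obtain ⟨o, ho⟩ := hOne
    have h2 : ι.left o ∈ TopologicalSpace.Closeds.closure (Set.range ι.left) :=
      subset_closure ⟨o, rfl⟩
    rw [← he] at h2
    have h3 : o ∈ closure ((O : Set S.obj.left)ᶜ) := by
      rw [ι.left.isEmbedding.isInducing.closure_eq_preimage_closure_image]
      exact h2
    rw [O.isOpen.isClosed_compl.closure_eq] at h3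
    exact h3 ho
  obtain ⟨m, hm⟩ := ih (TopologicalSpace.Closeds.closure (ι.left '' (O : Set S.obj.left)ᶜ)) hlt
    (ι.left '' (O : Set S.obj.left)ᶜ)
    (O.isOpen.isClosed_compl.isLocallyClosed.image ι.left.isEmbedding.isInducing hW)
    (by
      rintro h _ ⟨x, hx, rfl⟩
      refine ⟨(act h).left x, fun hx' => hx ?_, (hιact h x).symm⟩
      have := hOinv h⁻¹ _ hx'
      rwa [actapp, mul_inv_cancel, act1] at this) rfl
  refine ⟨_, hm.add_piece P ?_ ?_⟩
  · rw [hPO, Set.disjoint_image_iff hinj]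
    exact disjoint_compl_right
  · rw [hPO, ← Set.image_union, Set.union_compl_self, Set.image_univ]

end

section

variable {k : Type u} [Field k]

/-! ### Powers and their geometric points -/

/-- The spectrum of `k`. -/
noncomputable def FTScheme.point (k : Type u) [Field k] : FTScheme k where
  obj := Over.mk (𝟙 (Spec (CommRingCat.of k)))
  locallyOfFiniteType := by dsimp; infer_instance
  quasiCompact := by dsimp; infer_instance

section powers

/-- The powers in `SchOver k` are iterated fibre products over `k`. -/
theorem FTScheme.exists_iso_power_fin (X : FTScheme k) (hX : IsSeparated X.obj.hom) (n : ℕ) :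
    ∃ (Y : FTScheme k) (_ : Y.obj ≅ power X.obj (Fin n)), IsSeparated Y.obj.hom := by
  induction n with
  | zero =>
    refine ⟨FTScheme.point k, ⟨Pi.lift fun i => i.elim0,
      Over.homMk (power X.obj (Fin 0)).hom (Category.comp_id _), ?_, ?_⟩, ?_⟩
    · ext1
      have := Over.w (Pi.lift (fun i => i.elim0) :
        Over.mk (𝟙 (Spec (CommRingCat.of k))) ⟶ power X.obj (Fin 0))
      exact this
    · exact Pi.hom_ext _ _ fun i => i.elim0
    · dsimp [FTScheme.point]
      infer_instance
  | succ n ih =>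
    obtain ⟨Y, e, hY⟩ := ih
    refine ⟨X.prod Y, ⟨Pi.lift (Fin.cases (X.fst Y)
        fun i => X.snd Y ≫ e.hom ≫ Pi.π (fun _ : Fin n => X.obj) i),
      FTScheme.lift (Pi.π (fun _ => X.obj) 0)
        (Pi.lift (fun i => Pi.π (fun _ => X.obj) (Fin.succ i)) ≫ e.inv), ?_, ?_⟩, ?_⟩
    · refine FTScheme.prod_ext ?_ ?_
      · simp
      · simp only [Category.assoc, FTScheme.lift_snd, Category.id_comp]
        rw [← Category.assoc, Iso.comp_inv_eq]
        refine Pi.hom_ext _ _ fun i => ?_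
        simp
    · refine Pi.hom_ext _ _ fun i => ?_
      induction i using Fin.cases with
      | zero => simp
      | succ i => simp
    · dsimp [FTScheme.prod]
      infer_instance

theorem FTScheme.exists_iso_power (X : FTScheme k) (hX : IsSeparated X.obj.hom) (I : Type)
    [Finite I] : ∃ (Y : FTScheme k) (_ : Y.obj ≅ power X.obj I), IsSeparated Y.obj.hom := by
  obtain ⟨n, ⟨f⟩⟩ := Finite.exists_equiv_fin I
  obtain ⟨Y, e, hY⟩ := X.exists_iso_power_fin hX n
  refine ⟨Y, e ≪≫ ⟨Pi.lift fun i => Pi.π (fun _ => X.obj) (f i),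
    Pi.lift fun i => Pi.π (fun _ => X.obj) (f.symm i), ?_, ?_⟩, hY⟩ <;>
  · refine Pi.hom_ext _ _ fun i => ?_
    simp

theorem FTScheme.finiteType_power (X : FTScheme k) (hX : IsSeparated X.obj.hom) (I : Type)
    [Finite I] : LocallyOfFiniteType (power X.obj I).hom ∧ QuasiCompact (power X.obj I).hom ∧
      IsSeparated (power X.obj I).hom := by
  obtain ⟨Y, e, hY⟩ := X.exists_iso_power hX I
  have hw : e.inv.left ≫ Y.obj.hom = (power X.obj I).hom := Over.w e.inv
  have : IsIso e.inv.left := inferInstanceAs (IsIso ((Over.forget _).map e.inv))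
  rw [← hw]
  exact ⟨inferInstance, inferInstance, inferInstance⟩

variable {X : SchOver k} {I J : Type} [Finite I] [Finite J]

/-- The coordinates of a geometric point of a power. -/
noncomputable abbrev coord {Ω : GeomPt k} (x : Ω.pt ⟶ power X I) (i : I) : Ω.pt ⟶ X :=
  x ≫ Pi.π (fun _ : I => X) i

theorem coord_injective {Ω : GeomPt k} :
    Function.Injective (coord : (Ω.pt ⟶ power X I) → I → (Ω.pt ⟶ X)) :=
  fun _ _ h => Pi.hom_ext _ _ fun i => congrFun h i

theorem exists_coord_eq {Ω : GeomPt k} (x : I → (Ω.pt ⟶ X)) :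
    ∃ y : Ω.pt ⟶ power X I, coord y = x :=
  ⟨Pi.lift x, by funext i; simp [coord]⟩

/-- The morphism of powers given by a map of index sets. -/
noncomputable def reindex (X : SchOver k) (e : J → I) : power X I ⟶ power X J :=
  Pi.lift fun j => Pi.π (fun _ : I => X) (e j)

theorem coord_comp_reindex {Ω : GeomPt k} (e : J → I) (x : Ω.pt ⟶ power X I) :
    coord (x ≫ reindex X e) = coord x ∘ e := by
  funext j
  simp [coord, reindex]

theorem coord_comp_permute {Ω : GeomPt k} (σ : Equiv.Perm I) (x : Ω.pt ⟶ power X I) :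
    coord (x ≫ permute X σ) = coord x ∘ σ := coord_comp_reindex σ x

theorem permute_one : permute X (1 : Equiv.Perm I) = 𝟙 _ := by
  refine Pi.hom_ext _ _ fun i => ?_
  simp [permute]

theorem permute_mul (σ τ : Equiv.Perm I) : permute X (σ * τ) = permute X σ ≫ permute X τ := by
  refine Pi.hom_ext _ _ fun i => ?_
  simp [permute]

/-- The equalizer of the underlying morphisms of schemes has the expected geometric points. -/
theorem mem_range_equalizer_iff {V : SchOver k} [LocallyOfFiniteType V.hom] (f g : V ⟶ X)
    {Ω : GeomPt k} (x : Ω.pt ⟶ V) :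
    GeomPt.im x ∈ Set.range (equalizer.ι f.left g.left) ↔ x ≫ f = x ≫ g := by
  let E : SchOver k := Over.mk (equalizer.ι f.left g.left ≫ V.hom)
  let j : E ⟶ V := Over.homMk (equalizer.ι f.left g.left) rfl
  have hj : j ≫ f = j ≫ g := by
    ext1
    exact equalizer.condition _ _
  have : LocallyOfFiniteType j.left :=
    inferInstanceAs (LocallyOfFiniteType (equalizer.ι f.left g.left))
  change GeomPt.im x ∈ Set.range j.left ↔ _
  rw [mem_range_iff_exists_geomPt]
  constructor
  · rintro ⟨s, rfl⟩
    rw [Category.assoc, hj, Category.assoc]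
  · intro h
    have h' : x.left ≫ f.left = x.left ≫ g.left := congrArg (·.left) h
    refine ⟨Over.homMk (equalizer.lift x.left h') ?_, ?_⟩
    · change equalizer.lift x.left h' ≫ equalizer.ι f.left g.left ≫ V.hom = _
      rw [equalizer.lift_ι_assoc, Over.w]
    · ext1
      exact equalizer.lift_ι _ _

end powers

section separated

variable (X : FTScheme k) (hX : IsSeparated X.obj.hom) {I : Type} [Finite I]
include hX

theorem mem_offDiagonal_iff {Ω : GeomPt k} (x : Ω.pt ⟶ power X.obj I) :
    GeomPt.im x ∈ offDiagonal X.obj I ↔ Function.Injective (coord x) := by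
  have := (X.finiteType_power hX I).1
  simp only [offDiagonal, Set.mem_compl_iff, Set.mem_iUnion, mem_range_equalizer_iff, not_exists]
  constructor
  · intro h i j hij
    by_contra hne
    exact h i j hne hij
  · intro h i j hne hij
    exact hne (h hij)

theorem isOpen_offDiagonal : IsOpen (offDiagonal X.obj I) := by
  have := (X.finiteType_power hX I).1
  rw [offDiagonal, isOpen_compl_iff]
  refine isClosed_iUnion_of_finite fun i => isClosed_iUnion_of_finite fun j =>
    isClosed_iUnion_of_finite fun _ => ?_
  -- the equalizer of schemes has the same image as the equalizer over `k`, which is closed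
  have e : Set.range (equalizer.ι (Pi.π (fun _ : I => X.obj) i).left
      (Pi.π (fun _ : I => X.obj) j).left) =
      Set.range (equalizer.ι (Pi.π (fun _ : I => X.obj) i) (Pi.π (fun _ : I => X.obj) j)).left := by
    ext y
    obtain ⟨Ω, x, rfl⟩ := exists_geomPt _ y
    rw [mem_range_equalizer_iff, mem_range_iff_exists_geomPt]
    constructor
    · intro h
      exact ⟨equalizer.lift x h, equalizer.lift_ι _ _⟩
    · rintro ⟨s, rfl⟩
      rw [Category.assoc, equalizer.condition, Category.assoc]
  rw [e]
  exact (Scheme.Hom.isClosedEmbedding (equalizer.ι (Pi.π (fun _ : I => X.obj) i)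
    (Pi.π (fun _ : I => X.obj) j)).left).isClosed_range

theorem isQuotientClass_quotientClass {H : Type} [Group H] [Finite H] (θ : H →* Equiv.Perm I)
    (W : Set (power X.obj I).left) (hW : IsLocallyClosed W)
    (hinv : ∀ h, Set.MapsTo (permute X.obj (θ h)).left W W) :
    IsQuotientClass (power X.obj I) (fun h => permute X.obj (θ h)) W
      (quotientClass (power X.obj I) (fun h => permute X.obj (θ h)) W) := by
  obtain ⟨h1, h2, h3⟩ := X.finiteType_power hX I
  have h : ∃ m, IsQuotientClass (power X.obj I) (fun h => permute X.obj (θ h)) W m := by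
    refine exists_isQuotientClass ⟨power X.obj I⟩ h3 (ρ := fun h => permute X.obj (θ h)) ?_ ?_ W hW
      hinv
    · rw [map_one, permute_one]
    · intro h h'
      rw [map_mul, permute_mul]
  rw [quotientClass, dif_pos h]
  exact h.choose_spec

/-- The group of permutations of the elements of a multiset that preserve the labels. -/
def labelPerm (μ : Multiset ℕ) : Subgroup (Equiv.Perm μ.ToType) where
  carrier := {σ | ∀ p, (σ p).1 = p.1}
  mul_mem' := fun {σ τ} hσ hτ p => (hσ (τ p)).trans (hτ p)
  one_mem' := fun _ => rfl
  inv_mem' := fun {σ} hσ p => by simpa using (hσ (σ⁻¹ p)).symm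

theorem hasClass_symClass (n : ℕ) :
    HasClass (power X.obj (Fin n)) (fun _ => Set.univ)
      (fun _ x => Set.range fun σ : Equiv.Perm (Fin n) => x ≫ permute X.obj σ)
      (symClass X.obj n) := by
  have := (isQuotientClass_quotientClass X hX (MonoidHom.id (Equiv.Perm (Fin n))) Set.univ
    isClosed_univ.isLocallyClosed (fun _ _ _ => trivial)).hasClass permute_one permute_mul
  exact this.congr (fun Ω => by ext; simp) fun _ _ _ _ _ => Iff.rfl

theorem hasClass_wClass (μ : Multiset ℕ) :
    HasClass (power X.obj μ.ToType) (fun _ => {x | Function.Injective (coord x)})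
      (fun _ x => Set.range fun σ : labelPerm μ => x ≫ permute X.obj σ.1)
      (wClass X.obj μ) := by
  have := (isQuotientClass_quotientClass X hX (labelPerm μ).subtype (offDiagonal X.obj μ.ToType)
    (isOpen_offDiagonal X hX).isLocallyClosed (fun σ y hy => by
      obtain ⟨Ω, x, rfl⟩ := exists_geomPt _ y
      rw [← GeomPt.im_comp, mem_offDiagonal_iff X hX, coord_comp_permute]
      rw [mem_offDiagonal_iff X hX] at hy
      exact hy.comp (Equiv.injective _))).hasClass permute_one
        (fun σ τ => permute_mul σ.1 τ.1)
  exact this.congr (fun Ω => by ext x; simp only [Set.mem_ofPred_eq, mem_offDiagonal_iff X hX])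
    fun _ _ _ _ _ => Iff.rfl

end separated

end

section

variable {k : Type u} [Field k]

/-! ### Effective zero-cycles -/

section cycles

variable {P : Type u} {I J : Type*} [Fintype I] [Fintype J]

/-- The effective zero-cycle `∑ ℓ i • [x i]`. -/
noncomputable def cycle (ℓ : I → ℕ) (x : I → P) : P →₀ ℕ := ∑ i, Finsupp.single (x i) (ℓ i)

/-- The type of a zero-cycle: the multiset of its multiplicities. -/
noncomputable def cycleType (c : P →₀ ℕ) : Multiset ℕ := c.support.val.map c

theorem degree_cycle (ℓ : I → ℕ) (x : I → P) : (cycle ℓ x).degree = ∑ i, ℓ i := by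
  rw [cycle, map_sum]
  simp

theorem sum_cycleType (c : P →₀ ℕ) : (cycleType c).sum = c.degree := rfl

theorem exists_equiv_of_map_eq {Q : Type*} (x : I → Q) (y : J → Q)
    (h : (Finset.univ : Finset I).val.map x = (Finset.univ : Finset J).val.map y) :
    ∃ e : I ≃ J, ∀ i, y (e i) = x i := by
  classical
  have hc : ∀ q, Nonempty ({i // x i = q} ≃ {j // y j = q}) := by
    intro q
    have := congrArg (Multiset.count q) h
    rw [Multiset.count_map, Multiset.count_map] at this
    refine ⟨Fintype.equivOfCardEq ?_⟩
    rw [Fintype.card_subtype, Fintype.card_subtype]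
    simp_rw [eq_comm (a := q)] at this
    exact this
  exact ⟨Equiv.ofFiberEquiv fun q => (hc q).some, fun i => Equiv.ofFiberEquiv_map _ _⟩

theorem toMultiset_cycle_one (x : I → P) :
    Finsupp.toMultiset (cycle 1 x) = (Finset.univ : Finset I).val.map x := by
  rw [cycle, map_sum]
  simp only [Pi.one_apply, Finsupp.toMultiset_single, one_smul]
  rw [← Multiset.sum_map_singleton (Multiset.map x _), Multiset.map_map]
  rfl

theorem cycle_one_eq_iff (x y : I → P) : cycle 1 x = cycle 1 y ↔ ∃ σ : Equiv.Perm I, x ∘ σ = y := by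
  constructor
  · intro h
    have := congrArg Finsupp.toMultiset h
    rw [toMultiset_cycle_one, toMultiset_cycle_one] at this
    obtain ⟨e, he⟩ := exists_equiv_of_map_eq y x this.symm
    exact ⟨e, funext he⟩
  · rintro ⟨σ, rfl⟩
    exact (Equiv.sum_comp σ fun i => Finsupp.single (x i) 1).symm

theorem cycle_apply_of_injective (ℓ : I → ℕ) {x : I → P} (hx : Function.Injective x) (i : I) :
    cycle ℓ x (x i) = ℓ i := by
  classical
  rw [cycle, Finsupp.finsetSum_apply, Finset.sum_eq_single i]
  · simp
  · intro j _ hj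
    rw [Finsupp.single_apply, if_neg fun h => hj (hx h)]
  · simp

theorem support_cycle_of_injective {ℓ : I → ℕ} (hℓ : ∀ i, ℓ i ≠ 0) {x : I → P}
    (hx : Function.Injective x) : (cycle ℓ x).support = Finset.univ.map ⟨x, hx⟩ := by
  classical
  ext p
  rw [Finsupp.mem_support_iff, Finset.mem_map]
  constructor
  · intro h
    rw [cycle, Finsupp.finsetSum_apply] at h
    obtain ⟨i, -, hi⟩ := Finset.exists_ne_zero_of_sum_ne_zero h
    refine ⟨i, Finset.mem_univ i, ?_⟩
    by_contra hne
    exact hi (Finsupp.single_eq_of_ne fun h => hne h.symm)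
  · rintro ⟨i, -, rfl⟩
    change cycle ℓ x (x i) ≠ 0
    rw [cycle_apply_of_injective ℓ hx]
    exact hℓ i

theorem cycleType_cycle {ℓ : I → ℕ} (hℓ : ∀ i, ℓ i ≠ 0) {x : I → P}
    (hx : Function.Injective x) : cycleType (cycle ℓ x) = (Finset.univ : Finset I).val.map ℓ := by
  rw [cycleType, support_cycle_of_injective hℓ hx, Finset.map_val, Multiset.map_map]
  exact Multiset.map_congr rfl fun i _ => cycle_apply_of_injective ℓ hx i

theorem cycle_eq_iff_of_injective {ℓ : I → ℕ} (hℓ : ∀ i, ℓ i ≠ 0) {x y : I → P}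
    (hx : Function.Injective x) (hy : Function.Injective y) :
    cycle ℓ x = cycle ℓ y ↔ ∃ σ : Equiv.Perm I, (∀ i, ℓ (σ i) = ℓ i) ∧ x ∘ σ = y := by
  constructor
  · intro h
    have hs := congrArg Finsupp.support h
    rw [support_cycle_of_injective hℓ hx, support_cycle_of_injective hℓ hy] at hs
    obtain ⟨σ, hσ⟩ := exists_equiv_of_map_eq y x (congrArg Finset.val hs.symm)
    refine ⟨σ, fun i => ?_, funext hσ⟩
    rw [← cycle_apply_of_injective ℓ hx, hσ, h, cycle_apply_of_injective ℓ hy]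
  · rintro ⟨σ, hℓσ, rfl⟩
    rw [cycle, cycle, ← Equiv.sum_comp σ]
    simp [hℓσ]

theorem exists_cycle_eq (μ : Multiset ℕ) (c : P →₀ ℕ) (hc : cycleType c = μ) :
    ∃ x : μ.ToType → P, Function.Injective x ∧ cycle (fun p => p.1) x = c := by
  obtain ⟨e, he⟩ := exists_equiv_of_map_eq (fun p : μ.ToType => p.1) (fun p : c.support => c p.1)
    (by
      rw [Multiset.map_univ_coe, ← hc, cycleType]
      exact (Multiset.attach_map_val' _ _).symm)
  refine ⟨fun p => (e p).1, Subtype.val_injective.comp e.injective, ?_⟩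
  rw [cycle]
  simp_rw [← he]
  rw [Equiv.sum_comp e fun p => Finsupp.single p.1 (c p.1)]
  conv_rhs => rw [← Finsupp.sum_single c]
  exact Finset.sum_coe_sort c.support fun p => Finsupp.single p (c p)

theorem exists_cycle_one_eq (n : ℕ) (c : P →₀ ℕ) (hc : c.degree = n) :
    ∃ x : Fin n → P, cycle 1 x = c := by
  induction n generalizing c with
  | zero =>
    refine ⟨Fin.elim0, ?_⟩
    rw [(Finsupp.degree_eq_zero_iff c).mp hc]
    rfl
  | succ n ih =>
    have : c ≠ 0 := by
      rintro rfl
      simp at hc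
    obtain ⟨p, hp⟩ := Finsupp.ne_iff.mp this
    have hle : Finsupp.single p 1 ≤ c := by
      rw [Finsupp.single_le_iff]
      exact Nat.one_le_iff_ne_zero.mpr hp
    obtain ⟨d, rfl⟩ := exists_add_of_le hle
    obtain ⟨x, rfl⟩ := ih d (by
      rw [map_add, Finsupp.degree_single] at hc
      omega)
    refine ⟨Fin.cons p x, ?_⟩
    rw [cycle, Fin.sum_univ_succ]
    rfl

/-- Composition with a map of index sets whose fibres have `ℓ i` elements turns the sum of the
points `y i` into the cycle with multiplicities `ℓ i`. -/
theorem exists_index (ℓ : I → ℕ) (n : ℕ) (hn : ∑ i, ℓ i = n) :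
    ∃ e : Fin n → I, ∀ (P : Type u) (y : I → P), cycle 1 (y ∘ e) = cycle ℓ y := by
  have : Fintype.card (Σ i, Fin (ℓ i)) = n := by simpa using hn
  let f := (Fintype.equivFinOfCardEq this).symm
  refine ⟨fun j => (f j).1, fun P y => ?_⟩
  change ∑ j, Finsupp.single (y (f j).1) 1 = _
  rw [Equiv.sum_comp f fun s => Finsupp.single (y s.1) 1, Fintype.sum_sigma, cycle]
  refine Finset.sum_congr rfl fun i _ => ?_
  simp

end cycles

section classes

variable (X : FTScheme k) (hX : IsSeparated X.obj.hom)
include hX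

/-- `[w_μ]` is the class of the zero-cycles of type `μ`: the map that repeats each of the distinct
points as often as its label says identifies the configurations with these cycles. -/
theorem hasClass_type {n : ℕ} (μ : n.Partition) :
    HasClass (power X.obj (Fin n)) (fun _ => {x | cycleType (cycle 1 (coord x)) = μ.parts})
      (fun _ x => cycle 1 (coord x)) (wClass X.obj μ.parts) := by
  have hn : ∑ p : μ.parts.ToType, p.1 = n :=
    (congrArg Multiset.sum (Multiset.map_univ_coe μ.parts)).trans μ.parts_sum
  have hpos : ∀ p : μ.parts.ToType, p.1 ≠ 0 := fun p => (μ.parts_pos (Multiset.coe_mem)).ne'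
  obtain ⟨e, he⟩ := exists_index.{u} (fun p : μ.parts.ToType => p.1) n hn
  refine (hasClass_wClass X hX μ.parts).map (reindex X.obj e) ?_ ?_ ?_
  · intro Ω x hx
    rw [Set.mem_ofPred_eq, coord_comp_reindex, he, cycleType_cycle hpos hx]
    exact Multiset.map_univ_coe _
  · intro Ω y hy
    obtain ⟨x, hx, hxy⟩ := exists_cycle_eq _ _ hy
    obtain ⟨x, rfl⟩ := exists_coord_eq x
    exact ⟨x, hx, by rw [coord_comp_reindex, he, hxy]⟩
  · intro Ω x hx x' hx'
    rw [coord_comp_reindex, coord_comp_reindex, he, he, cycle_eq_iff_of_injective hpos hx hx']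
    have key : (∃ σ : labelPerm μ.parts, x ≫ permute X.obj σ.1 = x') ↔
        ∃ σ : Equiv.Perm μ.parts.ToType, (∀ i, (σ i).1 = i.1) ∧ coord x ∘ σ = coord x' := by
      constructor
      · rintro ⟨σ, rfl⟩
        exact ⟨σ.1, σ.2, (coord_comp_permute _ _).symm⟩
      · rintro ⟨σ, hσ, h⟩
        exact ⟨⟨σ, hσ⟩, coord_injective (by rw [coord_comp_permute, h])⟩
    rw [← key]
    constructor
    · intro h
      have h1 : x' ∈ Set.range fun σ : labelPerm μ.parts => x' ≫ permute X.obj σ.1 :=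
        ⟨1, by simp [permute_one]⟩
      rwa [← h] at h1
    · rintro ⟨σ, rfl⟩
      ext z
      constructor
      · rintro ⟨τ, rfl⟩
        refine ⟨σ⁻¹ * τ, ?_⟩
        dsimp only
        rw [Category.assoc, ← permute_mul]
        simp
      · rintro ⟨τ, rfl⟩
        refine ⟨σ * τ, ?_⟩
        dsimp only
        rw [Category.assoc, ← permute_mul]
        simp

open Classical in
/-- The sum of the classes `[w_μ]` over the partitions `μ` of `n` with a given property. -/
noncomputable def wSum {k : Type u} [Field k] (X : SchOver k) (n : ℕ) (p : Multiset ℕ → Prop) :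
    GrothendieckRing k :=
  ∑ μ : n.Partition with p μ.parts, wClass X μ.parts

theorem hasClass_wSum (n : ℕ) (p : Multiset ℕ → Prop) :
    HasClass (power X.obj (Fin n)) (fun _ => {x | p (cycleType (cycle 1 (coord x)))})
      (fun _ x => cycle 1 (coord x)) (wSum X.obj n p) := by
  classical
  have := HasClass.sum (V := power X.obj (Fin n)) (f := fun _ x => cycle 1 (coord x))
    (D := fun μ _ => {x | cycleType (cycle 1 (coord x)) = μ.parts})
    (m := fun μ => wClass X.obj μ.parts) (Finset.univ.filter fun μ : n.Partition => p μ.parts)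
    (fun μ _ => hasClass_type X hX μ) (by
      rintro μ - ν - hne Ω x hx y hy he
      rw [Set.mem_ofPred_eq] at hx hy
      rw [he, hy] at hx
      exact hne (Nat.Partition.ext hx.symm))
  rw [wSum]
  refine this.congr (fun Ω => ?_) fun _ _ _ _ _ => Iff.rfl
  ext x
  simp only [Set.mem_ofPred_eq, Finset.mem_filter, Finset.mem_univ, true_and]
  constructor
  · rintro ⟨μ, hp, h⟩
    rwa [h]
  · intro h
    refine ⟨⟨cycleType (cycle 1 (coord x)), fun {i} hi => ?_, ?_⟩, h, rfl⟩
    · obtain ⟨q, hq, rfl⟩ := Multiset.mem_map.mp hi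
      exact Nat.pos_of_ne_zero (Finsupp.mem_support_iff.mp hq)
    · rw [sum_cycleType, degree_cycle]
      simp

/-- `[Symⁿ X]` is the class of the effective zero-cycles of degree `n`. -/
theorem hasClass_sym (n : ℕ) :
    HasClass (power X.obj (Fin n)) (fun _ => Set.univ)
      (fun _ x => cycle 1 (coord x)) (symClass X.obj n) := by
  refine (hasClass_symClass X hX n).congr (fun _ => rfl) fun Ω x _ x' _ => ?_
  rw [cycle_one_eq_iff]
  constructor
  · intro h
    have h1 : x' ∈ Set.range fun σ : Equiv.Perm (Fin n) => x' ≫ permute X.obj σ :=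
      ⟨1, by simp [permute_one]⟩
    rw [← h] at h1
    obtain ⟨σ, rfl⟩ := h1
    exact ⟨σ, (coord_comp_permute _ _).symm⟩
  · rintro ⟨σ, h⟩
    have h2 : x ≫ permute X.obj σ = x' := coord_injective (by rw [coord_comp_permute, h])
    subst h2
    ext z
    constructor
    · rintro ⟨τ, rfl⟩
      refine ⟨σ⁻¹ * τ, ?_⟩
      dsimp only
      rw [Category.assoc, ← permute_mul]
      simp
    · rintro ⟨τ, rfl⟩
      refine ⟨σ * τ, ?_⟩
      dsimp only
      rw [Category.assoc, ← permute_mul]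

omit hX in
/-- Uniqueness of the class of a family of cycles of degree `n`. -/
theorem hasClass_cycle_unique {n : ℕ} {p : ∀ Ω : GeomPt k, ((Ω.pt ⟶ X.obj) →₀ ℕ) → Prop}
    {m m' : GrothendieckRing k}
    (h : HasClass (power X.obj (Fin n)) (fun Ω => {x | p Ω (cycle 1 (coord x))})
      (fun _ x => cycle 1 (coord x)) m)
    (h' : HasClass (power X.obj (Fin n)) (fun Ω => {x | p Ω (cycle 1 (coord x))})
      (fun _ x => cycle 1 (coord x)) m') : m = m' := by
  refine h.unique h' (fun σ : Equiv.Perm (Fin n) => permute X.obj σ) ?_ ?_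
  · intro Ω x _ y _ hxy
    obtain ⟨σ, hσ⟩ := (cycle_one_eq_iff _ _).mp hxy
    exact ⟨σ, coord_injective (by rw [coord_comp_permute, hσ])⟩
  · intro Ω x _ σ
    rw [coord_comp_permute]
    exact ((cycle_one_eq_iff _ _).mpr ⟨σ, rfl⟩).symm

theorem symClass_eq_wSum (n : ℕ) : symClass X.obj n = wSum X.obj n fun _ => True :=
  hasClass_cycle_unique X (p := fun _ _ => True) (hasClass_sym X hX n)
    (hasClass_wSum X hX n fun _ => True)

end classes

end

section

variable {k : Type u} [Field k]

/-! ### Division of cycles with remainder -/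

section division

variable {P : Type u}

theorem sum_map_div_cycleType (c : P →₀ ℕ) (b : ℕ) :
    ((cycleType c).map (· / b)).sum = (c.mapRange (· / b) (Nat.zero_div b)).degree := by
  rw [cycleType, Multiset.map_map]
  exact (Finsupp.sum_mapRange_index (f := (· / b)) (hf := Nat.zero_div b) (g := c)
    (h := fun (_ : P) (n : ℕ) => n) fun _ => rfl).symm

theorem forall_mem_cycleType {a : ℕ} {f : ℕ → ℕ} (c : P →₀ ℕ) (h0 : f 0 < a) :
    (∀ i ∈ cycleType c, f i < a) ↔ ∀ p, f (c p) < a := by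
  constructor
  · intro h p
    by_cases hp : c p = 0
    · rwa [hp]
    · exact h _ (Multiset.mem_map_of_mem _ (Finsupp.mem_support_iff.mpr hp))
  · intro h i hi
    obtain ⟨p, -, rfl⟩ := Multiset.mem_map.mp hi
    exact h p

theorem smul_add_injective {a b : ℕ} (hab : a ≤ b) {c c' d d' : P →₀ ℕ} (hd : ∀ p, d p < a)
    (hd' : ∀ p, d' p < a) (h : b • c + d = b • c' + d') : c = c' ∧ d = d' := by
  have key : ∀ p, c p = c' p ∧ d p = d' p := by
    intro p
    have hp : b * c p + d p = b * c' p + d' p := DFunLike.congr_fun h p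
    have h1 := (hd p).trans_le hab
    have h2 := (hd' p).trans_le hab
    have e1 := congrArg (· / b) hp
    have e2 := congrArg (· % b) hp
    simp only [Nat.mul_add_mod, Nat.mod_eq_of_lt h1, Nat.mod_eq_of_lt h2] at e2
    simp only [Nat.mul_add_div (Nat.zero_lt_of_lt h1), Nat.div_eq_of_lt h1, Nat.div_eq_of_lt h2,
      add_zero] at e1
    exact ⟨e1, e2⟩
  exact ⟨Finsupp.ext fun p => (key p).1, Finsupp.ext fun p => (key p).2⟩

end division

variable (X : FTScheme k) (hX : IsSeparated X.obj.hom)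
include hX

/-- Division with remainder by `b`: a cycle whose multiplicities have remainders less than `a ≤ b`
is uniquely of the form `b E + D` with all multiplicities of `D` less than `a`. -/
theorem symClass_mul_wSum {a b : ℕ} (ha : 0 < a) (hab : a ≤ b) (r m : ℕ) :
    symClass X.obj r * wSum X.obj m (fun μ => ∀ i ∈ μ, i < a) =
      wSum X.obj (m + r * b) fun μ => (μ.map (· / b)).sum = r ∧ ∀ i ∈ μ, i % b < a := by
  have hb : 0 < b := ha.trans_le hab
  let Pt : GeomPt k → Type u := fun Ω => (Ω.pt ⟶ X.obj)
  obtain ⟨e, he⟩ := exists_index.{u} (Sum.elim (fun _ : Fin r => b) (fun _ : Fin m => 1))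
    (m + r * b) (by simp [add_comm])
  let φ : power X.obj (Fin r) ⨯ power X.obj (Fin m) ⟶ power X.obj (Fin r ⊕ Fin m) :=
    Pi.lift (Sum.elim (fun i => Limits.prod.fst ≫ Pi.π (fun _ => X.obj) i)
      (fun j => Limits.prod.snd ≫ Pi.π (fun _ => X.obj) j))
  have hφ : ∀ (Ω : GeomPt k) (x : Ω.pt ⟶ power X.obj (Fin r) ⨯ power X.obj (Fin m)),
      cycle 1 (coord (x ≫ φ ≫ reindex X.obj e)) =
        b • cycle 1 (coord (x ≫ Limits.prod.fst)) + cycle 1 (coord (x ≫ Limits.prod.snd)) := by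
    intro Ω x
    rw [← Category.assoc, coord_comp_reindex, he, cycle, Fintype.sum_sum_type, cycle, cycle,
      Finset.smul_sum]
    congr 1
    · refine Finset.sum_congr rfl fun i _ => ?_
      simp [coord, φ]
    · refine Finset.sum_congr rfl fun i _ => ?_
      simp [coord, φ]
  refine hasClass_cycle_unique X
    (p := fun Ω c => ((cycleType c).map (· / b)).sum = r ∧ ∀ i ∈ cycleType c, i % b < a)
    ?_ (hasClass_wSum X hX _ _)
  have h0 : 0 % b < a := by simpa using ha
  have hlt : ∀ {Ω : GeomPt k} (c : Pt Ω →₀ ℕ), (∀ i ∈ cycleType c, i < a) ↔ ∀ p, c p < a :=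
    fun c => forall_mem_cycleType (f := id) c ha
  refine ((hasClass_sym X hX r).prod (hasClass_wSum X hX m _)).map (φ ≫ reindex X.obj e) ?_ ?_ ?_
  · rintro Ω x ⟨-, hx⟩
    rw [Set.mem_ofPred_eq, hlt] at hx
    rw [Set.mem_ofPred_eq, hφ, sum_map_div_cycleType, forall_mem_cycleType (f := (· % b)) _ h0]
    have e1 : (b • cycle 1 (coord (x ≫ Limits.prod.fst)) +
        cycle 1 (coord (x ≫ Limits.prod.snd))).mapRange (· / b) (Nat.zero_div b) =
        cycle 1 (coord (x ≫ Limits.prod.fst)) := by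
      ext p
      simp [Nat.mul_add_div hb, Nat.div_eq_of_lt ((hx p).trans_le hab)]
    refine ⟨?_, fun p => ?_⟩
    · rw [e1, degree_cycle]
      simp
    · simpa [Nat.mul_add_mod, Nat.mod_eq_of_lt ((hx p).trans_le hab)] using hx p
  · rintro Ω y ⟨hy, hy'⟩
    rw [forall_mem_cycleType (f := (· % b)) _ h0] at hy'
    rw [sum_map_div_cycleType] at hy
    set c := cycle 1 (coord y) with hc
    have hcdeg : c.degree = m + r * b := by
      rw [hc, degree_cycle]
      simp
    have hdec : b • c.mapRange (· / b) (Nat.zero_div b) +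
        c.mapRange (· % b) (Nat.zero_mod b) = c := by
      ext p
      simp [Nat.div_add_mod]
    obtain ⟨x₁, hx₁⟩ := exists_cycle_one_eq r _ hy
    obtain ⟨x₂, hx₂⟩ := exists_cycle_one_eq m (c.mapRange (· % b) (Nat.zero_mod b)) (by
      have := congrArg Finsupp.degree hdec
      rw [map_add, map_nsmul, hy, hcdeg, smul_eq_mul] at this
      linarith [mul_comm b r])
    obtain ⟨x₁, rfl⟩ := exists_coord_eq x₁
    obtain ⟨x₂, rfl⟩ := exists_coord_eq x₂
    refine ⟨Limits.prod.lift x₁ x₂, ⟨trivial, ?_⟩, ?_⟩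
    · rw [Set.mem_ofPred_eq, hlt, Limits.prod.lift_snd, hx₂]
      exact hy'
    · rw [hφ, Limits.prod.lift_fst, Limits.prod.lift_snd, hx₁, hx₂, hdec]
  · rintro Ω x ⟨-, hx⟩ x' ⟨-, hx'⟩
    rw [Set.mem_ofPred_eq, hlt] at hx hx'
    rw [hφ, hφ, Prod.mk.injEq]
    constructor
    · rintro ⟨h1, h2⟩
      rw [h1, h2]
    · exact smul_add_injective hab hx hx'

theorem symClass_zero : symClass X.obj 0 = 1 := by
  refine hasClass_cycle_unique X (p := fun _ _ => True) (hasClass_sym X hX 0) ?_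
  refine ⟨FTScheme.point k, FTScheme.point k, Pi.lift fun i => i.elim0, 𝟙 _,
    (cls_one _ (inferInstanceAs (IsIso (𝟙 (Spec (CommRingCat.of k)))))).symm, fun Ω =>
      ⟨fun _ => trivial, fun x _ => ⟨Over.homMk Ω.str (Category.comp_id _), ?_⟩,
        fun q => ⟨q, Category.comp_id q⟩, fun s s' => ?_⟩⟩
  · dsimp only
    exact congrArg (cycle 1) (funext fun i => i.elim0)
  · have : s = s' := by
      ext1
      exact (Over.w s).trans (Over.w s').symm
    simp [this]

end

section

/-! ### The refinement ordering -/

section refinement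

open Multiset

theorem ElementaryMerge.add_right {l l' : Multiset ℕ} (h : ElementaryMerge l l')
    (m : Multiset ℕ) : ElementaryMerge (l + m) (l' + m) := by
  obtain ⟨x, y, s, rfl, rfl⟩ := h
  exact ⟨x, y, s + m, by simp, by simp⟩

theorem Refines.trans {l m n : Multiset ℕ} (h : Refines l m) (h' : Refines m n) : Refines l n :=
  Relation.ReflTransGen.trans h h'

theorem Refines.refl (l : Multiset ℕ) : Refines l l := Relation.ReflTransGen.refl

theorem Refines.add_right {l l' : Multiset ℕ} (h : Refines l l') (m : Multiset ℕ) :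
    Refines (l + m) (l' + m) := by
  induction h with
  | refl => exact Refines.refl _
  | tail _ h ih => exact Relation.ReflTransGen.tail ih (h.add_right m)

theorem Refines.add {l l' m m' : Multiset ℕ} (h : Refines l l') (h' : Refines m m') :
    Refines (l + m) (l' + m') := by
  refine (h.add_right m).trans ?_
  rw [add_comm l', add_comm l']
  exact h'.add_right l'

theorem refines_singleton_sum {l : Multiset ℕ} (hl : l ≠ 0) : Refines l {l.sum} := by
  induction l using Multiset.induction_on with
  | empty => exact absurd rfl hl
  | cons x l ih =>
    rcases eq_or_ne l 0 with rfl | h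
    · simpa using Refines.refl {x}
    · have h1 := (Refines.refl {x}).add (ih h)
      rw [singleton_add] at h1
      exact h1.tail ⟨x, l.sum, 0, rfl, by simp⟩

theorem refines_replicate_one_mul {b : ℕ} (hb : 0 < b) (c : ℕ) :
    Refines (replicate (c * b) 1) (replicate c b) := by
  induction c with
  | zero => simpa using Refines.refl 0
  | succ c ih =>
    rw [Nat.succ_mul, replicate_add, replicate_succ, ← singleton_add, add_comm ({b} : Multiset ℕ)]
    refine ih.add ?_
    have h1 := refines_singleton_sum (l := replicate b 1) fun h => by
      have := congrArg card h
      simp at this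
      omega
    simpa using h1

/-- Every part `i` of `μ` splits into `i / b` parts `b` and `i % b` parts `1`. -/
theorem refines_remainder_quotient (b : ℕ) (μ : Multiset ℕ) (hμ : ∀ i ∈ μ, 0 < i) :
    Refines (replicate (μ.map (· % b)).sum 1 + replicate (μ.map (· / b)).sum b) μ := by
  induction μ using Multiset.induction_on with
  | empty => simpa using Refines.refl 0
  | cons i μ ih =>
    have h1 := refines_singleton_sum (l := replicate (i % b) 1 + replicate (i / b) b) fun h => by
      have h2 := congrArg sum h
      simp only [sum_add, sum_replicate, smul_eq_mul, mul_one, sum_zero] at h2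
      have h3 := hμ i (mem_cons_self i μ)
      rw [mul_comm, Nat.mod_add_div] at h2
      omega
    have h2 : (replicate (i % b) 1 + replicate (i / b) b).sum = i := by
      simp only [sum_add, sum_replicate, smul_eq_mul, mul_one]
      rw [mul_comm, Nat.mod_add_div]
    rw [h2] at h1
    have h3 := h1.add (ih fun j hj => hμ j (mem_cons_of_mem hj))
    rw [singleton_add] at h3
    simp only [map_cons, sum_cons, replicate_add]
    convert h3 using 1
    abel

theorem sum_eq_sum_mod_add (b : ℕ) (μ : Multiset ℕ) :
    μ.sum = (μ.map (· % b)).sum + (μ.map (· / b)).sum * b := by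
  induction μ using Multiset.induction_on with
  | empty => simp
  | cons i μ ih =>
    simp only [map_cons, sum_cons, ih, add_mul]
    have := Nat.mod_add_div i b
    rw [mul_comm] at this
    omega

theorem ElementaryMerge.sum_div_le {b : ℕ} {l l' : Multiset ℕ}
    (h : ElementaryMerge l l') : (l.map (· / b)).sum ≤ (l'.map (· / b)).sum := by
  obtain ⟨x, y, s, rfl, rfl⟩ := h
  simp only [map_cons, sum_cons]
  have : x / b + y / b ≤ (x + y) / b := Nat.div_add_div_le_add_div
  omega

theorem Refines.sum_div_le {b : ℕ} {l l' : Multiset ℕ}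
    (h : Refines l l') : (l.map (· / b)).sum ≤ (l'.map (· / b)).sum := by
  induction h with
  | refl => exact le_rfl
  | tail _ h ih => exact ih.trans h.sum_div_le

/-- A partition is obtained by merging from `r` parts `b` and ones iff its parts contain `r`
disjoint blocks of size `b`. -/
theorem refines_one_replicate_iff {b r j : ℕ} (hb : 1 < b) {μ : Multiset ℕ} (hμ : ∀ i ∈ μ, 0 < i)
    (hs : μ.sum = j + r * b) :
    Refines (replicate j 1 + replicate r b) μ ↔ r ≤ (μ.map (· / b)).sum := by
  constructor
  · intro h
    refine le_trans (le_of_eq ?_) h.sum_div_le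
    simp [Nat.div_eq_of_lt hb, Nat.div_self (Nat.zero_lt_of_lt hb)]
  · intro h
    refine Refines.trans ?_ (refines_remainder_quotient b μ hμ)
    obtain ⟨c, hc⟩ := Nat.exists_eq_add_of_le h
    have h1 := sum_eq_sum_mod_add b μ
    rw [hc, hs, add_mul] at h1
    have hj : j = (μ.map (· % b)).sum + c * b := by omega
    rw [hc, hj, replicate_add, replicate_add, add_assoc, add_comm (replicate r b)]
    exact (Refines.refl _).add
      ((refines_replicate_one_mul (Nat.zero_lt_of_lt hb) c).add (Refines.refl _))

/-- The numerical condition for a refinement by one part `a`, and parts `b` and `1`, is stable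
under merging: either the remainders produce a carry, or a remainder that is at least `a` stays. -/
theorem ElementaryMerge.carry {a b r : ℕ} (hb : 0 < b) {l l' : Multiset ℕ}
    (h : ElementaryMerge l l')
    (hl : r + 1 ≤ (l.map (· / b)).sum ∨ r ≤ (l.map (· / b)).sum ∧ ∃ i ∈ l, a ≤ i % b) :
    r + 1 ≤ (l'.map (· / b)).sum ∨ r ≤ (l'.map (· / b)).sum ∧ ∃ i ∈ l', a ≤ i % b := by
  rcases hl with hl | ⟨hl, i, hi, hai⟩
  · exact Or.inl (hl.trans h.sum_div_le)
  · obtain ⟨x, y, s, rfl, rfl⟩ := h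
    simp only [map_cons, sum_cons] at hl ⊢
    have hxy := Nat.add_div (a := x) (b := y) hb
    by_cases hc : b ≤ x % b + y % b
    · left
      rw [if_pos hc] at hxy
      omega
    · right
      rw [if_neg hc] at hxy
      refine ⟨by omega, ?_⟩
      have hm : (x + y) % b = x % b + y % b := by
        rw [Nat.add_mod, Nat.mod_eq_of_lt (not_le.mp hc)]
      rw [mem_cons, mem_cons] at hi
      rcases hi with rfl | rfl | hi
      · exact ⟨i + y, mem_cons_self _ _, by omega⟩
      · exact ⟨x + i, mem_cons_self _ _, by omega⟩
      · exact ⟨i, mem_cons_of_mem hi, hai⟩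

/-- A partition is obtained by merging from one part `a`, `r` parts `b` and ones iff its parts
contain `r + 1` disjoint blocks of size `b`, or `r` such blocks and beside them a block of size
`a`. -/
theorem refines_one_cons_replicate_iff {a b r j : ℕ} (ha : 1 < a) (hab : a ≤ b) {μ : Multiset ℕ}
    (hμ : ∀ i ∈ μ, 0 < i) (hs : μ.sum = j + (a + r * b)) :
    Refines (replicate j 1 + (a ::ₘ replicate r b)) μ ↔
      r + 1 ≤ (μ.map (· / b)).sum ∨ r ≤ (μ.map (· / b)).sum ∧ ∃ i ∈ μ, a ≤ i % b := by
  have hb : 1 < b := ha.trans_le hab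
  have hb0 : 0 < b := Nat.zero_lt_of_lt hb
  constructor
  · intro h
    clear hμ hs
    induction h with
    | refl =>
      simp only [map_add, sum_add, map_cons, sum_cons, map_replicate, sum_replicate,
        Nat.div_eq_of_lt hb, Nat.div_self hb0]
      rcases hab.eq_or_lt with rfl | hlt
      · left
        rw [Nat.div_self hb0]
        simp [add_comm]
      · right
        refine ⟨by simp, a, by simp, ?_⟩
        rw [Nat.mod_eq_of_lt hlt]
    | tail _ h ih => exact h.carry hb0 ih
  · -- an extra part `b` splits as `a` and `b - a` ones
    have case1 : r + 1 ≤ (μ.map (· / b)).sum →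
        Refines (replicate j 1 + (a ::ₘ replicate r b)) μ := by
      intro h
      have hle : (r + 1) * b ≤ μ.sum := by
        rw [sum_eq_sum_mod_add b μ]
        exact (Nat.mul_le_mul_right b h).trans (Nat.le_add_left _ _)
      obtain ⟨j', hj'⟩ := Nat.exists_eq_add_of_le' hle
      refine Refines.trans ?_ ((refines_one_replicate_iff (j := j') hb hμ hj').mpr h)
      have hj : j = j' + (b - a) := by
        rw [hs, add_mul] at hj'
        omega
      have h1 := refines_singleton_sum (l := replicate (b - a) 1 + {a}) (by simp)
      have h2 : (replicate (b - a) 1 + {a}).sum = b := by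
        simp
        omega
      rw [h2] at h1
      rw [hj, replicate_add, replicate_succ, ← singleton_add, ← singleton_add, add_assoc,
        ← add_assoc (replicate (b - a) 1)]
      exact (Refines.refl _).add (h1.add (Refines.refl _))
    rintro (h | ⟨h, i, hi, hai⟩)
    · exact case1 h
    · by_cases h' : r + 1 ≤ (μ.map (· / b)).sum
      · exact case1 h'
      · have hr : (μ.map (· / b)).sum = r := by omega
        obtain ⟨μ', rfl⟩ := exists_cons_of_mem hi
        have h1 := refines_singleton_sum
          (l := replicate (i % b - a) 1 + {a} + replicate (i / b) b) (by simp)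
        have h2 : (replicate (i % b - a) 1 + {a} + replicate (i / b) b).sum = i := by
          simp only [sum_add, sum_replicate, smul_eq_mul, mul_one, sum_singleton]
          have := Nat.mod_add_div i b
          rw [mul_comm] at this
          omega
        rw [h2] at h1
        have h3 := h1.add (refines_remainder_quotient b μ' fun j hj => hμ j (mem_cons_of_mem hj))
        rw [singleton_add] at h3
        convert h3 using 1
        have h4 := sum_eq_sum_mod_add b (i ::ₘ μ')
        simp only [map_cons, sum_cons] at h4 hr hs
        have hj : j = (i % b - a) + (μ'.map (· % b)).sum := by
          rw [hr, hs] at h4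
          omega
        rw [hj, ← hr, replicate_add, replicate_add, ← singleton_add]
        abel

end refinement

end

section

variable {k : Type u} [Field k]

/-! ### Generating series -/

section wSum

variable (X : SchOver k)

theorem wSum_congr {n : ℕ} {p q : Multiset ℕ → Prop}
    (h : ∀ μ : n.Partition, p μ.parts ↔ q μ.parts) : wSum X n p = wSum X n q := by
  classical
  simp only [wSum]
  exact Finset.sum_congr (Finset.filter_congr fun μ _ => h μ) fun _ _ => rfl

theorem wSum_eq_zero {n : ℕ} {p : Multiset ℕ → Prop} (h : ∀ μ : n.Partition, ¬ p μ.parts) :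
    wSum X n p = 0 := by
  classical
  rw [wSum, Finset.filter_false_of_mem fun μ _ => h μ, Finset.sum_empty]

theorem wSum_eq_add {n : ℕ} {p q s : Multiset ℕ → Prop}
    (h : ∀ μ : n.Partition, p μ.parts ↔ q μ.parts ∨ s μ.parts)
    (h' : ∀ μ : n.Partition, q μ.parts → ¬ s μ.parts) :
    wSum X n p = wSum X n q + wSum X n s := by
  classical
  simp only [wSum]
  rw [← Finset.sum_union]
  · refine Finset.sum_congr ?_ fun _ _ => rfl
    ext μ
    simp [h μ]
  · rw [Finset.disjoint_filter]
    exact fun μ _ => h' μ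

theorem wSum_true_eq_sum (n a : ℕ) (ha : 0 < a) : (wSum X n fun _ => True) =
    ∑ r ∈ Finset.range (n + 1), wSum X n fun μ => (μ.map (· / a)).sum = r ∧ ∀ i ∈ μ, i % a < a := by
  classical
  simp only [wSum]
  rw [Finset.filter_true, ← Finset.sum_fiberwise_of_maps_to (s := Finset.univ)
    (t := Finset.range (n + 1)) (g := fun μ : n.Partition => (μ.parts.map (· / a)).sum)]
  · refine Finset.sum_congr rfl fun r _ => Finset.sum_congr ?_ fun _ _ => rfl
    ext μ
    simp [Nat.mod_lt _ ha]
  · intro μ _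
    rw [Finset.mem_range, Nat.lt_succ_iff]
    have h := sum_eq_sum_mod_add a μ.parts
    rw [μ.parts_sum] at h
    have := Nat.le_mul_of_pos_right (μ.parts.map (· / a)).sum ha
    omega

theorem wBar_ofMultiset (s : Multiset ℕ) (hs : ∀ i ∈ s, i ≠ 0) {n : ℕ} (hn : s.sum = n) :
    wBar X (Nat.Partition.ofMultiset s) = wSum X n (Refines s) := by
  subst hn
  have : (Nat.Partition.ofMultiset s).parts = s := Multiset.filter_eq_self.mpr hs
  rw [wBar, wSum, this]

theorem coeff_KBar_replicate {b r j : ℕ} (hb : 1 < b) :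
    PowerSeries.coeff j (KBar X (Multiset.replicate r b)) =
      wSum X (j + r * b) fun μ => r ≤ (μ.map (· / b)).sum := by
  rw [KBar, PowerSeries.coeff_mk, wBar_ofMultiset X _ _ (n := j + r * b)]
  · exact wSum_congr X fun μ =>
      refines_one_replicate_iff hb (fun i hi => μ.parts_pos hi) μ.parts_sum
  · simp
  · intro i hi
    rw [Multiset.mem_add] at hi
    rcases hi with hi | hi <;> have := Multiset.eq_of_mem_replicate hi <;> omega

theorem coeff_KBar_cons_replicate {a b r j : ℕ} (ha : 1 < a) (hab : a ≤ b) :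
    PowerSeries.coeff j (KBar X (a ::ₘ Multiset.replicate r b)) =
      wSum X (j + (a + r * b)) fun μ => r + 1 ≤ (μ.map (· / b)).sum ∨
        r ≤ (μ.map (· / b)).sum ∧ ∃ i ∈ μ, a ≤ i % b := by
  rw [KBar, PowerSeries.coeff_mk, wBar_ofMultiset X _ _ (n := j + (a + r * b))]
  · exact wSum_congr X fun μ =>
      refines_one_cons_replicate_iff ha hab (fun i hi => μ.parts_pos hi) μ.parts_sum
  · simp
    ring
  · intro i hi
    rw [Multiset.mem_add, Multiset.mem_cons] at hi
    rcases hi with hi | rfl | hi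
    · have := Multiset.eq_of_mem_replicate hi
      omega
    · omega
    · have := Multiset.eq_of_mem_replicate hi
      omega

/-- The generating series of the classes of configurations whose multiplicities have a given
property. -/
noncomputable def wSeries (p : Multiset ℕ → Prop) : (GrothendieckRing k)⟦X⟧ :=
  PowerSeries.mk fun n => wSum X n p

theorem mul_sum_div_le_sum (b : ℕ) {n : ℕ} (μ : n.Partition) :
    (μ.parts.map (· / b)).sum * b ≤ n := by
  have h := sum_eq_sum_mod_add b μ.parts
  rw [μ.parts_sum] at h
  omega

/-- Up to a shift, `K̄_{1^• b^r}` counts the configurations with `r` disjoint blocks of size `b`.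
The terms of degree less than `r * b` vanish on both sides. -/
theorem X_pow_mul_KBar_replicate {b r : ℕ} (hb : 1 < b) :
    PowerSeries.X ^ (r * b) * KBar X (Multiset.replicate r b) =
      wSeries X fun μ => r ≤ (μ.map (· / b)).sum := by
  ext n
  rw [PowerSeries.coeff_X_pow_mul', wSeries, PowerSeries.coeff_mk]
  split_ifs with h
  · rw [coeff_KBar_replicate X hb, Nat.sub_add_cancel h]
  · refine (wSum_eq_zero X fun μ hμ => h ?_).symm
    exact (Nat.mul_le_mul_right b hμ).trans (mul_sum_div_le_sum b μ)

/-- Up to a shift, `K̄_{1^• ab^r}` counts the configurations with `r` disjoint blocks of size `b`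
and a further block of size `a`. -/
theorem X_pow_mul_KBar_cons_replicate {a b r : ℕ} (ha : 1 < a) (hab : a ≤ b) :
    PowerSeries.X ^ (a + r * b) * KBar X (a ::ₘ Multiset.replicate r b) =
      wSeries X fun μ => r + 1 ≤ (μ.map (· / b)).sum ∨
        r ≤ (μ.map (· / b)).sum ∧ ∃ i ∈ μ, a ≤ i % b := by
  ext n
  rw [PowerSeries.coeff_X_pow_mul', wSeries, PowerSeries.coeff_mk]
  split_ifs with h
  · rw [coeff_KBar_cons_replicate X ha hab, Nat.sub_add_cancel h]
  · refine (wSum_eq_zero X fun μ hμ => h ?_).symm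
    rcases hμ with hμ | ⟨hμ, i, hi, hai⟩
    · have := (Nat.mul_le_mul_right b hμ).trans (mul_sum_div_le_sum b μ)
      rw [add_mul] at this
      omega
    · have h1 := Nat.mul_le_mul_right b hμ
      have h2 := sum_eq_sum_mod_add b μ.parts
      rw [μ.parts_sum] at h2
      have h3 := Multiset.le_sum_of_mem (Multiset.mem_map_of_mem (· % b) hi)
      omega

end wSum

section zeta

variable (X : FTScheme k) (hX : IsSeparated X.obj.hom)
include hX

theorem constantCoeff_zeta : PowerSeries.constantCoeff (zeta X.obj) = 1 := by
  rw [← PowerSeries.coeff_zero_eq_constantCoeff_apply, zeta, PowerSeries.coeff_mk,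
    symClass_zero X hX]

theorem C_symClass_mul_wSeries {a b : ℕ} (ha : 0 < a) (hab : a ≤ b) (r : ℕ) :
    PowerSeries.C (symClass X.obj r) * PowerSeries.X ^ (r * b) *
      wSeries X.obj (fun μ => ∀ i ∈ μ, i < a) =
      wSeries X.obj fun μ => (μ.map (· / b)).sum = r ∧ ∀ i ∈ μ, i % b < a := by
  ext n
  rw [mul_assoc, PowerSeries.coeff_C_mul, PowerSeries.coeff_X_pow_mul', wSeries, wSeries]
  split_ifs with h
  · rw [PowerSeries.coeff_mk, PowerSeries.coeff_mk, symClass_mul_wSum X hX ha hab,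
      Nat.sub_add_cancel h]
  · rw [mul_zero, PowerSeries.coeff_mk]
    refine (wSum_eq_zero X.obj fun μ hμ => h ?_).symm
    rw [← hμ.1]
    exact mul_sum_div_le_sum b μ

/-- The zeta function is the product of `Z(t ^ a)` and the series of the configurations with
multiplicities less than `a`. -/
theorem zeta_eq_mul {a : ℕ} (ha : 0 < a) :
    zeta X.obj = substPow (zeta X.obj) a * wSeries X.obj fun μ => ∀ i ∈ μ, i < a := by
  ext n
  have h1 : PowerSeries.coeff n ((∑ r ∈ Finset.range (n + 1),
      PowerSeries.C (symClass X.obj r) * PowerSeries.X ^ (r * a)) *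
      wSeries X.obj fun μ => ∀ i ∈ μ, i < a) = PowerSeries.coeff n (zeta X.obj) := by
    rw [Finset.sum_mul, map_sum, zeta, PowerSeries.coeff_mk, symClass_eq_wSum X hX,
      wSum_true_eq_sum X.obj n a ha]
    refine Finset.sum_congr rfl fun r _ => ?_
    rw [C_symClass_mul_wSeries X hX ha le_rfl, wSeries, PowerSeries.coeff_mk]
  rw [← h1, PowerSeries.coeff_mul, PowerSeries.coeff_mul]
  refine Finset.sum_congr rfl fun ij hij => ?_
  congr 1
  rw [substPow, PowerSeries.coeff_subst_X_pow ha.ne', map_sum]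
  simp only [PowerSeries.coeff_C_mul, PowerSeries.coeff_X_pow]
  have hle : ij.1 ≤ n := by
    have := Finset.HasAntidiagonal.mem_antidiagonal.mp hij
    omega
  split_ifs with h
  · obtain ⟨c, hc⟩ := h
    have hcn : c < n + 1 := by
      have := Nat.le_mul_of_pos_left c ha
      omega
    rw [hc, Nat.mul_div_cancel_left _ ha, Finset.sum_eq_single c]
    · simp [mul_comm, zeta]
    · intro r _ hr
      rw [if_neg, mul_zero]
      intro h
      exact hr (Nat.eq_of_mul_eq_mul_left ha (by rw [mul_comm a r, ← h]))
    · intro h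
      exact absurd (Finset.mem_range.mpr hcn) h
  · refine Finset.sum_eq_zero fun r _ => ?_
    rw [if_neg, mul_zero]
    rintro h'
    exact h ⟨r, by rw [h', mul_comm]⟩

/-- `Z(t) / Z(t ^ a)` is the series of the configurations with multiplicities less than `a`. -/
theorem zeta_mul_recip {a : ℕ} (ha : 0 < a) :
    zeta X.obj * recip (substPow (zeta X.obj) a) = wSeries X.obj fun μ => ∀ i ∈ μ, i < a := by
  have h : substPow (zeta X.obj) a * recip (substPow (zeta X.obj) a) = 1 := by
    refine PowerSeries.mul_invOfUnit _ 1 ?_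
    rw [substPow, PowerSeries.constantCoeff_subst_X_pow ha.ne', constantCoeff_zeta X hX]
    simp
  conv_lhs => rw [zeta_eq_mul X hX ha, mul_right_comm, ← zeta_eq_mul X hX ha]
  rw [h, one_mul]

omit hX in
/-- The configurations with `r` blocks of size `b` but no further block of size `a` are those with
exactly `r` blocks of size `b` and all remainders less than `a`. -/
theorem wSeries_le_eq_add {a b : ℕ} (r : ℕ) : (wSeries X.obj fun μ => r ≤ (μ.map (· / b)).sum) =
    (wSeries X.obj fun μ => r + 1 ≤ (μ.map (· / b)).sum ∨
        r ≤ (μ.map (· / b)).sum ∧ ∃ i ∈ μ, a ≤ i % b) +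
      wSeries X.obj fun μ => (μ.map (· / b)).sum = r ∧ ∀ i ∈ μ, i % b < a := by
  ext n
  simp only [wSeries, map_add, PowerSeries.coeff_mk]
  refine wSum_eq_add X.obj (fun μ => ?_) fun μ => ?_
  · by_cases h : ∃ i ∈ μ.parts, a ≤ i % b
    · have h' : ¬ ∀ i ∈ μ.parts, i % b < a := by push Not; exact h
      simp only [h, h', and_true, and_false, or_false]
      omega
    · have h' : ∀ i ∈ μ.parts, i % b < a := by push Not at h; exact h
      simp only [h, and_false, or_false]
      constructor
      · intro hr
        by_cases hr' : r + 1 ≤ (μ.parts.map (· / b)).sum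
        · exact Or.inl hr'
        · exact Or.inr ⟨by omega, h'⟩
      · rintro (hr | ⟨hr, -⟩) <;> omega
  · rintro (h | ⟨h, i, hi, hai⟩) ⟨h1, h2⟩
    · omega
    · exact absurd (h2 i hi) (not_lt.mpr hai)

theorem X_pow_mul_KBar_eq {a b : ℕ} (r : ℕ) (ha : 1 < a) (hab : a ≤ b) :
    PowerSeries.X ^ a * KBar X.obj (a ::ₘ Multiset.replicate r b) =
      KBar X.obj (Multiset.replicate r b) - zeta X.obj * recip (substPow (zeta X.obj) a) *
        PowerSeries.C (symClass X.obj r) := by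
  apply PowerSeries.X_pow_mul_cancel (k := r * b)
  rw [mul_sub, X_pow_mul_KBar_replicate X.obj (ha.trans_le hab), ← mul_assoc, ← pow_add,
    add_comm (r * b), X_pow_mul_KBar_cons_replicate X.obj ha hab, eq_sub_iff_add_eq,
    zeta_mul_recip X hX (Nat.zero_lt_of_lt ha), wSeries_le_eq_add X (a := a),
    ← C_symClass_mul_wSeries X hX (Nat.zero_lt_of_lt ha) hab]
  ring

theorem wSeries_le_eq_sub {b : ℕ} (hb : 0 < b) (r : ℕ) :
    (wSeries X.obj fun μ => r ≤ (μ.map (· / b)).sum) =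
      zeta X.obj - zeta X.obj * recip (substPow (zeta X.obj) b) *
        ∑ i ∈ Finset.range r, PowerSeries.C (symClass X.obj i) * PowerSeries.X ^ (b * i) := by
  induction r with
  | zero =>
    simp only [Nat.zero_le, Finset.range_zero, Finset.sum_empty, mul_zero, sub_zero]
    ext n
    simp only [wSeries, zeta, PowerSeries.coeff_mk, symClass_eq_wSum X hX]
  | succ r ih =>
    rw [Finset.sum_range_succ, mul_add, ← sub_sub, ← ih, wSeries_le_eq_add X (a := b) (r := r),
      eq_sub_iff_add_eq, zeta_mul_recip X hX hb, ← C_symClass_mul_wSeries X hX hb le_rfl]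
    have e : (wSeries X.obj fun μ => r + 1 ≤ (μ.map (· / b)).sum ∨
        r ≤ (μ.map (· / b)).sum ∧ ∃ i ∈ μ, b ≤ i % b) =
        wSeries X.obj fun μ => r + 1 ≤ (μ.map (· / b)).sum := by
      ext n
      rw [wSeries, wSeries, PowerSeries.coeff_mk, PowerSeries.coeff_mk]
      refine wSum_congr X.obj fun μ => ⟨?_, Or.inl⟩
      rintro (h | ⟨-, i, -, h⟩)
      · exact h
      · exact absurd (Nat.mod_lt i hb) (not_lt.mpr h)
    rw [e, mul_comm b r]
    ring

theorem X_pow_mul_KBar_eq' {a b : ℕ} (r : ℕ) (ha : 1 < a) (hab : a ≤ b) :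
    PowerSeries.X ^ (a + r * b) * KBar X.obj (a ::ₘ Multiset.replicate r b) =
      zeta X.obj - zeta X.obj * recip (substPow (zeta X.obj) b) *
        (∑ i ∈ Finset.range r, PowerSeries.C (symClass X.obj i) * PowerSeries.X ^ (b * i)) -
      zeta X.obj * recip (substPow (zeta X.obj) a) * PowerSeries.C (symClass X.obj r) *
        PowerSeries.X ^ (r * b) := by
  have hb := ha.trans_le hab
  rw [← wSeries_le_eq_sub X hX (Nat.zero_lt_of_lt hb), ← X_pow_mul_KBar_replicate X.obj hb,
    add_comm, pow_add, mul_assoc, X_pow_mul_KBar_eq X hX r ha hab]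
  ring

end zeta

/-! ### Laurent series -/

section laurent

variable {R : Type*} [CommRing R]

theorem coe_X_pow_mul_tPow (n : ℕ) (f : R⟦X⟧) :
    ((PowerSeries.X ^ n * f : R⟦X⟧) : R⸨X⸩) * tPow (-(n : ℤ)) = (f : R⸨X⸩) := by
  rw [map_mul, mul_right_comm, HahnSeries.ofPowerSeries_X_pow, tPow, HahnSeries.single_mul_single]
  simp

end laurent

end

section

/-! ### Multisets of vectors and tuples of polynomials -/

section interpolation

open Polynomial

variable {K J : Type*} [Field K]

/-- The polynomial of degree less than `N` with given coefficients. -/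
noncomputable def truncPoly {A : Type*} [CommRing A] (N : ℕ) (b : ℕ → A) : A[X] :=
  ∑ s ∈ Finset.range N, C (b s) * X ^ s

theorem coeff_truncPoly {A : Type*} [CommRing A] (N : ℕ) (b : ℕ → A) (s : ℕ) :
    (truncPoly N b).coeff s = if s < N then b s else 0 := by
  simp [truncPoly, finsetSum_coeff, coeff_C_mul, coeff_X_pow]

theorem truncPoly_mem_degreeLT {A : Type*} [CommRing A] (N : ℕ) (b : ℕ → A) :
    truncPoly N b ∈ degreeLT A N := by
  rw [mem_degreeLT, degree_lt_iff_coeff_zero]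
  intro s hs
  rw [coeff_truncPoly, if_neg (not_lt.mpr hs)]

theorem truncPoly_coeff {A : Type*} [CommRing A] {N : ℕ} {g : A[X]} (hg : g ∈ degreeLT A N) :
    truncPoly N g.coeff = g := by
  ext s
  rw [coeff_truncPoly]
  split_ifs with h
  · rfl
  · rw [mem_degreeLT, degree_lt_iff_coeff_zero] at hg
    exact (hg s (not_lt.mp h)).symm

theorem truncPoly_congr {A : Type*} [CommRing A] {N : ℕ} {b b' : ℕ → A} (h : ∀ s < N, b s = b' s) :
    truncPoly N b = truncPoly N b' :=
  Finset.sum_congr rfl fun s hs => by rw [h s (Finset.mem_range.mp hs)]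

theorem map_truncPoly {A A' : Type*} [CommRing A] [CommRing A'] (φ : A →+* A') (N : ℕ)
    (b : ℕ → A) : (truncPoly N b).map φ = truncPoly N fun s => φ (b s) := by
  simp [truncPoly, Polynomial.map_sum]

open Classical in
/-- A polynomial of degree less than `#B` is determined by its Taylor expansions at the values of
`f` on `B`, to the orders given by the multiplicities of the values. -/
theorem eq_zero_of_taylor_coeff_eq_zero (B : Finset J) (f : J → K) {g : K[X]}
    (hg : g ∈ degreeLT K B.card)
    (h : ∀ j ∈ B, ∀ s < (B.filter fun i => f i = f j).card, (taylor (f j) g).coeff s = 0) :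
    g = 0 := by
  have hprod : ∏ j ∈ B, (X - C (f j)) =
      ∏ a ∈ B.image f, (X - C a) ^ (B.filter fun i => f i = a).card :=
    Finset.prod_comp (fun a => X - C a) f
  have hdvd : ∏ j ∈ B, (X - C (f j)) ∣ g := by
    rw [hprod]
    refine Finset.prod_dvd_of_coprime (fun a _ a' _ haa' => ?_) fun a ha => ?_
    · exact (isCoprime_X_sub_C_of_isUnit_sub (sub_ne_zero.mpr haa').isUnit).pow
    · obtain ⟨j, hj, rfl⟩ := Finset.mem_image.mp ha
      rw [X_sub_C_pow_dvd_iff, X_pow_dvd_iff]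
      exact h j hj
  refine eq_zero_of_dvd_of_degree_lt hdvd ?_
  rw [mem_degreeLT] at hg
  refine hg.trans_eq ?_
  rw [degree_prod]
  simp

open Classical in
/-- Hermite interpolation. -/
theorem exists_taylor_coeff_eq (B : Finset J) (f : J → K) (γ : K → ℕ → K) :
    ∃ g ∈ degreeLT K B.card,
      ∀ j ∈ B, ∀ s < (B.filter fun i => f i = f j).card, (taylor (f j) g).coeff s = γ (f j) s := by
  let I := Σ a : B.image f, Fin (B.filter fun i => f i = a.1).card
  let L : degreeLT K B.card →ₗ[K] (I → K) := LinearMap.pi fun p =>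
    (lcoeff K p.2).comp ((taylor p.1.1).comp (degreeLT K B.card).subtype)
  have hL : ∀ g p, L g p = (taylor p.1.1 g.1).coeff p.2 := fun g p => rfl
  have hinj : Function.Injective L := by
    rw [injective_iff_map_eq_zero]
    intro g hg
    refine Subtype.ext (eq_zero_of_taylor_coeff_eq_zero B f g.2 fun j hj s hs => ?_)
    exact congrFun hg ⟨⟨f j, Finset.mem_image_of_mem f hj⟩, ⟨s, hs⟩⟩
  have hfin : FiniteDimensional K (degreeLT K B.card) :=
    Module.Finite.equiv (degreeLTEquiv K B.card).symm
  have hdim : Module.finrank K (degreeLT K B.card) = Module.finrank K (I → K) := by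
    rw [(degreeLTEquiv K B.card).finrank_eq, Module.finrank_fintype_fun_eq_card,
      Module.finrank_fintype_fun_eq_card, Fintype.card_fin, Fintype.card_sigma]
    simp only [Fintype.card_fin]
    rw [Finset.card_eq_sum_card_image f B]
    exact (Finset.sum_coe_sort (B.image f) fun a => (B.filter fun i => f i = a).card).symm
  obtain ⟨g, hg⟩ := (LinearMap.injective_iff_surjective_of_finrank_eq_finrank hdim).mp hinj
    fun p => γ p.1.1 p.2
  exact ⟨g.1, g.2, fun j hj s hs =>
    congrFun hg ⟨⟨f j, Finset.mem_image_of_mem f hj⟩, ⟨s, hs⟩⟩⟩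

end interpolation

section correspondence

open Polynomial

variable {K J : Type*} [Field K]

open Classical in
/-- The correspondence between families `α` of `#B` vectors in `K ^ d` and vectors `β` in
`K ^ (d * #B)`. The first `#B` entries of `β` are the coefficients of the monic polynomial whose
roots are the first coordinates of the vectors. Over a root `a` of multiplicity `m` lie `m` vectors
of length `d - 1`, which correspond to `d - 1` jets of length `m` at `a`; for all roots together
these are the Taylor expansions of `d - 1` polynomials of degree less than `#B`, whose coefficients
are the other entries of `β`. -/
def Corr : ℕ → Finset J → (ℕ → J → K) → (ℕ → ℕ → K) → Prop
  | 0, _, _, _ => True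
  | d + 1, B, α, β =>
    (∀ s < B.card, (∏ j ∈ B, (X - C (α 0 j))).coeff s = β 0 s) ∧
    ∀ j ∈ B, Corr d (B.filter fun i => α 0 i = α 0 j) (fun i => α (i + 1))
      fun i s => (taylor (α 0 j) (truncPoly B.card (β (i + 1)))).coeff s

open Classical in
theorem Corr.congr {d : ℕ} {B : Finset J} {α α' : ℕ → J → K} {β β' : ℕ → ℕ → K}
    (h : Corr d B α β) (hα : ∀ i < d, ∀ j ∈ B, α i j = α' i j)
    (hβ : ∀ i < d, ∀ s < B.card, β i s = β' i s) : Corr d B α' β' := by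
  induction d generalizing B α α' β β' with
  | zero => trivial
  | succ d ih =>
    obtain ⟨h1, h2⟩ := h
    have h0 : ∀ j ∈ B, α 0 j = α' 0 j := hα 0 d.succ_pos
    refine ⟨fun s hs => ?_, fun j hj => ?_⟩
    · rw [← hβ 0 d.succ_pos s hs, ← h1 s hs]
      congr 1
      exact Finset.prod_congr rfl fun j hj => by rw [h0 j hj]
    · have hB : (B.filter fun i => α' 0 i = α' 0 j) = B.filter fun i => α 0 i = α 0 j :=
        Finset.filter_congr fun i hi => by rw [h0 i hi, h0 j hj]
      rw [hB]
      refine ih (h2 j hj) (fun i hi l hl => ?_) fun i hi s hs => ?_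
      · exact hα (i + 1) (Nat.succ_lt_succ hi) l (Finset.mem_of_mem_filter l hl)
      · rw [← h0 j hj, truncPoly_congr (hβ (i + 1) (Nat.succ_lt_succ hi))]

open Classical in
theorem exists_corr_right (d : ℕ) (B : Finset J) (α : ℕ → J → K) : ∃ β, Corr d B α β := by
  induction d generalizing B α with
  | zero => exact ⟨fun _ _ => 0, trivial⟩
  | succ d ih =>
    choose γ hγ using fun a : K => ih (B.filter fun i => α 0 i = a) fun i => α (i + 1)
    choose g hg hg' using fun i => exists_taylor_coeff_eq B (α 0) fun a => γ a i
    refine ⟨fun i => i.casesOn (fun s => (∏ j ∈ B, (X - C (α 0 j))).coeff s)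
      fun i s => (g i).coeff s, fun _ _ => rfl, fun j hj => ?_⟩
    refine (hγ (α 0 j)).congr (fun _ _ _ _ => rfl) fun i _ s hs => ?_
    change _ = (taylor (α 0 j) (truncPoly B.card fun s => (g i).coeff s)).coeff s
    rw [truncPoly_coeff (hg i), hg' i j hj s hs]

theorem exists_map_eq_of_card_eq {Q : Type*} [Nonempty Q] (B : Finset J) (M : Multiset Q)
    (h : M.card = B.card) : ∃ f : J → Q, B.val.map f = M := by
  classical
  induction B using Finset.induction_on generalizing M with
  | empty =>
    rw [Finset.card_empty, Multiset.card_eq_zero] at h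
    exact ⟨fun _ => Classical.arbitrary Q, by rw [h]; rfl⟩
  | insert a B ha ih =>
    rw [Finset.card_insert_of_notMem ha] at h
    obtain ⟨q, hq⟩ := Multiset.card_pos_iff_exists_mem.mp (by omega : 0 < M.card)
    obtain ⟨M', rfl⟩ := Multiset.exists_cons_of_mem hq
    rw [Multiset.card_cons, Nat.add_right_cancel_iff] at h
    obtain ⟨f, hf⟩ := ih M' h
    refine ⟨Function.update f a q, ?_⟩
    rw [Finset.insert_val_of_notMem ha, Multiset.map_cons, Function.update_self, ← hf]
    congr 1
    refine Multiset.map_congr rfl fun x hx => Function.update_of_ne ?_ _ _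
    rintro rfl
    exact ha hx

/-- The monic polynomial with given lower coefficients. -/
theorem monic_X_pow_add_truncPoly (N : ℕ) (b : ℕ → K) :
    (X ^ N + truncPoly N b).Monic ∧ (X ^ N + truncPoly N b).natDegree = N := by
  have h := mem_degreeLT.mp (truncPoly_mem_degreeLT N b)
  refine ⟨monic_X_pow_add h, natDegree_eq_of_degree_eq_some ?_⟩
  rw [degree_add_eq_left_of_degree_lt, degree_X_pow]
  rwa [degree_X_pow]

theorem eq_X_pow_add_truncPoly {N : ℕ} {p : K[X]} (hp : p.Monic) (hN : p.natDegree = N) :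
    p = X ^ N + truncPoly N p.coeff := by
  ext s
  rw [coeff_add, coeff_X_pow, coeff_truncPoly]
  rcases lt_trichotomy s N with h | rfl | h
  · rw [if_neg h.ne, if_pos h, zero_add]
  · rw [if_pos rfl, if_neg (lt_irrefl _), add_zero, ← hN]
    exact hp
  · rw [if_neg h.ne', if_neg h.not_gt, add_zero]
    exact coeff_eq_zero_of_natDegree_lt (hN ▸ h)

theorem prod_X_sub_C_eq (B : Finset J) (f : J → K) :
    ∏ j ∈ B, (X - C (f j)) = X ^ B.card + truncPoly B.card (∏ j ∈ B, (X - C (f j))).coeff :=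
  eq_X_pow_add_truncPoly (monic_prod_of_monic _ _ fun j _ => monic_X_sub_C (f j)) (by
    rw [natDegree_prod_of_monic _ _ fun j _ => monic_X_sub_C (f j)]
    simp)

theorem roots_prod_X_sub_C' (B : Finset J) (f : J → K) :
    (∏ j ∈ B, (X - C (f j))).roots = B.val.map f := by
  have : ∏ j ∈ B, (X - C (f j)) = ((B.val.map f).map fun a => X - C a).prod := by
    rw [Multiset.map_map]
    rfl
  rw [this, roots_multiset_prod_X_sub_C]

open Classical in
theorem exists_corr_left [IsAlgClosed K] (d : ℕ) (B : Finset J) (β : ℕ → ℕ → K) :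
    ∃ α, Corr d B α β := by
  induction d generalizing B β with
  | zero => exact ⟨fun _ _ => 0, trivial⟩
  | succ d ih =>
    let p : K[X] := X ^ B.card + truncPoly B.card (β 0)
    obtain ⟨hp, hdeg⟩ := monic_X_pow_add_truncPoly B.card (β 0)
    have hs : p.Splits := IsAlgClosed.splits p
    obtain ⟨f, hf⟩ := exists_map_eq_of_card_eq B p.roots (by
      rw [← hs.natDegree_eq_card_roots]
      exact hdeg)
    have hprod : ∏ j ∈ B, (X - C (f j)) = p := by
      rw [hs.eq_prod_roots_of_monic hp, ← hf, Multiset.map_map]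
      rfl
    choose τ hτ using fun a : K => ih (B.filter fun i => f i = a)
      fun i s => (taylor a (truncPoly B.card (β (i + 1)))).coeff s
    refine ⟨fun i => i.casesOn f fun i j => τ (f j) i j, fun s hs => ?_, fun j hj => ?_⟩
    · change (∏ j ∈ B, (X - C (f j))).coeff s = _
      rw [hprod, coeff_add, coeff_X_pow, if_neg hs.ne, coeff_truncPoly, if_pos hs, zero_add]
    · refine (hτ (f j)).congr (fun i _ l hl => ?_) fun _ _ _ _ => rfl
      change τ (f j) i l = τ (f l) i l
      rw [(Finset.mem_filter.mp hl).2]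

/-- The multiset of the vectors of length `d` given by the columns of `α`. -/
def vectors (d : ℕ) (B : Finset J) (α : ℕ → J → K) : Multiset (Fin d → K) :=
  B.val.map fun j i => α i j

omit [Field K] in
theorem card_vectors (d : ℕ) (B : Finset J) (α : ℕ → J → K) : (vectors d B α).card = B.card := by
  simp [vectors]

omit [Field K] in
open Classical in
theorem count_vectors_succ (d : ℕ) (B : Finset J) (α : ℕ → J → K) (v : Fin (d + 1) → K) :
    (vectors (d + 1) B α).count v =
      (vectors d (B.filter fun j => α 0 j = v 0) fun i => α (i + 1)).count (Fin.tail v) := by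
  rw [vectors, vectors, Multiset.count_map, Multiset.count_map, ← Finset.filter_val,
    ← Finset.filter_val, Finset.filter_filter]
  congr 2
  ext j
  simp only [Finset.mem_filter, funext_iff, Fin.forall_fin_succ, Fin.tail]
  simp [eq_comm]

omit [Field K] in
open Classical in
theorem vectors_succ_eq_iff (d : ℕ) (B B' : Finset J) (α α' : ℕ → J → K) :
    vectors (d + 1) B α = vectors (d + 1) B' α' ↔
      ∀ a, vectors d (B.filter fun j => α 0 j = a) (fun i => α (i + 1)) =
        vectors d (B'.filter fun j => α' 0 j = a) fun i => α' (i + 1) := by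
  constructor
  · intro h a
    ext t
    have h1 := count_vectors_succ d B α (Fin.cons a t)
    have h2 := count_vectors_succ d B' α' (Fin.cons a t)
    rw [h, h2] at h1
    simpa using h1.symm
  · intro h
    ext v
    rw [count_vectors_succ, count_vectors_succ, h]

omit [Field K] in
open Classical in
theorem map_eq_map_iff_card_filter (B B' : Finset J) (f f' : J → K) :
    B.val.map f = B'.val.map f' ↔
      ∀ a, (B.filter fun j => f j = a).card = (B'.filter fun j => f' j = a).card := by
  rw [Multiset.ext]
  refine forall_congr' fun a => ?_
  rw [Multiset.count_map, Multiset.count_map, ← Finset.filter_val, ← Finset.filter_val]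
  simp only [eq_comm (a := a)]
  rfl

open Classical in
/-- The correspondence induces an injective map on multisets of vectors. -/
theorem Corr.vectors_eq_iff {d : ℕ} {B B' : Finset J} {α α' : ℕ → J → K} {β β' : ℕ → ℕ → K}
    (h : Corr d B α β) (h' : Corr d B' α' β') (hB : B.card = B'.card) :
    vectors d B α = vectors d B' α' ↔ ∀ i < d, ∀ s < B.card, β i s = β' i s := by
  induction d generalizing B B' α α' β β' with
  | zero =>
    refine ⟨fun _ i hi => absurd hi (Nat.not_lt_zero i), fun _ => ?_⟩
    have key : ∀ (B : Finset J) (α : ℕ → J → K),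
        vectors 0 B α = Multiset.replicate B.card Fin.elim0 := fun B α =>
      Multiset.eq_replicate.mpr ⟨card_vectors 0 B α, fun _ _ => Subsingleton.elim _ _⟩
    rw [key, key, hB]
  | succ d ih =>
    obtain ⟨h1, h2⟩ := h
    obtain ⟨h1', h2'⟩ := h'
    -- comparison over a common value `a` of the first coordinate
    have step : ∀ a, (B.filter fun j => α 0 j = a).card = (B'.filter fun j => α' 0 j = a).card →
        (vectors d (B.filter fun j => α 0 j = a) (fun i => α (i + 1)) =
          vectors d (B'.filter fun j => α' 0 j = a) (fun i => α' (i + 1)) ↔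
        ∀ i < d, ∀ s < (B.filter fun j => α 0 j = a).card,
          (taylor a (truncPoly B.card (β (i + 1)))).coeff s =
            (taylor a (truncPoly B.card (β' (i + 1)))).coeff s) := by
      intro a ha
      rcases (B.filter fun j => α 0 j = a).eq_empty_or_nonempty with he | ⟨j, hj⟩
      · have he' : (B'.filter fun j => α' 0 j = a) = ∅ := by
          rw [← Finset.card_eq_zero, ← ha, he, Finset.card_empty]
        rw [he, he']
        simp [vectors]
      · obtain ⟨j', hj'⟩ : (B'.filter fun j => α' 0 j = a).Nonempty := by
          rw [← Finset.card_pos, ← ha]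
          exact Finset.card_pos.mpr ⟨j, hj⟩
        rw [Finset.mem_filter] at hj hj'
        have c := h2 j hj.1
        have c' := h2' j' hj'.1
        rw [hj.2] at c
        rw [hj'.2, ← hB] at c'
        exact ih c c' ha
    rw [vectors_succ_eq_iff]
    constructor
    · intro hv
      have hcard : ∀ a, (B.filter fun j => α 0 j = a).card =
          (B'.filter fun j => α' 0 j = a).card := fun a => by
        rw [← card_vectors d _ fun i => α (i + 1), hv a, card_vectors]
      intro i hi s hs
      cases i with
      | zero =>
        rw [← h1 s hs, ← h1' s (hB ▸ hs)]
        have := (map_eq_map_iff_card_filter B B' (α 0) (α' 0)).mpr hcard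
        have hp := congrArg (fun M : Multiset K => (M.map fun a => X - C a).prod) this
        simp only [Multiset.map_map] at hp
        exact congrArg (fun p : K[X] => p.coeff s) hp
      | succ i =>
        have hi' : i < d := Nat.lt_of_succ_lt_succ hi
        have hz : truncPoly B.card (β (i + 1)) - truncPoly B.card (β' (i + 1)) = 0 := by
          refine eq_zero_of_taylor_coeff_eq_zero B (α 0)
            (Submodule.sub_mem _ (truncPoly_mem_degreeLT _ _) (truncPoly_mem_degreeLT _ _))
            fun j hj s hs => ?_
          rw [map_sub, coeff_sub, sub_eq_zero]
          exact (step (α 0 j) (hcard _)).mp (hv _) i hi' s hs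
        have := congrArg (fun p : K[X] => p.coeff s) (sub_eq_zero.mp hz)
        simpa [coeff_truncPoly, hs] using this
    · intro hβ a
      have hroots : B.val.map (α 0) = B'.val.map (α' 0) := by
        rw [← roots_prod_X_sub_C', ← roots_prod_X_sub_C', prod_X_sub_C_eq B, prod_X_sub_C_eq B',
          ← hB]
        congr 2
        refine truncPoly_congr fun s hs => ?_
        rw [h1 s hs, h1' s (hB ▸ hs), hβ 0 d.succ_pos s hs]
      refine (step a ((map_eq_map_iff_card_filter _ _ _ _).mp hroots a)).mpr fun i hi s _ => ?_
      rw [truncPoly_congr (hβ (i + 1) (Nat.succ_lt_succ hi))]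

end correspondence

end

section

variable {k : Type u} [Field k]

/-! ### Symmetric powers of affine space -/

section values

variable {Y Z : SchOver k} {Ω : GeomPt k}

/-- The values of the global functions of a scheme at a geometric point. -/
noncomputable def evalPt (y : Ω.pt ⟶ Y) : Γ(Y.left, ⊤) →+* Ω.K :=
  (Scheme.ΓSpecIso (CommRingCat.of Ω.K)).hom.hom.comp
    (Scheme.Hom.appTop (X := Spec (CommRingCat.of Ω.K)) y.left).hom

theorem evalPt_appTop (y : Ω.pt ⟶ Y) (g : Y ⟶ Z) (f : Γ(Z.left, ⊤)) :
    evalPt y (g.left.appTop f) = evalPt (y ≫ g) f := by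
  simp only [evalPt, RingHom.comp_apply]
  rfl

theorem im_mem_basicOpen_iff (y : Ω.pt ⟶ Y) (f : Γ(Y.left, ⊤)) :
    GeomPt.im y ∈ Y.left.basicOpen f ↔ evalPt y f ≠ 0 := by
  let y' : Spec (CommRingCat.of Ω.K) ⟶ Y.left := y.left
  let e := (Scheme.ΓSpecIso (CommRingCat.of Ω.K)).commRingCatIsoToRingEquiv
  have h1 : GeomPt.im y ∈ Y.left.basicOpen f ↔
      Ω.closedPt ∈ (Spec (CommRingCat.of Ω.K)).basicOpen (y'.appTop f) := by
    rw [← Scheme.preimage_basicOpen_top]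
    rfl
  have h2 : evalPt y f = e (y'.appTop f) := rfl
  rw [h1, h2]
  rcases eq_or_ne (e (y'.appTop f)) 0 with h | h
  · rw [EmbeddingLike.map_eq_zero_iff] at h
    rw [h, Scheme.basicOpen_zero]
    simp
  · have : IsUnit (y'.appTop f) := (MulEquiv.isUnit_map e).mp h.isUnit
    rw [Scheme.basicOpen_of_isUnit _ this]
    simp [h]

end values

section definable

open Topology

/-- A property of geometric points is definable if it says that the underlying topological point
belongs to a fixed constructible set. -/
def Definable (Y : FTScheme k) (P : ∀ Ω : GeomPt k, (Ω.pt ⟶ Y.obj) → Prop) : Prop :=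
  ∃ C : Set Y.obj.left, IsConstructible C ∧ ∀ Ω y, P Ω y ↔ GeomPt.im y ∈ C

variable {Y : FTScheme k} {P P' : ∀ Ω : GeomPt k, (Ω.pt ⟶ Y.obj) → Prop}

theorem Definable.congr (h : Definable Y P) (h' : ∀ Ω y, P' Ω y ↔ P Ω y) : Definable Y P' := by
  obtain ⟨C, hC, hP⟩ := h
  exact ⟨C, hC, fun Ω y => (h' Ω y).trans (hP Ω y)⟩

theorem definable_true : Definable Y fun _ _ => True :=
  ⟨Set.univ, .univ, fun _ _ => by simp⟩

theorem Definable.not (h : Definable Y P) : Definable Y fun Ω y => ¬ P Ω y := by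
  obtain ⟨C, hC, hP⟩ := h
  exact ⟨Cᶜ, hC.compl, fun Ω y => not_congr (hP Ω y)⟩

theorem Definable.and (h : Definable Y P) (h' : Definable Y P') :
    Definable Y fun Ω y => P Ω y ∧ P' Ω y := by
  obtain ⟨C, hC, hP⟩ := h
  obtain ⟨C', hC', hP'⟩ := h'
  exact ⟨C ∩ C', hC.inter hC', fun Ω y => and_congr (hP Ω y) (hP' Ω y)⟩

theorem definable_forall {I : Type*} (A : Finset I) {P : I → ∀ Ω : GeomPt k, (Ω.pt ⟶ Y.obj) → Prop}
    (h : ∀ i ∈ A, Definable Y (P i)) : Definable Y fun Ω y => ∀ i ∈ A, P i Ω y := by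
  classical
  induction A using Finset.induction_on with
  | empty => exact definable_true.congr (by simp)
  | insert i A _ ih =>
    exact ((h i (Finset.mem_insert_self i A)).and
      (ih fun j hj => h j (Finset.mem_insert_of_mem hj))).congr (by simp)

theorem definable_exists {I : Type*} (A : Finset I) {P : I → ∀ Ω : GeomPt k, (Ω.pt ⟶ Y.obj) → Prop}
    (h : ∀ i ∈ A, Definable Y (P i)) : Definable Y fun Ω y => ∃ i ∈ A, P i Ω y :=
  (definable_forall A fun i hi => (h i hi).not).not.congr (by simp)

theorem definable_eq (f g : Γ(Y.obj.left, ⊤)) :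
    Definable Y fun _ y => evalPt y f = evalPt y g := by
  have hU : IsConstructible (Y.obj.left.basicOpen (f - g) : Set Y.obj.left) :=
    IsRetrocompact.isConstructible (Y.obj.left.basicOpen (f - g)).isOpen
      fun _ _ _ => TopologicalSpace.NoetherianSpace.isCompact _
  refine ⟨_, hU.compl, fun Ω y => ?_⟩
  rw [Set.mem_compl_iff, SetLike.mem_coe, im_mem_basicOpen_iff, map_sub, not_not, sub_eq_zero]

open Classical Polynomial in
/-- The correspondence between families of vectors and vectors is given by a constructible set. -/
theorem definable_corr {J : Type*} (d : ℕ) (B : Finset J) (a : ℕ → J → Γ(Y.obj.left, ⊤))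
    (b : ℕ → ℕ → Γ(Y.obj.left, ⊤)) :
    Definable Y fun _ y => Corr d B (fun i j => evalPt y (a i j)) fun i s => evalPt y (b i s) := by
  induction d generalizing B a b with
  | zero => exact definable_true
  | succ d ih =>
    let b' (j : J) (i s : ℕ) : Γ(Y.obj.left, ⊤) :=
      (taylor (a 0 j) (truncPoly B.card (b (i + 1)))).coeff s
    refine ((definable_forall (Finset.range B.card) fun s _ =>
      definable_eq (Y := Y) ((∏ j ∈ B, (X - C (a 0 j))).coeff s) (b 0 s)).and
      (definable_forall B fun j _ => definable_exists B.powerset fun A _ =>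
        (definable_forall B (P := fun i _ y => i ∈ A ↔ evalPt y (a 0 i) = evalPt y (a 0 j))
          fun i _ => ?_).and (ih A (fun i => a (i + 1)) (b' j)))).congr fun Ω y => ?_
    · by_cases hi : i ∈ A
      · exact (definable_eq (a 0 i) (a 0 j)).congr (by simp [hi])
      · exact (definable_eq (a 0 i) (a 0 j)).not.congr (by simp [hi])
    · have e1 : ∀ s, evalPt y ((∏ j ∈ B, (X - C (a 0 j))).coeff s) =
          (∏ j ∈ B, (X - C (evalPt y (a 0 j)))).coeff s := fun s => by
        rw [← coeff_map, Polynomial.map_prod]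
        simp
      have e2 : ∀ j i s, evalPt y (b' j i s) = (taylor (evalPt y (a 0 j))
          (truncPoly B.card fun s => evalPt y (b (i + 1) s))).coeff s := fun j i s => by
        rw [← map_truncPoly, ← map_taylor, coeff_map]
      simp only [e1, e2, Finset.mem_range, Corr]
      refine and_congr Iff.rfl (forall₂_congr fun j _ => ?_)
      constructor
      · intro h
        exact ⟨_, Finset.mem_powerset.mpr (Finset.filter_subset _ _),
          fun i hi => by simp [hi], h⟩
      · rintro ⟨A, hA, hA', h⟩
        have : (B.filter fun i => evalPt y (a 0 i) = evalPt y (a 0 j)) = A := by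
          ext i
          rw [Finset.mem_filter]
          exact ⟨fun hi => (hA' i hi.1).mpr hi.2, fun hi =>
            ⟨Finset.mem_powerset.mp hA hi, (hA' i (Finset.mem_powerset.mp hA hi)).mp hi⟩⟩
        rwa [this]

end definable

section affine

variable {N : ℕ}

/-- The morphism to affine space given by functions. -/
noncomputable def toAffineSpace {Y : SchOver k} (f : Fin N → Γ(Y.left, ⊤)) :
    Y ⟶ (affineSpace k N).obj :=
  Over.homMk (AffineSpace.homOfVector Y.hom fun i => f i.down) (AffineSpace.homOfVector_over _ _)

/-- The coordinate functions of affine space. -/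
noncomputable def affineCoord (i : Fin N) : Γ((affineSpace k N).obj.left, ⊤) :=
  AffineSpace.coord (Spec (CommRingCat.of k)) (ULift.up i)

/-- The coordinates of a geometric point of affine space. -/
noncomputable def affineVec {Ω : GeomPt k} (y : Ω.pt ⟶ (affineSpace k N).obj) (i : Fin N) : Ω.K :=
  evalPt y (affineCoord i)

theorem affineVec_toAffineSpace {Y : SchOver k} (f : Fin N → Γ(Y.left, ⊤)) {Ω : GeomPt k}
    (y : Ω.pt ⟶ Y) (i : Fin N) : affineVec (y ≫ toAffineSpace f) i = evalPt y (f i) := by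
  rw [affineVec, ← evalPt_appTop]
  congr 1
  exact AffineSpace.homOfVector_appTop_coord _ _ _

theorem affineVec_bijective {Ω : GeomPt k} :
    Function.Bijective (affineVec : (Ω.pt ⟶ (affineSpace k N).obj) → Fin N → Ω.K) := by
  constructor
  · intro y y' h
    ext1
    refine AffineSpace.hom_ext ((Over.w y).trans (Over.w y').symm) fun i => ?_
    exact (Scheme.ΓSpecIso (CommRingCat.of Ω.K)).commRingCatIsoToRingEquiv.injective
      (congrFun h i.down)
  · intro v
    refine ⟨𝟙 _ ≫ toAffineSpace fun i => (Scheme.ΓSpecIso (CommRingCat.of Ω.K)).inv (v i), ?_⟩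
    funext i
    rw [affineVec_toAffineSpace]
    simp [evalPt]

theorem cls_affineSpace (N : ℕ) : cls (affineSpace k N) = lefschetz k ^ N := by
  induction N with
  | zero =>
    rw [pow_zero, ← cls_one (FTScheme.point k) (inferInstanceAs (IsIso (𝟙 _)))]
    refine cls_eq_of_geomPt_bijective (Z := FTScheme.point k)
      (Over.homMk (affineSpace k 0).obj.hom (Category.comp_id _)) fun Ω => ⟨fun y y' _ => ?_,
        fun q => ?_⟩
    · exact affineVec_bijective.1 (Subsingleton.elim _ _)
    · obtain ⟨y, -⟩ := affineVec_bijective.2 (Fin.elim0 : Fin 0 → Ω.K)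
      refine ⟨y, ?_⟩
      ext1
      exact (Over.w _).trans (Over.w q).symm
  | succ N ih =>
    rw [pow_succ, ← ih, lefschetz, cls_mul]
    let T := (affineSpace k N).prod (affineSpace k 1)
    let f : Fin (N + 1) → Γ(T.obj.left, ⊤) := Fin.snoc (α := fun _ => Γ(T.obj.left, ⊤))
      (fun i => ((affineSpace k N).fst (affineSpace k 1)).left.appTop (affineCoord i))
      (((affineSpace k N).snd (affineSpace k 1)).left.appTop (affineCoord 0))
    have h1 : ∀ (Ω : GeomPt k) (y : Ω.pt ⟶ T.obj) (i : Fin N),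
        affineVec (y ≫ toAffineSpace f) i.castSucc =
          affineVec (y ≫ (affineSpace k N).fst (affineSpace k 1)) i := fun Ω y i => by
      rw [affineVec_toAffineSpace]
      simp only [f, Fin.snoc_castSucc]
      exact evalPt_appTop _ _ _
    have h2 : ∀ (Ω : GeomPt k) (y : Ω.pt ⟶ T.obj),
        affineVec (y ≫ toAffineSpace f) (Fin.last N) =
          affineVec (y ≫ (affineSpace k N).snd (affineSpace k 1)) 0 := fun Ω y => by
      rw [affineVec_toAffineSpace]
      simp only [f, Fin.snoc_last]
      exact evalPt_appTop _ _ _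
    refine (cls_eq_of_geomPt_bijective (toAffineSpace f) fun Ω => ⟨fun y y' h => ?_,
      fun z => ?_⟩).symm
    · dsimp only at h
      refine FTScheme.prod_ext (affineVec_bijective.1 (funext fun i => ?_))
        (affineVec_bijective.1 (funext fun i => ?_))
      · rw [← h1, ← h1, h]
      · rw [Subsingleton.elim i 0, ← h2, ← h2, h]
    · obtain ⟨y, hy⟩ := affineVec_bijective.2 fun i : Fin N => affineVec z i.castSucc
      obtain ⟨y', hy'⟩ := affineVec_bijective.2 fun _ : Fin 1 => affineVec z (Fin.last N)
      refine ⟨FTScheme.lift y y', affineVec_bijective.1 (funext fun i => ?_)⟩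
      refine Fin.lastCases ?_ (fun i => ?_) i
      · exact (h2 Ω _).trans (by rw [FTScheme.lift_snd, hy'])
      · exact (h1 Ω _ i).trans (by rw [FTScheme.lift_fst, hy])

theorem isSeparated_affineSpace (d : ℕ) : IsSeparated (affineSpace k d).obj.hom := by
  have : IsAffineHom (affineSpace k d).obj.hom :=
    inferInstanceAs (IsAffineHom (𝔸(ULift.{u} (Fin d); Spec (CommRingCat.of k)) ↘ _))
  infer_instance

/-- The symmetric powers of affine space have the classes of affine spaces. The correspondence
`Corr` is a constructible subset `S` of `(𝔸ᵈ)ⁿ × 𝔸ᵈⁿ` that maps onto both factors on geometric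
points, and two points of `S` have the same image in `𝔸ᵈⁿ` iff their images in `(𝔸ᵈ)ⁿ` are equal up
to a permutation. -/
theorem symClass_affineSpace (d n : ℕ) :
    symClass (affineSpace k d).obj n = lefschetz k ^ (d * n) := by
  classical
  let A := affineSpace k d
  let T := affineSpace k (d * n)
  have hA : IsSeparated A.obj.hom := isSeparated_affineSpace d
  obtain ⟨_, _, _⟩ := A.finiteType_power hA (Fin n)
  let W : FTScheme k := ⟨power A.obj (Fin n)⟩
  let a (i : ℕ) (j : Fin n) : Γ((W.prod T).obj.left, ⊤) :=
    if h : i < d then (W.fst T ≫ Pi.π (fun _ => A.obj) j).left.appTop (affineCoord ⟨i, h⟩) else 0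
  let b (i s : ℕ) : Γ((W.prod T).obj.left, ⊤) :=
    if h : i < d ∧ s < n then
      (W.snd T).left.appTop (affineCoord (finProdFinEquiv (⟨i, h.1⟩, ⟨s, h.2⟩))) else 0
  have ha : ∀ {Ω : GeomPt k} (y : Ω.pt ⟶ (W.prod T).obj) (i : Fin d) (j : Fin n),
      evalPt y (a i j) = affineVec (coord (X := A.obj) (y ≫ W.fst T) j) i := fun y i j => by
    simp only [a, i.2, dite_true]
    rw [evalPt_appTop, ← Category.assoc]
    rfl
  have hb : ∀ {Ω : GeomPt k} (y : Ω.pt ⟶ (W.prod T).obj) (i : Fin d) (s : Fin n),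
      evalPt y (b i s) = affineVec (y ≫ W.snd T) (finProdFinEquiv (i, s)) := fun y i s => by
    simp only [b, i.2, s.2, and_self, dite_true]
    rw [evalPt_appTop]
    rfl
  obtain ⟨C, hC, hC'⟩ := definable_corr (Y := W.prod T) d Finset.univ a b
  obtain ⟨S, _, ι, _, hS'⟩ := exists_geomPt_of_isConstructible hC (W.prod T) (𝟙 _)
  have hS : ∀ {Ω : GeomPt k} (y : Ω.pt ⟶ (W.prod T).obj), (∃ s, s ≫ ι = y) ↔
      Corr d Finset.univ (fun i j => evalPt y (a i j)) fun i s => evalPt y (b i s) := fun y => by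
    have h := ((hS' _).2.2 y).1
    rw [Category.comp_id] at h
    exact h.trans (hC' _ y).symm
  rw [← cls_affineSpace]
  refine hasClass_cycle_unique A (p := fun _ _ => True) (hasClass_sym A hA n)
    ⟨S, T, ι ≫ W.fst T, ι ≫ W.snd T, rfl, fun Ω => ⟨fun _ => trivial, fun x _ => ?_, fun q => ?_,
      fun s s' => ?_⟩⟩
  · obtain ⟨β, hβ⟩ := exists_corr_right d Finset.univ fun i (j : Fin n) =>
      if h : i < d then affineVec (coord x j) ⟨i, h⟩ else 0
    obtain ⟨q, hq⟩ := affineVec_bijective.2 fun l : Fin (d * n) =>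
      β (finProdFinEquiv.symm l).1 (finProdFinEquiv.symm l).2
    have hy := (hS (FTScheme.lift (Y := W) x q)).mpr (hβ.congr (fun i hi j _ => ?_)
      fun i hi s hs => ?_)
    · obtain ⟨s, hs⟩ := hy
      refine ⟨s, ?_⟩
      rw [← Category.assoc, hs, FTScheme.lift_fst]
    · rw [ha _ ⟨i, hi⟩, FTScheme.lift_fst, dif_pos hi]
    · rw [Finset.card_univ, Fintype.card_fin] at hs
      rw [hb _ ⟨i, hi⟩ ⟨s, hs⟩, FTScheme.lift_snd, hq]
      dsimp only
      rw [Equiv.symm_apply_apply]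
  · obtain ⟨α, hα⟩ := exists_corr_left d (Finset.univ : Finset (Fin n)) fun i s =>
      if h : i < d ∧ s < n then affineVec q (finProdFinEquiv (⟨i, h.1⟩, ⟨s, h.2⟩)) else 0
    choose x hx using fun j => affineVec_bijective.2 fun i : Fin d => α i j
    obtain ⟨x, rfl⟩ := exists_coord_eq x
    have hy := (hS (FTScheme.lift (Y := W) x q)).mpr (hα.congr (fun i hi j _ => ?_)
      fun i hi s hs => ?_)
    · obtain ⟨s, hs⟩ := hy
      refine ⟨s, ?_⟩
      rw [← Category.assoc, hs, FTScheme.lift_snd]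
    · rw [ha _ ⟨i, hi⟩, FTScheme.lift_fst, hx]
    · rw [Finset.card_univ, Fintype.card_fin] at hs
      rw [hb _ ⟨i, hi⟩ ⟨s, hs⟩, FTScheme.lift_snd, dif_pos ⟨hi, hs⟩]
  · have key := ((hS _).mp ⟨s, rfl⟩).vectors_eq_iff ((hS _).mp ⟨s', rfl⟩) rfl
    have hvec : ∀ s : Ω.pt ⟶ S.obj, vectors d Finset.univ (fun i j => evalPt (s ≫ ι) (a i j)) =
        (Finsupp.toMultiset (cycle 1 (coord (X := A.obj) (s ≫ ι ≫ W.fst T)))).map affineVec := by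
      intro s
      rw [toMultiset_cycle_one, Multiset.map_map, vectors]
      refine Multiset.map_congr rfl fun j _ => funext fun i => ?_
      rw [ha, Category.assoc]
      rfl
    rw [hvec, hvec, (Multiset.map_injective affineVec_bijective.1).eq_iff,
      (Function.LeftInverse.injective Finsupp.toMultiset_toFinsupp).eq_iff] at key
    rw [key, ← affineVec_bijective.1.eq_iff]
    constructor
    · intro h i hi l hl
      rw [Finset.card_univ, Fintype.card_fin] at hl
      rw [hb _ ⟨i, hi⟩ ⟨l, hl⟩, hb _ ⟨i, hi⟩ ⟨l, hl⟩, Category.assoc, Category.assoc, h]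
    · intro h
      funext l
      obtain ⟨⟨i, l⟩, rfl⟩ := finProdFinEquiv.surjective l
      have := h i i.2 l (by simp)
      rwa [hb, hb, Category.assoc, Category.assoc] at this

end affine

end

section

variable {k : Type u} [Field k]

/-! ### The case of affine space -/

section geometric

variable {R : Type*} [CommRing R]

theorem eq_recip_of_mul_eq_one {f g : R⟦X⟧} (hf : PowerSeries.constantCoeff f = 1)
    (h : f * g = 1) : g = recip f := by
  have h' : f * recip f = 1 := PowerSeries.mul_invOfUnit f 1 (by simpa using hf)
  calc g = g * (f * recip f) := by rw [h', mul_one]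
    _ = recip f := by rw [← mul_assoc, mul_comm g, h, one_mul]

theorem one_sub_C_mul_X_mul_mk (M : R) :
    (1 - PowerSeries.C M * PowerSeries.X) * PowerSeries.mk (fun n => M ^ n) = 1 := by
  ext n
  rw [sub_mul, one_mul, mul_assoc, map_sub, PowerSeries.coeff_C_mul, PowerSeries.coeff_mk]
  cases n with
  | zero => simp
  | succ n => rw [PowerSeries.coeff_succ_X_mul, PowerSeries.coeff_mk, ← pow_succ', sub_self,
      PowerSeries.coeff_one, if_neg n.succ_ne_zero]

theorem mk_pow_eq_recip (M : R) :
    PowerSeries.mk (fun n => M ^ n) = recip (1 - PowerSeries.C M * PowerSeries.X) :=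
  eq_recip_of_mul_eq_one (by simp) (one_sub_C_mul_X_mul_mk M)

theorem recip_substPow_mk_pow (M : R) {a : ℕ} (ha : 0 < a) :
    recip (substPow (PowerSeries.mk fun n => M ^ n) a) =
      1 - PowerSeries.C M * PowerSeries.X ^ a := by
  have hs : PowerSeries.HasSubst (PowerSeries.X ^ a : R⟦X⟧) := PowerSeries.HasSubst.X_pow ha.ne'
  refine (eq_recip_of_mul_eq_one ?_ ?_).symm
  · rw [substPow, PowerSeries.constantCoeff_subst_X_pow ha.ne']
    simp
  · have h := congrArg (PowerSeries.subst (PowerSeries.X ^ a : R⟦X⟧))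
      (one_sub_C_mul_X_mul_mk M)
    rw [← PowerSeries.coe_substAlgHom hs, map_mul, map_sub, map_mul, map_one,
      PowerSeries.coe_substAlgHom hs, PowerSeries.subst_X hs] at h
    have hC : PowerSeries.subst (PowerSeries.X ^ a : R⟦X⟧) (PowerSeries.C M) =
        PowerSeries.C M := by
      rw [← PowerSeries.coe_substAlgHom hs]
      exact (PowerSeries.substAlgHom hs).commutes M
    rw [hC] at h
    rw [mul_comm]
    exact h

theorem one_sub_mul_geom_sum (M : R) (b r : ℕ) :
    (1 - PowerSeries.C M * PowerSeries.X ^ b) *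
      (∑ i ∈ Finset.range r, PowerSeries.C (M ^ i) * PowerSeries.X ^ (b * i)) =
        1 - PowerSeries.C (M ^ r) * PowerSeries.X ^ (r * b) := by
  have h := mul_neg_geom_sum (PowerSeries.C M * PowerSeries.X ^ b) r
  simp only [mul_pow, ← pow_mul, ← map_pow] at h
  rw [h, mul_comm b r]

end geometric

theorem zeta_affineSpace (d : ℕ) :
    zeta (affineSpace k d).obj = PowerSeries.mk fun n => (lefschetz k ^ d) ^ n := by
  ext n
  rw [zeta, PowerSeries.coeff_mk, PowerSeries.coeff_mk, symClass_affineSpace, pow_mul]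

theorem KBar_affineSpace (d : ℕ) {a b : ℕ} (r : ℕ) (ha : 1 < a) (hab : a ≤ b) :
    KBar (affineSpace k d).obj (a ::ₘ Multiset.replicate r b) =
      PowerSeries.C ((lefschetz k ^ d) ^ (r + 1)) *
        zeta (affineSpace k d).obj := by
  apply PowerSeries.X_pow_mul_cancel (k := a + r * b)
  have ha' : 0 < a := Nat.zero_lt_of_lt ha
  rw [X_pow_mul_KBar_eq' _ (isSeparated_affineSpace d) r ha hab, zeta_affineSpace,
    recip_substPow_mk_pow _ ha', recip_substPow_mk_pow _ (ha'.trans_le hab)]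
  have hS : ∀ n, symClass (affineSpace k d).obj n = (lefschetz k ^ d) ^ n := fun n => by
    rw [symClass_affineSpace, pow_mul]
  simp only [hS]
  rw [mul_assoc _ _ (Finset.sum _ _), one_sub_mul_geom_sum, pow_succ, map_mul, pow_add]
  ring

theorem IsGeomIrredVariety.exists_obj_eq {X : SchOver k} (hX : IsGeomIrredVariety X) :
    ∃ Y : FTScheme k, Y.obj = X :=
  ⟨@FTScheme.mk k _ X hX.locallyOfFiniteType hX.quasiCompact, rfl⟩

end

end MotivicConf

theorem proposition5p13 {k : Type u} [Field k] (a b r : ℕ) (ha : 1 < a) (hab : a ≤ b) :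
    (∀ X : MotivicConf.SchOver k, MotivicConf.IsGeomIrredVariety X →
      PowerSeries.constantCoeff (MotivicConf.zeta X) = 1 ∧
      ((MotivicConf.KBar X (a ::ₘ Multiset.replicate r b) :
          (MotivicConf.GrothendieckRing k)⟦X⟧) : (MotivicConf.GrothendieckRing k)⸨X⸩) =
        ((MotivicConf.KBar X (Multiset.replicate r b) :
          (MotivicConf.GrothendieckRing k)⟦X⟧) : (MotivicConf.GrothendieckRing k)⸨X⸩) *
            MotivicConf.tPow (-(a : ℤ)) -
        ((MotivicConf.zeta X * MotivicConf.recip (MotivicConf.substPow (MotivicConf.zeta X) a) *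
            PowerSeries.C (MotivicConf.symClass X r) :
          (MotivicConf.GrothendieckRing k)⟦X⟧) : (MotivicConf.GrothendieckRing k)⸨X⸩) *
            MotivicConf.tPow (-(a : ℤ)) ∧
      ((MotivicConf.KBar X (a ::ₘ Multiset.replicate r b) :
          (MotivicConf.GrothendieckRing k)⟦X⟧) : (MotivicConf.GrothendieckRing k)⸨X⸩) =
        MotivicConf.tPow (-(a : ℤ) - (r : ℤ) * (b : ℤ)) *
          ((MotivicConf.zeta X -
            MotivicConf.zeta X * MotivicConf.recip (MotivicConf.substPow (MotivicConf.zeta X) b) *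
              (∑ i ∈ Finset.range r,
                PowerSeries.C (MotivicConf.symClass X i) * PowerSeries.X ^ (b * i)) -
            MotivicConf.zeta X * MotivicConf.recip (MotivicConf.substPow (MotivicConf.zeta X) a) *
              PowerSeries.C (MotivicConf.symClass X r) * PowerSeries.X ^ (r * b) :
          (MotivicConf.GrothendieckRing k)⟦X⟧) : (MotivicConf.GrothendieckRing k)⸨X⸩)) ∧
    (∀ d : ℕ,
      MotivicConf.zeta (MotivicConf.affineSpace k d).obj =
        MotivicConf.recip
          (1 - PowerSeries.C (MotivicConf.lefschetz k ^ d) * PowerSeries.X) ∧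
      MotivicConf.KBar (MotivicConf.affineSpace k d).obj (a ::ₘ Multiset.replicate r b) =
        PowerSeries.C ((MotivicConf.lefschetz k ^ d) ^ (r + 1)) *
          MotivicConf.recip
            (1 - PowerSeries.C (MotivicConf.lefschetz k ^ d) * PowerSeries.X)) := by
  refine ⟨fun X hX => ?_, fun d => ?_⟩
  · have h0 := hX.isSeparated
    obtain ⟨X, rfl⟩ := hX.exists_obj_eq
    refine ⟨MotivicConf.constantCoeff_zeta X h0, ?_, ?_⟩
    · rw [← sub_mul, ← map_sub, ← MotivicConf.X_pow_mul_KBar_eq X h0 r ha hab,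
        MotivicConf.coe_X_pow_mul_tPow]
    · rw [← MotivicConf.X_pow_mul_KBar_eq' X h0 r ha hab, mul_comm]
      have e : -(a : ℤ) - r * b = -((a + r * b : ℕ) : ℤ) := by
        push_cast
        ring
      rw [e, MotivicConf.coe_X_pow_mul_tPow]
  · rw [MotivicConf.KBar_affineSpace d r ha hab, MotivicConf.zeta_affineSpace,
      MotivicConf.mk_pow_eq_recip]
    exact ⟨rfl, rfl⟩
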